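/- An instance of single-block $\varepsilon$-Consensus-Halving consists of $\varepsilon>0$ and $n\ge 1$ agents; agent $i$ has a block $(a_i,b_i)$ with $0\le a_i<b_i\le 1$, and its valuation $\mu_i$ is the probability measure with density $f_i=\frac{1}{b_i-a_i}$ on $(a_i,b_i)$ and $f_i=0$ elsewhere. A solution is a set of at most $n$ cuts in $[0,1]$ such that, when the pieces into which they split $[0,1]$ are labelled alternately $+$ and $-$, and $I^+$, $I^-$ denote the unions of the pieces with the respective label, $|\mu_i(I^+)-\mu_i(I^-)|\le\varepsilon$ for all $i$. The instance has maximum value $M$ if $f_i(x)\le M$ for all $i$ and all $x\in[0,1]$, and maximum intersection $d$ if for every $x\in[0,1]$ at most $d$ of the numbers $f_1(x),\dots,f_n(x)$ are positive. Theorem. There is an algorithm (a program for a real random access machine with indirect addressing, in which each memory access, each addition or truncated subtraction of natural numbers, each arithmetic operation ($+,-,\cdot,/$) on real numbers, each comparison and each use of a natural-number constant costs one step, and which has no rounding and no real constants other than natural numbers) and a constant $K$ such that the following holds for all $n\ge1$, $\varepsilon$, $M$, $d$ with $0<\varepsilon\le 2M$ and every single-block instance with $n$ agents, maximum value $M$ and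 maximum intersection $d$. Given $n$, $\varepsilon$ and the endpoints $a_i,b_i$, the algorithm halts after at most $$K\left(\frac{2M}{\varepsilon}\right)^{d+2} n\,(n+d)$$ steps and outputs a set of cuts that is a solution of the instance. -/

import Mathlib

namespace ConsensusHalving

open MeasureTheory Set

/-! ## The Consensus-Halving problem -/

/-- The points of `[0, 1]` labelled `+` by the set of cuts `S`: the cuts split `[0, 1]` into
consecutive pieces, labelled alternately `+`, `-`, `+`, … from left to right. -/
def plusPart (S : Finset ℝ) : Set ℝ :=
  {x | x ∈ Icc (0 : ℝ) 1 ∧ Even (S.filter (fun s => s ≤ x)).card}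

/-- The points of `[0, 1]` labelled `-` by the set of cuts `S`. -/
def minusPart (S : Finset ℝ) : Set ℝ :=
  {x | x ∈ Icc (0 : ℝ) 1 ∧ Odd (S.filter (fun s => s ≤ x)).card}

/-- `S` is a set of at most `n` cuts of `[0, 1]` such that each of the `n` measures gives the
two parts the same mass, up to `ε`. -/
def IsSolution {n : ℕ} (μ : Fin n → Measure ℝ) (ε : ℝ) (S : Finset ℝ) : Prop :=
  (∀ s ∈ S, s ∈ Icc (0 : ℝ) 1) ∧ S.card ≤ n ∧
    ∀ i, |(μ i).real (plusPart S) - (μ i).real (minusPart S)| ≤ ε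

/-- A single-block instance with `n` agents: agent `i` has a single value block, with endpoints
`left i < right i` in `[0, 1]`. -/
structure SingleBlock (n : ℕ) where
  left : Fin n → ℝ
  right : Fin n → ℝ
  left_nonneg : ∀ i, 0 ≤ left i
  left_lt_right : ∀ i, left i < right i
  right_le_one : ∀ i, right i ≤ 1

namespace SingleBlock

variable {n : ℕ}

/-- The density of agent `i`: constant on the block, zero elsewhere. The block is taken open; with
its endpoints included the number of overlapping blocks could only grow. -/
noncomputable def density (C : SingleBlock n) (i : Fin n) : ℝ → ℝ :=
  (Ioo (C.left i) (C.right i)).indicator (fun _ => 1 / (C.right i - C.left i))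

/-- The valuation of agent `i`: the measure with the given density. -/
noncomputable def valuation (C : SingleBlock n) (i : Fin n) : Measure ℝ :=
  volume.withDensity (fun x => ENNReal.ofReal (C.density i x))

/-- At every point of `[0, 1]` at most `d` agents have positive density. -/
def HasMaxIntersection (C : SingleBlock n) (d : ℕ) : Prop :=
  ∀ x ∈ Icc (0 : ℝ) 1, {i : Fin n | 0 < C.density i x}.ncard ≤ d

/-- All densities are bounded by `M`. -/
def HasMaxValue (C : SingleBlock n) (M : ℝ) : Prop :=
  ∀ i, ∀ x ∈ Icc (0 : ℝ) 1, C.density i x ≤ M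

/-- The valuations are probability measures. -/
theorem isProbabilityMeasure_valuation (C : SingleBlock n) (i : Fin n) :
    IsProbabilityMeasure (C.valuation i) := by
  have h : 0 < C.right i - C.left i := sub_pos.2 (C.left_lt_right i)
  constructor
  have e : (fun x => ENNReal.ofReal (C.density i x)) =
      (Ioo (C.left i) (C.right i)).indicator
        (fun _ => ENNReal.ofReal (1 / (C.right i - C.left i))) := by
    funext x
    by_cases hx : x ∈ Ioo (C.left i) (C.right i)
    · simp only [density, indicator_of_mem hx]
    · simp only [density, indicator_of_notMem hx, ENNReal.ofReal_zero]
  rw [valuation, e, withDensity_apply _ MeasurableSet.univ, setLIntegral_univ,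
    lintegral_indicator_const measurableSet_Ioo, Real.volume_Ioo,
    ← ENNReal.ofReal_mul (by positivity), one_div_mul_cancel h.ne', ENNReal.ofReal_one]

end SingleBlock

/-! ## The machine model: a real random access machine

Programs are finite texts. The memory has one cell holding a natural number and one cell holding
a real number for every address in `ℕ`, and addresses are computed (indirect addressing). Every
access to a cell, every constant, every arithmetic operation, every comparison and every basic
command takes one step. On natural numbers there are only addition and truncated subtraction; on
real numbers there are the four field operations and comparison. There is no rounding and no
conversion from reals to integers, and the only constants are natural numbers. -/

/-- The memory of the machine. -/
structure Memory where
  ints : ℕ → ℕ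
  reals : ℕ → ℝ

/-- Integer expressions; `cell a` is the content of the integer cell with address `a`. -/
inductive IntExpr : Type
  | lit (k : ℕ)
  | cell (a : IntExpr)
  | add (e f : IntExpr)
  | sub (e f : IntExpr)

namespace IntExpr

/-- The value of an integer expression. -/
def eval (σ : Memory) : IntExpr → ℕ
  | lit k => k
  | cell a => σ.ints (a.eval σ)
  | add e f => e.eval σ + f.eval σ
  | sub e f => e.eval σ - f.eval σ

/-- The number of steps that the evaluation of an integer expression takes. -/
def cost : IntExpr → ℕ
  | lit _ => 1
  | cell a => a.cost + 1
  | add e f => e.cost + f.cost + 1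
  | sub e f => e.cost + f.cost + 1

end IntExpr

/-- Real expressions; `cell a` is the content of the real cell with address `a`, and `ofInt e` is
the integer `e` as a real number. -/
inductive RealExpr : Type
  | ofInt (e : IntExpr)
  | cell (a : IntExpr)
  | add (e f : RealExpr)
  | sub (e f : RealExpr)
  | mul (e f : RealExpr)
  | div (e f : RealExpr)

namespace RealExpr

/-- The value of a real expression (division by zero returns zero). -/
noncomputable def eval (σ : Memory) : RealExpr → ℝ
  | ofInt e => (e.eval σ : ℝ)
  | cell a => σ.reals (a.eval σ)
  | add e f => e.eval σ + f.eval σ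
  | sub e f => e.eval σ - f.eval σ
  | mul e f => e.eval σ * f.eval σ
  | div e f => e.eval σ / f.eval σ

/-- The number of steps that the evaluation of a real expression takes. -/
def cost : RealExpr → ℕ
  | ofInt e => e.cost + 1
  | cell a => a.cost + 1
  | add e f => e.cost + f.cost + 1
  | sub e f => e.cost + f.cost + 1
  | mul e f => e.cost + f.cost + 1
  | div e f => e.cost + f.cost + 1

end RealExpr

/-- Tests: strict comparison of integers and of reals, negation, conjunction. -/
inductive Test : Type
  | ltInt (e f : IntExpr)
  | ltReal (e f : RealExpr)
  | neg (b : Test)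
  | conj (b c : Test)

namespace Test

/-- The outcome of a test. -/
def Holds (σ : Memory) : Test → Prop
  | ltInt e f => e.eval σ < f.eval σ
  | ltReal e f => e.eval σ < f.eval σ
  | neg b => ¬ b.Holds σ
  | conj b c => b.Holds σ ∧ c.Holds σ

/-- The number of steps that a test takes. -/
def cost : Test → ℕ
  | ltInt e f => e.cost + f.cost + 1
  | ltReal e f => e.cost + f.cost + 1
  | neg b => b.cost + 1
  | conj b c => b.cost + c.cost + 1

end Test

/-- Programs. -/
inductive Program : Type
  | nop
  | setInt (a v : IntExpr)
  | setReal (a : IntExpr) (v : RealExpr)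
  | seq (p q : Program)
  | branch (b : Test) (p q : Program)
  | loop (b : Test) (p : Program)

/-- `Exec p σ σ' t`: started with memory `σ`, the program `p` halts with memory `σ'` after exactly
`t` steps. `branch b p q` runs `p` if `b` holds and `q` otherwise, and `loop b p` runs `p` as long
as `b` holds. -/
inductive Exec : Program → Memory → Memory → ℕ → Prop
  | nop (σ : Memory) : Exec .nop σ σ 1
  | setInt (a v : IntExpr) (σ : Memory) :
      Exec (.setInt a v) σ { σ with ints := Function.update σ.ints (a.eval σ) (v.eval σ) }
        (a.cost + v.cost + 1)
  | setReal (a : IntExpr) (v : RealExpr) (σ : Memory) :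
      Exec (.setReal a v) σ { σ with reals := Function.update σ.reals (a.eval σ) (v.eval σ) }
        (a.cost + v.cost + 1)
  | seq {p q : Program} {σ σ₁ σ₂ : Memory} {t₁ t₂ : ℕ} :
      Exec p σ σ₁ t₁ → Exec q σ₁ σ₂ t₂ → Exec (.seq p q) σ σ₂ (t₁ + t₂)
  | branch_pos {b : Test} {p q : Program} {σ σ₁ : Memory} {t : ℕ} :
      b.Holds σ → Exec p σ σ₁ t → Exec (.branch b p q) σ σ₁ (b.cost + t + 1)
  | branch_neg {b : Test} {p q : Program} {σ σ₁ : Memory} {t : ℕ} :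
      ¬ b.Holds σ → Exec q σ σ₁ t → Exec (.branch b p q) σ σ₁ (b.cost + t + 1)
  | loop_stop {b : Test} {p : Program} {σ : Memory} :
      ¬ b.Holds σ → Exec (.loop b p) σ σ (b.cost + 1)
  | loop_step {b : Test} {p : Program} {σ σ₁ σ₂ : Memory} {t₁ t₂ : ℕ} :
      b.Holds σ → Exec p σ σ₁ t₁ → Exec (.loop b p) σ₁ σ₂ t₂ →
        Exec (.loop b p) σ σ₂ (b.cost + t₁ + t₂ + 1)

/-- Execution is deterministic: the result and the number of steps are unique. -/
theorem Exec.unique {p : Program} {σ σ₁ σ₂ : Memory} {t₁ t₂ : ℕ}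
    (h₁ : Exec p σ σ₁ t₁) (h₂ : Exec p σ σ₂ t₂) : σ₁ = σ₂ ∧ t₁ = t₂ := by
  induction h₁ generalizing σ₂ t₂ with
  | nop σ => cases h₂; exact ⟨rfl, rfl⟩
  | setInt a v σ => cases h₂; exact ⟨rfl, rfl⟩
  | setReal a v σ => cases h₂; exact ⟨rfl, rfl⟩
  | seq _ _ ih ih' =>
    cases h₂ with
    | seq k k' =>
      obtain ⟨rfl, rfl⟩ := ih k
      obtain ⟨rfl, rfl⟩ := ih' k'
      exact ⟨rfl, rfl⟩
  | branch_pos hb _ ih =>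
    cases h₂ with
    | branch_pos _ k => obtain ⟨rfl, rfl⟩ := ih k; exact ⟨rfl, rfl⟩
    | branch_neg hb' _ => exact absurd hb hb'
  | branch_neg hb _ ih =>
    cases h₂ with
    | branch_pos hb' _ => exact absurd hb' hb
    | branch_neg _ k => obtain ⟨rfl, rfl⟩ := ih k; exact ⟨rfl, rfl⟩
  | loop_stop hb =>
    cases h₂ with
    | loop_stop _ => exact ⟨rfl, rfl⟩
    | loop_step hb' _ _ => exact absurd hb' hb
  | loop_step hb _ _ ih ih' =>
    cases h₂ with
    | loop_stop hb' => exact absurd hb hb'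
    | loop_step _ k k' =>
      obtain ⟨rfl, rfl⟩ := ih k
      obtain ⟨rfl, rfl⟩ := ih' k'
      exact ⟨rfl, rfl⟩

/-- The initial memory for the instance `C` with accuracy `ε`: the integer cell `0` holds the
number `n` of agents, the real cell `0` holds `ε`, the real cells `2 i + 1` and `2 i + 2` hold the
endpoints of the block of agent `i < n`, and all other cells hold `0`. -/
noncomputable def inputMemory {n : ℕ} (C : SingleBlock n) (ε : ℝ) : Memory where
  ints := fun k => if k = 0 then n else 0
  reals := fun k =>
    if k = 0 then ε
    else if h : (k - 1) / 2 < n then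
      (if k % 2 = 1 then C.left ⟨(k - 1) / 2, h⟩ else C.right ⟨(k - 1) / 2, h⟩)
    else 0

/-- The set of cuts in the final memory: the integer cell `0` holds their number `k`, and the real
cells `0, …, k - 1` hold their positions. -/
noncomputable def outputCuts (σ : Memory) : Finset ℝ :=
  (Finset.range (σ.ints 0)).image σ.reals

end ConsensusHalving

namespace ConsensusHalving

/-! ## Ky Fan's lemma for the octahedral sphere -/

namespace KyFan

/-! Put `N = 2M/ε`. The interval is divided into `m` equal cells, where `m` is the least positive
integer with `4 ≤ m ε (b_i - a_i)` for all agents. Since `1 ≤ M (b_i - a_i)`, `m` is at most `⌈2N⌉ ≤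
3N`. Rounding the endpoints down turns each block into an interval `[al i, be i)` of cells. A sign
sequence on the cells with at most `n` changes, whose two signs differ by at most 2 on every such
interval, gives a solution: rounding costs at most `1/m` at either end, the imbalance costs `2/m`,
and `4/m ≤ ε (b_i - a_i)` (`isSolution_gridCuts`).

Such a sequence exists (`exists_balanced`) by a purely combinatorial argument. Every cell is split
into `Q` beads, and Tucker's lemma on the octahedral sphere (`exists_le_label`, a consequence of the
parity statement `odd_card_alternating`) is applied to sign vectors on the beads. A vector is
labelled by the first interval on which one sign has a strict majority, and otherwise by the largest
number of sign changes of an extension, together with the first sign of such an extension. If every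
vector without a majority had more than `n` changes, all labels would be too small for Tucker's
lemma. Hence some vector has no majority and at most `n` changes in any extension. It has few zeros,
because an extension can change sign in front of each of them. The extension is thus nearly
balanced, and a greedy rounding from beads to cells (`exists_rounding`), which never creates sign
changes, leaves an error of at most 2.

A sequence is found by dynamic programming over the cells. After `k` cells, the checks still to come
depend on the past only through the number of `true` values since each live position, that is, each
left end `p < k` of an interval reaching beyond `k`. These counts are stored as the gaps between
consecutive live positions, in a mixed radix code. At most `d` positions are live, because their
blocks all contain the point `k/m` in the interior (`card_reach_le`). The gaps add up to at most
`3N`, so that the number of codes is at most `N^d (1 + 1/N)^(3N) ≤ 21 N^d`, without a factor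
exponential in `d` (`codeCount_le`, `codeCount_self_le`). There are at most `3N` layers, and one
state costs `O(m + n)` steps, since decoding by repeated subtraction is amortised against the number
of `true` values. Following the stored decisions from the first layer yields the cuts; the values
`M` and `d` occur only in the analysis.

The program is verified with specifications of the form `Runs p σ Q`, which bound the number of
steps along with the result. Frame rules show which variables and arrays remain untouched. -/

open Finset in
/-- Among the positions of a finite chain, those that separate the elements satisfying `δ` from
those that do not are counted, modulo two, by whether `δ` holds everywhere or nowhere. -/
theorem card_separators (δ : ℕ → Prop) [DecidablePred δ] (A : Finset ℕ) :
    ((#{a ∈ A | (∀ b ∈ A, b < a → δ b) ∧ ∀ b ∈ A, a < b → ¬ δ b} : ℕ) : ZMod 2) =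
      (if ∀ a ∈ A, δ a then 1 else 0) + (if ∀ a ∈ A, ¬ δ a then 1 else 0) := by
  induction A using Finset.induction_on_max with
  | empty => simp; rfl
  | insert M A hM ih =>
    have hMA : M ∉ A := fun h => lt_irrefl _ (hM M h)
    -- The new maximum `M` separates iff `δ` holds on all of `A`; an old separator survives iff `δ
    -- M` fails.
    have e : ({a ∈ insert M A | (∀ b ∈ insert M A, b < a → δ b) ∧
          ∀ b ∈ insert M A, a < b → ¬ δ b} : Finset ℕ) =
        (if ∀ a ∈ A, δ a then {M} else ∅) ∪
        (if δ M then ∅ else {a ∈ A | (∀ b ∈ A, b < a → δ b) ∧ ∀ b ∈ A, a < b → ¬ δ b}) := by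
      ext a
      simp only [mem_filter, mem_insert, mem_union]
      constructor
      · rintro ⟨rfl | ha, h1, h2⟩
        · left
          rw [if_pos]
          · simp
          · intro b hb
            exact h1 b (Or.inr hb) (hM b hb)
        · right
          rw [if_neg (h2 M (Or.inl rfl) (hM a ha))]
          simp only [mem_filter]
          exact ⟨ha, fun b hb => h1 b (Or.inr hb), fun b hb => h2 b (Or.inr hb)⟩
      · rintro (h | h)
        · split_ifs at h with h'
          · rw [mem_singleton] at h
            subst h
            refine ⟨Or.inl rfl, ?_, ?_⟩
            · rintro b (rfl | hb) hlt
              · exact absurd hlt (lt_irrefl _)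
              · exact h' b hb
            · rintro b (rfl | hb) hlt
              · exact absurd hlt (lt_irrefl _)
              · exact absurd hlt (not_lt.2 (hM b hb).le)
          · simp at h
        · split_ifs at h with h'
          · simp at h
          · simp only [mem_filter] at h
            obtain ⟨ha, h1, h2⟩ := h
            refine ⟨Or.inr ha, ?_, ?_⟩
            · rintro b (rfl | hb) hlt
              · exact absurd hlt (not_lt.2 (hM a ha).le)
              · exact h1 b hb hlt
            · rintro b (rfl | hb) hlt
              · exact h'
              · exact h2 b hb hlt
    have hd : Disjoint (if ∀ a ∈ A, δ a then {M} else (∅ : Finset ℕ))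
        (if δ M then ∅ else {a ∈ A | (∀ b ∈ A, b < a → δ b) ∧ ∀ b ∈ A, a < b → ¬ δ b}) := by
      split_ifs <;> simp [hMA]
    rw [e, card_union_of_disjoint hd]
    have e1 : (∀ a ∈ insert M A, δ a) ↔ (δ M ∧ ∀ a ∈ A, δ a) := by simp
    have e2 : (∀ a ∈ insert M A, ¬ δ a) ↔ (¬ δ M ∧ ∀ a ∈ A, ¬ δ a) := by simp
    simp only [e1, e2]
    push_cast
    by_cases hδ : δ M
    · simp only [hδ, if_true, card_empty, true_and, not_true, false_and, if_false]
      split_ifs <;> simp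
    · simp only [hδ, if_false, false_and, not_false_eq_true, true_and, ih]
      have : ∀ x y : ZMod 2, x + (x + y) = 0 + y := by decide
      rw [← this (if ∀ a ∈ A, δ a then 1 else 0)]
      split_ifs <;> simp

/-- The labels of `f` have distinct absolute values, and their signs alternate when they are
ordered by absolute value, the first sign being `c`. -/
def Alternating {n : ℕ} (c : Bool) (f : Fin n → ℕ × Bool) : Prop :=
  Function.Injective (fun k => (f k).1) ∧
    ∀ k, ((f k).2 = c ↔ Even (Finset.univ.filter (fun j => (f j).1 < (f k).1)).card)

noncomputable instance {n : ℕ} (c : Bool) (f : Fin n → ℕ × Bool) : Decidable (Alternating c f) :=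
  Classical.propDecidable _

-- Deleting the label `k` lowers by one the rank of every label above it and leaves the ranks below
-- unchanged. So the signs below must be those that positive alternation prescribes in the full
-- simplex, and the signs above must be the opposite ones.
open Finset in
theorem alternating_remove_iff {n : ℕ} (f : Fin (n + 1) → ℕ × Bool)
    (hf : Function.Injective (fun k => (f k).1)) (k : Fin (n + 1)) :
    Alternating true (f ∘ k.succAbove) ↔
      ∀ j, ((f j).1 < (f k).1 → ((f j).2 = true ↔ Even #{i | (f i).1 < (f j).1})) ∧
        ((f k).1 < (f j).1 → ¬ ((f j).2 = true ↔ Even #{i | (f i).1 < (f j).1})) := by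
  have hinj : Function.Injective (fun j => ((f ∘ k.succAbove) j).1) :=
    hf.comp Fin.succAbove_right_injective
  have hcard : ∀ j, #{i : Fin (n + 1) | (f i).1 < (f j).1} =
      #{i : Fin n | (f (k.succAbove i)).1 < (f j).1} +
        (if (f k).1 < (f j).1 then 1 else 0) := by
    intro j
    simp only [card_filter]
    rw [Fin.sum_univ_succAbove _ k]
    ring
  constructor
  · rintro ⟨-, h⟩ j
    by_cases hj : j = k
    · subst hj; simp
    · obtain ⟨i, rfl⟩ := Fin.exists_succAbove_eq hj
      have := h i
      simp only [Function.comp_apply] at this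
      rw [hcard]
      constructor
      · intro hlt
        rw [if_neg (not_lt.2 hlt.le), add_zero]
        exact this
      · intro hlt
        rw [if_pos hlt, Nat.even_add_one]
        tauto
  · intro h
    refine ⟨hinj, fun i => ?_⟩
    have := h (k.succAbove i)
    rw [hcard] at this
    simp only [Function.comp_apply]
    rcases lt_trichotomy (f (k.succAbove i)).1 (f k).1 with h1 | h1 | h1
    · have := this.1 h1
      rwa [if_neg (not_lt.2 h1.le), add_zero] at this
    · exact absurd (hf h1) (Fin.succAbove_ne k i)
    · have := this.2 h1
      rw [if_pos h1, Nat.even_add_one] at this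
      tauto

open Finset in
/-- The number of alternating facets of a labelled simplex without complementary labels. -/
theorem card_alternating_facets {n : ℕ} (f : Fin (n + 1) → ℕ × Bool)
    (hc : ∀ i j, (f i).1 = (f j).1 → (f i).2 = (f j).2) :
    ((#{k : Fin (n + 1) | Alternating true (f ∘ k.succAbove)} : ℕ) : ZMod 2) =
      (if Alternating true f then 1 else 0) + (if Alternating false f then 1 else 0) := by
  classical
  by_cases hf : Function.Injective (fun k => (f k).1)
  · set A : Finset ℕ := univ.image (fun k => (f k).1) with hA
    -- `δ a` says that the label of absolute value `a` carries the sign that positive alternation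
    -- prescribes at its rank. Alternating facets are then separators for `δ`, and the two kinds of
    -- alternating simplices are those with `δ` everywhere or nowhere.
    set δ : ℕ → Prop := fun a => ∀ j, (f j).1 = a →
      ((f j).2 = true ↔ Even #{i | (f i).1 < (f j).1}) with hδ
    have hδf : ∀ j, δ (f j).1 ↔ ((f j).2 = true ↔ Even #{i | (f i).1 < (f j).1}) := by
      intro j
      constructor
      · intro h; exact h j rfl
      · intro h i hi; rw [hf hi]; exact h
    have key := card_separators δ A
    have e1 : #{k : Fin (n + 1) | Alternating true (f ∘ k.succAbove)} =
        #{a ∈ A | (∀ b ∈ A, b < a → δ b) ∧ ∀ b ∈ A, a < b → ¬ δ b} := by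
      apply card_bij (fun k _ => (f k).1)
      · intro k hk
        simp only [mem_filter, mem_univ, true_and] at hk
        rw [alternating_remove_iff f hf] at hk
        simp only [hA, mem_filter, mem_image, mem_univ, true_and, exists_apply_eq_apply,
          forall_exists_index, forall_apply_eq_imp_iff, hδf]
        exact ⟨fun j => (hk j).1, fun j => (hk j).2⟩
      · intro i _ j _ h
        exact hf h
      · intro a ha
        simp only [hA, mem_filter, mem_image, mem_univ, true_and,
          forall_exists_index, forall_apply_eq_imp_iff, hδf] at ha
        obtain ⟨⟨k, rfl⟩, h1, h2⟩ := ha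
        refine ⟨k, ?_, rfl⟩
        simp only [mem_filter, mem_univ, true_and]
        rw [alternating_remove_iff f hf]
        exact fun j => ⟨h1 j, h2 j⟩
    have e2 : Alternating true f ↔ ∀ a ∈ A, δ a := by
      simp only [Alternating, hf, true_and, hA, mem_image, mem_univ,
          forall_exists_index, forall_apply_eq_imp_iff, hδf]
    have e3 : Alternating false f ↔ ∀ a ∈ A, ¬ δ a := by
      simp only [Alternating, hf, true_and, hA, mem_image, mem_univ,
          forall_exists_index, forall_apply_eq_imp_iff, hδf]
      refine forall_congr' fun j => ?_
      cases (f j).2 <;> simp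
    rw [e1, key]
    simp only [e2, e3]
  · have h1 : ¬ Alternating true f := fun h => hf h.1
    have h2 : ¬ Alternating false f := fun h => hf h.1
    rw [if_neg h1, if_neg h2, add_zero]
    simp only [Function.Injective, not_forall] at hf
    obtain ⟨i, j, hij, hne⟩ := hf
    -- A repeated absolute value means a repeated label, as complementary labels are excluded. Only
    -- the facets that omit one of the two copies can alternate, and these carry the same labels up
    -- to order, so their number is 0 or 2.
    have hfe : f i = f j := Prod.ext hij (hc i j hij)
    have hsub : ∀ k, Alternating true (f ∘ k.succAbove) → k = i ∨ k = j := by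
      intro k hk
      by_contra hcon
      push Not at hcon
      obtain ⟨i', hi'⟩ := Fin.exists_succAbove_eq hcon.1.symm
      obtain ⟨j', hj'⟩ := Fin.exists_succAbove_eq hcon.2.symm
      have : i' = j' := hk.1 (by simp only [Function.comp_apply, hi', hj']; exact hij)
      apply hne
      rw [← hi', ← hj', this]
    have hsymm : ∀ i j : Fin (n + 1), f i = f j → i ≠ j →
        Alternating true (f ∘ i.succAbove) → Alternating true (f ∘ j.succAbove) := by
      intro i j hfe hne h
      -- a permutation of the index set transports one facet to the other
      have hex : ∀ t : Fin n, ∃ r : Fin n,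
          i.succAbove r = if j.succAbove t = i then j else j.succAbove t := by
        intro t
        apply Fin.exists_succAbove_eq
        split_ifs with h'
        · exact hne.symm
        · exact h'
      choose g hg using hex
      have hfg : ∀ t, f (i.succAbove (g t)) = f (j.succAbove t) := by
        intro t
        rw [hg]
        split_ifs with h'
        · rw [h', hfe]
        · rfl
      have hginj : Function.Injective g := by
        intro s t hst
        have := congrArg i.succAbove hst
        rw [hg, hg] at this
        apply Fin.succAbove_right_injective (p := j)
        split_ifs at this with h1 h2 h2
        · rw [h1, h2]
        · exact absurd this.symm (Fin.succAbove_ne j t)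
        · exact absurd this (Fin.succAbove_ne j s)
        · exact this
      have hgb : Function.Bijective g := Finite.injective_iff_bijective.1 hginj
      have hcomp : f ∘ j.succAbove = (f ∘ i.succAbove) ∘ g := by
        funext t; exact (hfg t).symm
      rw [hcomp]
      refine ⟨h.1.comp hginj, fun k => ?_⟩
      have := h.2 (g k)
      rw [Function.comp_apply, this]
      have : #{r : Fin n | ((f ∘ i.succAbove) r).1 < ((f ∘ i.succAbove) (g k)).1} =
          #{r : Fin n | (((f ∘ i.succAbove) ∘ g) r).1 < (((f ∘ i.succAbove) ∘ g) k).1} := by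
        symm
        apply card_bij (fun r _ => g r)
        · intro r hr
          simpa using hr
        · intro a _ b _ h; exact hginj h
        · intro b hb
          obtain ⟨r, rfl⟩ := hgb.2 b
          exact ⟨r, by simpa using hb, rfl⟩
      rw [this]
      rfl
    by_cases hi : Alternating true (f ∘ i.succAbove)
    · have hj := hsymm i j hfe hne hi
      have : ({k : Fin (n + 1) | Alternating true (f ∘ k.succAbove)} : Finset _) = {i, j} := by
        ext k
        simp only [mem_filter, mem_univ, true_and, mem_insert, mem_singleton]
        constructor
        · exact hsub k
        · rintro (rfl | rfl) <;> assumption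
      rw [this, card_pair hne]
      rfl
    · have hj : ¬ Alternating true (f ∘ j.succAbove) :=
        fun h => hi (hsymm j i hfe.symm (Ne.symm hne) h)
      have : ({k : Fin (n + 1) | Alternating true (f ∘ k.succAbove)} : Finset _) = ∅ := by
        ext k
        simp only [mem_filter, mem_univ, true_and, notMem_empty, iff_false]
        intro h
        rcases hsub k h with rfl | rfl <;> contradiction
      rw [this]
      simp

end KyFan
end ConsensusHalving

/-! ### Maximal chains of sign vectors, and the parity argument. -/

namespace ConsensusHalving
namespace KyFan

/-- The maximal chains of nonzero sign vectors with coordinates `0, …, n - 1`: the signed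
coordinates in the order in which they are added. -/
noncomputable def chains (n : ℕ) : Finset (Fin n → ℕ × Bool) :=
  open Classical in
  (Fintype.piFinset fun _ : Fin n => Finset.range n ×ˢ (Finset.univ : Finset Bool)).filter
    (fun w => Function.Injective (fun k => (w k).1))

theorem mem_chains {n : ℕ} {w : Fin n → ℕ × Bool} :
    w ∈ chains n ↔ (∀ k, (w k).1 < n) ∧ Function.Injective (fun k => (w k).1) := by
  simp [chains]

theorem exists_of_mem_chains {n : ℕ} {w : Fin n → ℕ × Bool} (hw : w ∈ chains n) {t : ℕ}
    (ht : t < n) : ∃ k, (w k).1 = t := by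
  rw [mem_chains] at hw
  have : Function.Injective (fun k => (⟨(w k).1, hw.1 k⟩ : Fin n)) := by
    intro i j hij
    exact hw.2 (congrArg Fin.val hij)
  obtain ⟨k, hk⟩ := (Finite.injective_iff_surjective.1 this) ⟨t, ht⟩
  exact ⟨k, congrArg Fin.val hk⟩

/-- The `k`-th sign vector of a chain. -/
def vec {n : ℕ} (w : Fin n → ℕ × Bool) (k : Fin n) : Finset (ℕ × Bool) :=
  (Finset.univ.filter (fun j => j ≤ k)).image w

/-- The opposite signed coordinate. -/
def opp (a : ℕ × Bool) : ℕ × Bool := (a.1, !a.2)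

theorem opp_opp (a : ℕ × Bool) : opp (opp a) = a := by simp [opp]

/-- Nonzero sign vectors with coordinates below `N`. -/
def IsSignVector (N : ℕ) (x : Finset (ℕ × Bool)) : Prop :=
  x.Nonempty ∧ (∀ a ∈ x, a.1 < N) ∧ ∀ a ∈ x, opp a ∉ x

theorem isSignVector_vec {n N : ℕ} (hn : n ≤ N) {w : Fin n → ℕ × Bool} (hw : w ∈ chains n)
    (k : Fin n) : IsSignVector N (vec w k) := by
  rw [mem_chains] at hw
  refine ⟨⟨w k, Finset.mem_image_of_mem _ (by simp)⟩, ?_, ?_⟩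
  · intro a ha
    simp only [vec, Finset.mem_image] at ha
    obtain ⟨j, -, rfl⟩ := ha
    exact (hw.1 j).trans_le hn
  · intro a ha ha'
    simp only [vec, Finset.mem_image] at ha ha'
    obtain ⟨j, -, rfl⟩ := ha
    obtain ⟨i, -, hi⟩ := ha'
    have : i = j := hw.2 (by simp [hi, opp])
    subst this
    simp [opp, Prod.ext_iff] at hi

theorem vec_opp {n : ℕ} (w : Fin n → ℕ × Bool) (k : Fin n) :
    vec (fun j => opp (w j)) k = (vec w k).image opp := by
  simp only [vec, Finset.image_image]; rfl

theorem vec_subset {n : ℕ} (w : Fin n → ℕ × Bool) {j k : Fin n} (h : j ≤ k) :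
    vec w j ⊆ vec w k := by
  apply Finset.image_subset_image
  intro i
  simp only [Finset.mem_filter, Finset.mem_univ, true_and]
  exact fun hi => hi.trans h

theorem opp_mem_chains {n : ℕ} {w : Fin n → ℕ × Bool} (hw : w ∈ chains n) :
    (fun j => opp (w j)) ∈ chains n := by
  rw [mem_chains] at hw ⊢
  exact hw

/-- The chain that agrees with `w` except in its `k`-th member. -/
def neighbour {n : ℕ} (w : Fin (n + 1) → ℕ × Bool) (k : Fin (n + 1)) : Fin (n + 1) → ℕ × Bool :=
  -- Exchanging two consecutive additions changes only the vector between them. The last vector has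
  -- no successor, and it is changed by flipping the coordinate added last.
  if h : k.val < n then w ∘ Equiv.swap k ⟨k.val + 1, by omega⟩
  else Function.update w k (opp (w k))

theorem neighbour_neighbour {n : ℕ} (w : Fin (n + 1) → ℕ × Bool) (k : Fin (n + 1)) :
    neighbour (neighbour w k) k = w := by
  unfold neighbour
  split_ifs
  · funext j; simp
  · simp [opp_opp]

theorem neighbour_ne {n : ℕ} {w : Fin (n + 1) → ℕ × Bool} (hw : w ∈ chains (n + 1))
    (k : Fin (n + 1)) : neighbour w k ≠ w := by
  rw [mem_chains] at hw
  intro h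
  have := congrFun h k
  unfold neighbour at this
  split_ifs at this with hk
  · simp only [Function.comp_apply, Equiv.swap_apply_left] at this
    have := hw.2 (congrArg Prod.fst this)
    simp [Fin.ext_iff] at this
  · simp [opp, Prod.ext_iff] at this

theorem neighbour_mem {n : ℕ} {w : Fin (n + 1) → ℕ × Bool} (hw : w ∈ chains (n + 1))
    (k : Fin (n + 1)) : neighbour w k ∈ chains (n + 1) := by
  rw [mem_chains] at hw ⊢
  unfold neighbour
  split_ifs with hk
  · exact ⟨fun j => hw.1 _, hw.2.comp (Equiv.injective _)⟩
  · have : ∀ j, (Function.update w k (opp (w k)) j).1 = (w j).1 := by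
      intro j
      by_cases hj : j = k
      · subst hj; simp [opp]
      · simp [hj]
    simpa [this] using hw

/-- For `j ≠ k` the swap of `k` and `k + 1` maps the initial segment up to `j` to itself; in the
other case only the last vector sees the flipped coordinate. -/
theorem vec_neighbour {n : ℕ} (w : Fin (n + 1) → ℕ × Bool) {j k : Fin (n + 1)} (h : j ≠ k) :
    vec (neighbour w k) j = vec w j := by
  unfold neighbour
  split_ifs with hk
  · have : vec (w ∘ Equiv.swap k ⟨k.val + 1, by omega⟩) j =
        ((Finset.univ.filter (fun i => i ≤ j)).image
          (Equiv.swap k ⟨k.val + 1, by omega⟩)).image w := by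
      rw [Finset.image_image]; rfl
    rw [this, vec]
    congr 1
    ext i
    simp only [Finset.mem_image, Finset.mem_filter, Finset.mem_univ, true_and]
    have hjk : j.val ≠ k.val := fun h' => h (Fin.ext h')
    have key : ∀ i : Fin (n + 1), i ≤ j →
        Equiv.swap k (⟨k.val + 1, by omega⟩ : Fin (n + 1)) i ≤ j := by
      intro i hi
      rw [Equiv.swap_apply_def]
      split_ifs with h1 h2
      · subst h1
        rw [Fin.le_def] at hi ⊢
        simp only
        omega
      · subst h2
        rw [Fin.le_def] at hi ⊢
        simp only at hi
        omega
      · exact hi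
    constructor
    · rintro ⟨a, ha, rfl⟩
      exact key a ha
    · intro hi
      exact ⟨_, key i hi, by simp⟩
  · apply Finset.image_congr
    intro i hi
    simp only [Finset.coe_filter, Finset.mem_univ, true_and, Set.mem_setOf_eq] at hi
    have : i ≠ k := by
      rintro rfl
      apply h
      rw [Fin.le_def] at hi
      apply Fin.ext
      omega
    simp [this]

theorem vec_init {n : ℕ} (w : Fin (n + 1) → ℕ × Bool) (j : Fin n) :
    vec (fun i : Fin n => w i.castSucc) j = vec w j.castSucc := by
  ext a
  simp only [vec, Finset.mem_image, Finset.mem_filter, Finset.mem_univ, true_and]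
  constructor
  · rintro ⟨i, hi, rfl⟩
    exact ⟨i.castSucc, hi, rfl⟩
  · rintro ⟨i, hi, rfl⟩
    refine ⟨⟨i.val, ?_⟩, hi, rfl⟩
    rw [Fin.le_def] at hi
    simp only [Fin.val_castSucc] at hi
    omega

theorem alternating_opp {n : ℕ} (f : Fin n → ℕ × Bool) (c : Bool) :
    Alternating c (fun k => opp (f k)) ↔ Alternating (!c) f := by
  simp only [Alternating, opp]
  refine and_congr Iff.rfl (forall_congr' fun k => ?_)
  cases c <;> cases (f k).2 <;> simp <;> rfl

variable {N : ℕ} {L : Finset (ℕ × Bool) → ℕ × Bool}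

open Finset in
/-- **Ky Fan's lemma**: an antipodal labelling of the nonzero sign vectors without complementary
labels on comparable vectors has an odd number of positive alternating maximal chains. -/
theorem odd_card_alternating
    (hopp : ∀ x, IsSignVector N x → L (x.image opp) = opp (L x))
    (hcomp : ∀ x y, IsSignVector N x → IsSignVector N y → x ⊆ y → (L x).1 = (L y).1 →
      (L x).2 = (L y).2) (n : ℕ) (hn : n ≤ N) :
    ((#{w ∈ chains n | Alternating true (fun k => L (vec w k))} : ℕ) : ZMod 2) = 1 := by
  classical
  induction n with
  | zero =>
    have : ({w ∈ chains 0 | Alternating true (fun k => L (vec w k))} : Finset _) =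
        {Fin.elim0} := by
      ext w
      simp only [mem_filter, mem_chains, mem_singleton, Alternating]
      constructor
      · intro; funext k; exact k.elim0
      · intro
        exact ⟨⟨fun k => k.elim0, fun k => k.elim0⟩, fun k => k.elim0, fun k => k.elim0⟩
    rw [this]; simp
  | succ n ih =>
    specialize ih (by omega)
    -- `C` is the hemisphere where the coordinate `n` is never negative, and `P` consists of its
    -- simplices with a chosen positively alternating facet. Counting `P` by simplices gives all
    -- positively alternating chains of the sphere; counting it by facets leaves only the equator,
    -- to which the induction hypothesis applies.
    set C := {w ∈ chains (n + 1) | ∀ k, w k ≠ (n, false)} with hC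
    set P : Finset ((Fin (n + 1) → ℕ × Bool) × Fin (n + 1)) :=
      {p ∈ C ×ˢ univ | Alternating true ((fun k => L (vec p.1 k)) ∘ p.2.succAbove)} with hP
    have hcons : ∀ w ∈ chains (n + 1), ∀ i j, (L (vec w i)).1 = (L (vec w j)).1 →
        (L (vec w i)).2 = (L (vec w j)).2 := by
      intro w hw i j h
      rcases le_total i j with hij | hij
      · exact hcomp _ _ (isSignVector_vec hn hw _) (isSignVector_vec hn hw _)
          (vec_subset w hij) h
      · exact (hcomp _ _ (isSignVector_vec hn hw _) (isSignVector_vec hn hw _)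
          (vec_subset w hij) h.symm).symm
    have hP1 : ((#P : ℕ) : ZMod 2) =
        ((#{w ∈ C | Alternating true (fun k => L (vec w k))} : ℕ) : ZMod 2) +
        ((#{w ∈ C | Alternating false (fun k => L (vec w k))} : ℕ) : ZMod 2) := by
      have : #P = ∑ w ∈ C, #{k : Fin (n + 1) |
          Alternating true ((fun k => L (vec w k)) ∘ k.succAbove)} := by
        rw [hP, card_filter, sum_product]
        simp only [card_filter]
      rw [this]
      push_cast
      rw [card_filter, card_filter]
      push_cast
      rw [← sum_add_distrib]
      apply sum_congr rfl
      intro w hw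
      exact card_alternating_facets _ (hcons w (mem_filter.1 hw).1)
    -- The antipodal map exchanges the two hemispheres and the two kinds of alternation.
    have hflip : #{w ∈ C | Alternating false (fun k => L (vec w k))} =
        #{w ∈ chains (n + 1) \ C | Alternating true (fun k => L (vec w k))} := by
      have hA : ∀ w ∈ chains (n + 1), ∀ c, Alternating c (fun k => L (vec (fun j => opp (w j)) k)) ↔
          Alternating (!c) (fun k => L (vec w k)) := by
        intro w hw c
        rw [← alternating_opp]
        have : (fun k => L (vec (fun j => opp (w j)) k)) = fun k => opp (L (vec w k)) := by
          funext k
          rw [vec_opp, hopp _ (isSignVector_vec hn hw k)]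
        rw [this]
      have hCopp : ∀ w ∈ chains (n + 1), (fun j => opp (w j)) ∈ C ↔ w ∉ C := by
        intro w hw
        obtain ⟨k, hk⟩ := exists_of_mem_chains hw (Nat.lt_succ_self n)
        have huniq : ∀ j, (w j).1 = n → j = k := by
          intro j hj
          exact (mem_chains.1 hw).2 (hj.trans hk.symm)
        simp only [hC, mem_filter, hw, opp_mem_chains hw, true_and, not_forall, not_not]
        constructor
        · intro h
          refine ⟨k, ?_⟩
          have := h k
          simp only [opp, ne_eq, Prod.mk.injEq, hk, true_and, Bool.not_eq_false'] at this
          exact Prod.ext hk (by simpa using this)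
        · rintro ⟨i, hi⟩ j hj
          have h1 : i = k := huniq i (by rw [hi])
          have h2 : j = k := huniq j (by have := congrArg Prod.fst hj; simpa [opp] using this)
          subst h1
          subst h2
          rw [hi] at hj
          simp [opp] at hj
      apply card_bij (fun w _ j => opp (w j))
      · intro w hw
        rw [mem_filter] at hw
        have hw1 : w ∈ chains (n + 1) := (mem_filter.1 hw.1).1
        rw [mem_filter, mem_sdiff, hCopp w hw1, hA w hw1]
        exact ⟨⟨opp_mem_chains hw1, fun h => h hw.1⟩, hw.2⟩
      · intro a _ b _ h
        funext j
        have := congrFun h j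
        rw [← opp_opp (a j), this, opp_opp]
      · intro w hw
        rw [mem_filter, mem_sdiff] at hw
        refine ⟨fun j => opp (w j), ?_, by funext j; exact opp_opp _⟩
        rw [mem_filter, hCopp w hw.1.1, hA w hw.1.1]
        exact ⟨hw.1.2, hw.2⟩
    have htotal : #{w ∈ chains (n + 1) | Alternating true (fun k => L (vec w k))} =
        #{w ∈ C | Alternating true (fun k => L (vec w k))} +
        #{w ∈ C | Alternating false (fun k => L (vec w k))} := by
      rw [hflip, ← card_union_of_disjoint, ← filter_union,
        union_sdiff_of_subset (filter_subset _ _)]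
      exact disjoint_filter_filter disjoint_sdiff
    have hsplit : #P = #{p ∈ P | p.2 = Fin.last n ∧ (p.1 (Fin.last n)).1 = n} +
        #{p ∈ P | ¬ (p.2 = Fin.last n ∧ (p.1 (Fin.last n)).1 = n)} :=
      (card_filter_add_card_filter_not _).symm
    -- An interior facet lies in exactly two simplices of `C`, which `neighbour` exchanges. The
    -- involution leaves `C` only if the last vector is removed and the coordinate added last is
    -- `n`.
    have heven : ((#{p ∈ P | ¬ (p.2 = Fin.last n ∧ (p.1 (Fin.last n)).1 = n)} : ℕ) : ZMod 2) = 0 := by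
      rw [card_eq_sum_ones]
      push_cast
      apply sum_involution (fun p _ => (neighbour p.1 p.2, p.2))
      · intro p _; rfl
      · intro p hp _ h
        have hp1 := (mem_filter.1 (mem_product.1 (mem_filter.1 (mem_filter.1 hp).1).1).1).1
        exact neighbour_ne hp1 p.2 (congrArg Prod.fst h)
      · rintro ⟨w, k⟩ hp
        simp only [hP, hC, mem_filter, mem_product, mem_univ, and_true] at hp ⊢
        obtain ⟨⟨⟨hw, hw2⟩, halt⟩, hb⟩ := hp
        refine ⟨⟨⟨neighbour_mem hw k, ?_⟩, ?_⟩, ?_⟩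
        · intro j hj
          unfold neighbour at hj
          split_ifs at hj with hk
          · exact hw2 _ hj
          · by_cases hjk : j = k
            · subst hjk
              apply hb
              have : j = Fin.last n := by
                apply Fin.ext; simp only [Fin.val_last]; omega
              refine ⟨this, ?_⟩
              rw [← this]
              have := congrArg Prod.fst hj
              simpa [opp] using this
            · rw [Function.update_of_ne hjk] at hj
              exact hw2 _ hj
        · convert halt using 1
          funext i
          simp only [Function.comp_apply]
          rw [vec_neighbour w (Fin.succAbove_ne k i)]
        · rintro ⟨rfl, h⟩
          apply hb
          refine ⟨rfl, ?_⟩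
          simpa [neighbour, opp] using h
      · rintro ⟨w, k⟩ _
        simp [neighbour_neighbour]
    -- The facets on the equator are the chains on `n` coordinates, completed in a unique way within
    -- the hemisphere by `(n, true)`.
    have hbd : #{p ∈ P | p.2 = Fin.last n ∧ (p.1 (Fin.last n)).1 = n} =
        #{w ∈ chains n | Alternating true (fun k => L (vec w k))} := by
      have hlab : ∀ w : Fin (n + 1) → ℕ × Bool,
          ((fun k => L (vec w k)) ∘ (Fin.last n).succAbove) =
          fun k => L (vec (fun i : Fin n => w i.castSucc) k) := by
        intro w
        funext k
        simp only [Function.comp_apply, Fin.succAbove_last, vec_init]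
      symm
      apply card_bij (fun w _ =>
        ((Fin.snoc w ((n, true) : ℕ × Bool) : Fin (n + 1) → ℕ × Bool), Fin.last n))
      · intro w hw
        simp only [mem_filter] at hw
        obtain ⟨hw1, hw2⟩ := hw
        rw [mem_chains] at hw1
        simp only [hP, hC, mem_filter, mem_product, mem_univ, and_true, hlab, Fin.snoc_castSucc,
          Fin.snoc_last, true_and]
        refine ⟨⟨mem_chains.2 ⟨?_, ?_⟩, ?_⟩, hw2⟩
        · intro k
          refine Fin.lastCases ?_ (fun i => ?_) k
          · simp
          · rw [Fin.snoc_castSucc]; exact (hw1.1 i).trans (Nat.lt_succ_self n)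
        · intro i j
          refine Fin.lastCases ?_ (fun i => ?_) i <;> refine Fin.lastCases ?_ (fun j => ?_) j
          · simp
          · simp only [Fin.snoc_castSucc, Fin.snoc_last]
            intro h; exact absurd h.symm (hw1.1 j).ne
          · simp only [Fin.snoc_castSucc, Fin.snoc_last]
            intro h; exact absurd h (hw1.1 i).ne
          · simp only [Fin.snoc_castSucc]
            intro h; rw [hw1.2 h]
        · intro k
          refine Fin.lastCases ?_ (fun i => ?_) k
          · simp
          · rw [Fin.snoc_castSucc]
            intro h
            have := hw1.1 i
            rw [h] at this
            exact lt_irrefl _ this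
      · intro a _ b _ h
        have := congrArg Prod.fst h
        funext i
        have := congrFun this i.castSucc
        simpa using this
      · rintro ⟨w, k⟩ hp
        simp only [hP, hC, mem_filter, mem_product, mem_univ, and_true] at hp
        obtain ⟨⟨⟨hw, hw2⟩, halt⟩, rfl, hlast⟩ := hp
        rw [hlab] at halt
        have hw' := mem_chains.1 hw
        refine ⟨fun i => w i.castSucc, ?_, ?_⟩
        · rw [mem_filter, mem_chains]
          refine ⟨⟨?_, ?_⟩, halt⟩
          · intro i
            have h1 := hw'.1 i.castSucc
            have h2 : (w i.castSucc).1 ≠ n := by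
              intro h
              have := hw'.2 (h.trans hlast.symm)
              exact (Fin.castSucc_lt_last i).ne this
            omega
          · intro i j h
            have := hw'.2 h
            exact Fin.castSucc_injective n this
        · ext1
          · funext j
            refine Fin.lastCases ?_ (fun i => ?_) j
            · simp only [Fin.snoc_last]
              have := hw2 (Fin.last n)
              refine Prod.ext hlast.symm ?_
              by_contra hne
              apply this
              refine Prod.ext hlast ?_
              simpa using Ne.symm hne
            · simp
          · rfl
    rw [htotal]
    push_cast
    rw [← hP1, hsplit]
    push_cast
    rw [heven, hbd, ih, add_zero]

/-- **Tucker's lemma** for the octahedral sphere. -/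
theorem exists_le_label
    (hopp : ∀ x, IsSignVector N x → L (x.image opp) = opp (L x))
    (hcomp : ∀ x y, IsSignVector N x → IsSignVector N y → x ⊆ y → (L x).1 = (L y).1 →
      (L x).2 = (L y).2) (hN : 0 < N) :
    ∃ x, IsSignVector N x ∧ N ≤ (L x).1 + 1 := by
  classical
  have h := odd_card_alternating hopp hcomp N le_rfl
  have hne : (Finset.filter (fun w => Alternating true (fun k => L (vec w k)))
      (chains N)).Nonempty := by
    rw [← Finset.card_pos]
    by_contra h0
    rw [Nat.eq_zero_of_not_pos h0] at h
    simp at h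
  obtain ⟨w, hw⟩ := hne
  rw [Finset.mem_filter] at hw
  by_contra hcon
  push Not at hcon
  have hlt : ∀ k, (L (vec w k)).1 < N - 1 := by
    intro k
    have := hcon _ (isSignVector_vec le_rfl hw.1 k)
    omega
  -- An alternating chain has `N` distinct absolute values, which do not fit below `N - 1`.
  have := Fintype.card_le_of_injective
    (fun k : Fin N => (⟨(L (vec w k)).1, hlt k⟩ : Fin (N - 1))) (by
      intro i j hij
      exact hw.2.1 (congrArg Fin.val hij))
  simp only [Fintype.card_fin] at this
  omega

end KyFan
end ConsensusHalving

namespace ConsensusHalving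

/-! ## Balanced sign sequences with few sign changes -/

/-- The number of `true` values of `s` in `[a, b)`. -/
def ups (s : ℕ → Bool) (a b : ℕ) : ℕ := ((Finset.Ico a b).filter (fun t => s t = true)).card

/-- The number of `t` in `[a, b)` where `s` changes between `t` and `t + 1`. -/
def turns (s : ℕ → Bool) (a b : ℕ) : ℕ := ((Finset.Ico a b).filter (fun t => s t ≠ s (t + 1))).card

theorem card_filter_Ico_add (p : ℕ → Prop) [DecidablePred p] {a b c : ℕ} (h : a ≤ b) (h' : b ≤ c) :
    ((Finset.Ico a b).filter p).card + ((Finset.Ico b c).filter p).card =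
      ((Finset.Ico a c).filter p).card := by
  rw [← Finset.card_union_of_disjoint, ← Finset.filter_union, Finset.Ico_union_Ico_eq_Ico h h']
  exact Finset.disjoint_filter_filter (Finset.Ico_disjoint_Ico_consecutive a b c)

theorem ups_add (s : ℕ → Bool) {a b c : ℕ} (h : a ≤ b) (h' : b ≤ c) :
    ups s a b + ups s b c = ups s a c := card_filter_Ico_add _ h h'

theorem turns_add (s : ℕ → Bool) {a b c : ℕ} (h : a ≤ b) (h' : b ≤ c) :
    turns s a b + turns s b c = turns s a c := card_filter_Ico_add _ h h'

theorem ups_self (s : ℕ → Bool) (a : ℕ) : ups s a a = 0 := by simp [ups]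

theorem turns_self (s : ℕ → Bool) (a : ℕ) : turns s a a = 0 := by simp [turns]

theorem ups_one (s : ℕ → Bool) (a : ℕ) : ups s a (a + 1) = (s a).toNat := by
  simp only [ups, Nat.Ico_succ_singleton, Finset.filter_singleton]
  cases s a <;> simp

theorem turns_one (s : ℕ → Bool) (a : ℕ) :
    turns s a (a + 1) = if s a = s (a + 1) then 0 else 1 := by
  simp only [turns, Nat.Ico_succ_singleton, Finset.filter_singleton]
  split_ifs with h <;> simp_all

theorem ups_succ (s : ℕ → Bool) {a b : ℕ} (h : a ≤ b) :
    ups s a (b + 1) = ups s a b + (s b).toNat := by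
  rw [← ups_add s h (Nat.le_succ b), ups_one]

theorem turns_succ (s : ℕ → Bool) {a b : ℕ} (h : a ≤ b) :
    turns s a (b + 1) = turns s a b + if s b = s (b + 1) then 0 else 1 := by
  rw [← turns_add s h (Nat.le_succ b), turns_one]

theorem ups_le (s : ℕ → Bool) (a b : ℕ) : ups s a b ≤ b - a := by
  have := Finset.card_filter_le (Finset.Ico a b) (fun t => s t = true)
  simpa [ups] using this

theorem turns_le (s : ℕ → Bool) (a b : ℕ) : turns s a b ≤ b - a := by
  have := Finset.card_filter_le (Finset.Ico a b) (fun t => s t ≠ s (t + 1))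
  simpa [turns] using this

theorem ups_congr {s s' : ℕ → Bool} {a b : ℕ} (h : ∀ t, a ≤ t → t < b → s t = s' t) :
    ups s a b = ups s' a b := by
  unfold ups
  congr 1
  apply Finset.filter_congr
  intro t ht
  rw [Finset.mem_Ico] at ht
  rw [h t ht.1 ht.2]

theorem turns_congr {s s' : ℕ → Bool} {a b : ℕ} (h : ∀ t, a ≤ t → t ≤ b → s t = s' t) :
    turns s a b = turns s' a b := by
  unfold turns
  congr 1
  apply Finset.filter_congr
  intro t ht
  rw [Finset.mem_Ico] at ht
  rw [h t ht.1 ht.2.le, h (t + 1) (by omega) (by omega)]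

theorem turns_not (s : ℕ → Bool) (a b : ℕ) : turns (fun t => !s t) a b = turns s a b := by
  simp [turns]

theorem ups_not (s : ℕ → Bool) (a b : ℕ) : ups (fun t => !s t) a b + ups s a b = b - a := by
  have := Finset.card_filter_add_card_filter_not (s := Finset.Ico a b) (fun t => s t = true)
  simp only [Nat.card_Ico] at this
  rw [← this, add_comm]
  simp [ups]

theorem one_le_turns {s : ℕ → Bool} {a b : ℕ} (h : a ≤ b) (hne : s a ≠ s b) :
    1 ≤ turns s a b := by
  induction b, h using Nat.le_induction with
  | base => exact absurd rfl hne
  | succ b hb ih =>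
    rw [turns_succ s hb]
    split_ifs with h'
    · rw [← h'] at hne
      have := ih hne
      omega
    · omega

theorem turns_ge_of_between {s : ℕ → Bool} {a b c : ℕ} (h : a ≤ c) (h' : c ≤ b) :
    (if s a = s c then 0 else 1) + (if s c = s b then 0 else 1) ≤ turns s a b := by
  rw [← turns_add s h h']
  apply Nat.add_le_add
  · split_ifs with h1
    · omega
    · exact one_le_turns h h1
  · split_ifs with h1
    · omega
    · exact one_le_turns h' h1

/-! ### The labelling of sign vectors on beads. -/

section Beads

open KyFan

variable (N n : ℕ) (A B : ℕ → ℕ)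

/-- The sign sequence `y` extends the sign vector `x`. -/
def Extends (y : ℕ → Bool) (x : Finset (ℕ × Bool)) : Prop := ∀ a ∈ x, y a.1 = a.2

/-- The largest number of sign changes of an extension of `x`. -/
noncomputable def maxTurns (x : Finset (ℕ × Bool)) : ℕ :=
  sSup {c | ∃ y, Extends y x ∧ turns y 0 (N - 1) = c}

open Classical in
/-- The first sign of the extensions of `x` with the most sign changes. -/
noncomputable def firstSign (x : Finset (ℕ × Bool)) : Bool :=
  decide (∃ y, Extends y x ∧ turns y 0 (N - 1) = maxTurns N x ∧ y 0 = true)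

/-- The sign `c` takes more than half of the interval `[A i, B i)`. -/
def Exceeds (x : Finset (ℕ × Bool)) (i : ℕ) (c : Bool) : Prop :=
  B i - A i < 2 * ((Finset.Ico (A i) (B i)).filter (fun t => (t, c) ∈ x)).card

open Classical in
/-- The labelling to which Tucker's lemma is applied. -/
noncomputable def beadLabel (x : Finset (ℕ × Bool)) : ℕ × Bool :=
  if ∃ i < n, ∃ c, Exceeds A B x i c then
    (sInf {i | i < n ∧ ∃ c, Exceeds A B x i c},
      decide (Exceeds A B x (sInf {i | i < n ∧ ∃ c, Exceeds A B x i c}) true))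
  -- If all vectors of this kind have at least `n + 1` turns, no information is lost by the
  -- truncated subtraction, these labels do not collide with those below `n`, and `maxTurns ≤ N - 1`
  -- keeps them at most `N - 2`, below the value that Tucker's lemma enforces.
  else (n + (maxTurns N x - (n + 1)), firstSign N x)

variable {N n A B}

theorem exists_extends {x : Finset (ℕ × Bool)} (hx : IsSignVector N x) : ∃ y, Extends y x := by
  classical
  refine ⟨fun t => decide ((t, true) ∈ x), ?_⟩
  rintro ⟨t, c⟩ ha
  cases c
  · have := hx.2.2 _ ha
    simpa [opp] using this
  · simpa using ha

theorem bddAbove_turns (x : Finset (ℕ × Bool)) :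
    BddAbove {c | ∃ y, Extends y x ∧ turns y 0 (N - 1) = c} := by
  refine ⟨N - 1, ?_⟩
  rintro c ⟨y, -, rfl⟩
  exact turns_le y 0 (N - 1)

theorem exists_maxTurns {x : Finset (ℕ × Bool)} (hx : IsSignVector N x) :
    ∃ y, Extends y x ∧ turns y 0 (N - 1) = maxTurns N x := by
  obtain ⟨y, hy⟩ := exists_extends hx
  exact Nat.sSup_mem (s := {c | ∃ y, Extends y x ∧ turns y 0 (N - 1) = c}) ⟨_, y, hy, rfl⟩
    (bddAbove_turns x)

theorem turns_le_maxTurns {x : Finset (ℕ × Bool)} {y : ℕ → Bool} (hy : Extends y x) :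
    turns y 0 (N - 1) ≤ maxTurns N x :=
  le_csSup (bddAbove_turns x) ⟨y, hy, rfl⟩

theorem maxTurns_le {x : Finset (ℕ × Bool)} (hx : IsSignVector N x) : maxTurns N x ≤ N - 1 := by
  obtain ⟨y, -, hy⟩ := exists_maxTurns hx
  rw [← hy]
  exact turns_le y 0 (N - 1)

/-- Two extensions with different first signs are opposite up to their first agreement, which exists
because `x` is nonzero. There exactly one of them changes sign; giving the other one the opposite
beginning adds a sign change, against maximality. -/
theorem first_eq_of_max {x : Finset (ℕ × Bool)} (hx : IsSignVector N x) {y y' : ℕ → Bool}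
    (hy : Extends y x) (hy' : Extends y' x) (h : turns y 0 (N - 1) = maxTurns N x)
    (h' : turns y' 0 (N - 1) = maxTurns N x) : y 0 = y' 0 := by
  by_contra hne
  obtain ⟨⟨t, c⟩, ht⟩ := hx.1
  have hex : ∃ p, y p = y' p := ⟨t, (hy _ ht).trans (hy' _ ht).symm⟩
  classical
  obtain ⟨p, hp, hmin⟩ : ∃ p, y p = y' p ∧ ∀ q < p, y q ≠ y' q :=
    ⟨Nat.find hex, Nat.find_spec hex, fun q hq => Nat.find_min hex hq⟩
  have hpt : p ≤ t := by
    by_contra hlt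
    push Not at hlt
    exact hmin t hlt ((hy _ ht).trans (hy' _ ht).symm)
  have htN := hx.2.1 _ ht
  simp only at htN
  obtain ⟨q, rfl⟩ : ∃ q, p = q + 1 := by
    cases p with
    | zero => exact absurd hp hne
    | succ q => exact ⟨q, rfl⟩
  -- crossing over from one maximal extension to the other at `q` gains a sign change
  have key : ∀ u v : ℕ → Bool, Extends u x → Extends v x → turns u 0 (N - 1) = maxTurns N x →
      turns v 0 (N - 1) = maxTurns N x → u (q + 1) = v (q + 1) → (∀ r < q + 1, u r ≠ v r) →
      u q = u (q + 1) → False := by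
    intro u v hu hv htu htv huv hlt heq
    set w : ℕ → Bool := fun r => if r ≤ q then v r else u r with hw
    have hwx : Extends w x := by
      intro a ha
      simp only [hw]
      split_ifs
      · exact hv a ha
      · exact hu a ha
    have h1 : turns w 0 q = turns u 0 q := by
      have e1 : turns w 0 q = turns v 0 q := by
        apply turns_congr
        intro r _ hr
        simp [hw, hr]
      have e2 : turns v 0 q = turns (fun r => !u r) 0 q := by
        apply turns_congr
        intro r _ hr
        have := hlt r (by omega)
        revert this
        cases u r <;> cases v r <;> simp
      rw [e1, e2, turns_not]
    have h2 : turns w (q + 1) (N - 1) = turns u (q + 1) (N - 1) := by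
      apply turns_congr
      intro r hr _
      have : ¬ r ≤ q := by omega
      simp [hw, this]
    have h3 : turns w q (q + 1) = turns u q (q + 1) + 1 := by
      rw [turns_one, turns_one, if_pos heq, if_neg]
      have hq := hlt q (by omega)
      simp only [hw, le_refl, if_true, Nat.not_succ_le_self, if_false]
      rw [← heq]
      exact fun h => hq h.symm
    have hle := turns_le_maxTurns (N := N) hwx
    rw [← turns_add w (Nat.zero_le (q + 1)) (show q + 1 ≤ N - 1 by omega),
      ← turns_add w (Nat.zero_le q) (show q ≤ q + 1 by omega)] at hle
    rw [← turns_add u (Nat.zero_le (q + 1)) (show q + 1 ≤ N - 1 by omega),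
      ← turns_add u (Nat.zero_le q) (show q ≤ q + 1 by omega)] at htu
    omega
  by_cases hc : y q = y (q + 1)
  · exact key y y' hy hy' h h' hp hmin hc
  · refine key y' y hy' hy h' h hp.symm (fun r hr => (hmin r hr).symm) ?_
    have := hmin q (by omega)
    rw [← hp]
    revert this hc
    cases y q <;> cases y' q <;> cases y (q + 1) <;> simp

theorem firstSign_eq {x : Finset (ℕ × Bool)} (hx : IsSignVector N x) {y : ℕ → Bool}
    (hy : Extends y x) (h : turns y 0 (N - 1) = maxTurns N x) : firstSign N x = y 0 := by
  classical
  unfold firstSign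
  by_cases h0 : y 0 = true
  · rw [h0]
    simp only [decide_eq_true_eq]
    exact ⟨y, hy, h, h0⟩
  · have : y 0 = false := by simpa using h0
    rw [this]
    simp only [decide_eq_false_iff_not]
    rintro ⟨y', hy', h', h0'⟩
    rw [first_eq_of_max hx hy hy' h h'] at h0
    exact h0 h0'

theorem mem_image_opp {x : Finset (ℕ × Bool)} {t : ℕ} {c : Bool} :
    (t, c) ∈ x.image opp ↔ (t, !c) ∈ x := by
  rw [Finset.mem_image]
  constructor
  · rintro ⟨a, ha, h⟩
    have : a = opp (t, c) := by rw [← h, opp_opp]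
    rw [this] at ha
    exact ha
  · intro h
    exact ⟨_, h, by simp [opp]⟩

theorem exceeds_opp {x : Finset (ℕ × Bool)} {i : ℕ} {c : Bool} :
    Exceeds A B (x.image opp) i c ↔ Exceeds A B x i (!c) := by
  simp only [Exceeds, mem_image_opp]

theorem Exceeds.mono {x y : Finset (ℕ × Bool)} (h : x ⊆ y) {i : ℕ} {c : Bool}
    (hx : Exceeds A B x i c) : Exceeds A B y i c := by
  refine lt_of_lt_of_le hx (Nat.mul_le_mul_left 2 (Finset.card_le_card ?_))
  intro t
  simp only [Finset.mem_filter]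
  exact fun ht => ⟨ht.1, h ht.2⟩

theorem not_exceeds_both {x : Finset (ℕ × Bool)} (hx : IsSignVector N x) {i : ℕ}
    (h1 : Exceeds A B x i true) (h2 : Exceeds A B x i false) : False := by
  unfold Exceeds at h1 h2
  have hd : Disjoint ((Finset.Ico (A i) (B i)).filter (fun t => (t, true) ∈ x))
      ((Finset.Ico (A i) (B i)).filter (fun t => (t, false) ∈ x)) := by
    rw [Finset.disjoint_filter]
    intro t _ h h'
    exact hx.2.2 _ h h'
  have := Finset.card_union_of_disjoint hd
  have hle : ((Finset.Ico (A i) (B i)).filter (fun t => (t, true) ∈ x) ∪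
      (Finset.Ico (A i) (B i)).filter (fun t => (t, false) ∈ x)).card ≤ B i - A i := by
    rw [← Nat.card_Ico]
    apply Finset.card_le_card
    exact Finset.union_subset (Finset.filter_subset _ _) (Finset.filter_subset _ _)
  omega

theorem isSignVector_opp {x : Finset (ℕ × Bool)} (hx : IsSignVector N x) :
    IsSignVector N (x.image opp) := by
  refine ⟨hx.1.image _, ?_, ?_⟩
  · rintro ⟨t, c⟩ ha
    rw [mem_image_opp] at ha
    exact hx.2.1 (t, !c) ha
  · rintro ⟨t, c⟩ ha ha'
    rw [mem_image_opp] at ha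
    simp only [opp] at ha'
    rw [mem_image_opp] at ha'
    exact hx.2.2 _ ha (by simpa [opp] using ha')

theorem extends_opp {x : Finset (ℕ × Bool)} {y : ℕ → Bool} (hy : Extends y x) :
    Extends (fun t => !y t) (x.image opp) := by
  rintro ⟨t, c⟩ ha
  rw [mem_image_opp] at ha
  have := hy _ ha
  simp only at this
  simp [this]

theorem maxTurns_opp {x : Finset (ℕ × Bool)} (hx : IsSignVector N x) :
    maxTurns N (x.image opp) = maxTurns N x := by
  have key : ∀ x, IsSignVector N x → maxTurns N x ≤ maxTurns N (x.image opp) := by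
    intro x hx
    obtain ⟨y, hy, h⟩ := exists_maxTurns hx
    rw [← h, ← turns_not]
    exact turns_le_maxTurns (extends_opp hy)
  apply le_antisymm _ (key x hx)
  have := key _ (isSignVector_opp hx)
  rwa [Finset.image_image, show opp ∘ opp = id from funext opp_opp, Finset.image_id] at this

theorem beadLabel_opp {x : Finset (ℕ × Bool)} (hx : IsSignVector N x) :
    beadLabel N n A B (x.image opp) = opp (beadLabel N n A B x) := by
  have e : ∀ i, (∃ c, Exceeds A B (x.image opp) i c) ↔ ∃ c, Exceeds A B x i c := by
    intro i
    simp only [exceeds_opp]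
    constructor
    · rintro ⟨c, h⟩; exact ⟨_, h⟩
    · rintro ⟨c, h⟩; exact ⟨!c, by simpa using h⟩
  have eset : {i | i < n ∧ ∃ c, Exceeds A B (x.image opp) i c} =
      {i | i < n ∧ ∃ c, Exceeds A B x i c} := by
    ext i; simp only [Set.mem_setOf_eq, e]
  unfold beadLabel
  by_cases h : ∃ i < n, ∃ c, Exceeds A B x i c
  · have h' : ∃ i < n, ∃ c, Exceeds A B (x.image opp) i c := by simpa only [e] using h
    rw [if_pos h, if_pos h', eset]
    have hmem : sInf {i | i < n ∧ ∃ c, Exceeds A B x i c} ∈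
        {i | i < n ∧ ∃ c, Exceeds A B x i c} := by
      obtain ⟨i, hi⟩ := h
      exact Nat.sInf_mem (s := {i | i < n ∧ ∃ c, Exceeds A B x i c}) ⟨i, hi⟩
    obtain ⟨-, c, hc⟩ := hmem
    simp only [opp, exceeds_opp, Prod.mk.injEq, true_and, Bool.not_true]
    set i := sInf {i | i < n ∧ ∃ c, Exceeds A B x i c}
    cases c
    · have : ¬ Exceeds A B x i true := fun h => not_exceeds_both hx h hc
      simp [exceeds_opp, this, hc]
    · have : ¬ Exceeds A B x i false := fun h => not_exceeds_both hx hc h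
      simp [exceeds_opp, this, hc]
  · have h' : ¬ ∃ i < n, ∃ c, Exceeds A B (x.image opp) i c := by simpa only [e] using h
    rw [if_neg h, if_neg h']
    obtain ⟨y, hy, hm⟩ := exists_maxTurns hx
    have h2 : turns (fun t => !y t) 0 (N - 1) = maxTurns N (x.image opp) := by
      rw [turns_not, maxTurns_opp hx, hm]
    rw [firstSign_eq (isSignVector_opp hx) (extends_opp hy) h2, firstSign_eq hx hy hm,
      maxTurns_opp hx]
    rfl

/-- A majority persists in a larger vector, and both signs cannot have one. For labels of the second
kind, equal values mean equal maximal numbers of turns; a maximal extension of `y` is then also a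
maximal extension of `x`, so the first signs agree. `hbig` makes the truncated subtraction in the
label injective. -/
theorem beadLabel_comp (hbig : ∀ x, IsSignVector N x → (¬ ∃ i < n, ∃ c, Exceeds A B x i c) →
      n + 1 ≤ maxTurns N x) {x y : Finset (ℕ × Bool)} (hx : IsSignVector N x)
    (hy : IsSignVector N y) (hxy : x ⊆ y)
    (h : (beadLabel N n A B x).1 = (beadLabel N n A B y).1) :
    (beadLabel N n A B x).2 = (beadLabel N n A B y).2 := by
  have hmem : ∀ x, (∃ i < n, ∃ c, Exceeds A B x i c) →
      sInf {i | i < n ∧ ∃ c, Exceeds A B x i c} < n ∧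
      ∃ c, Exceeds A B x (sInf {i | i < n ∧ ∃ c, Exceeds A B x i c}) c := by
    rintro x ⟨i, hi⟩
    exact Nat.sInf_mem (s := {i | i < n ∧ ∃ c, Exceeds A B x i c}) ⟨i, hi⟩
  unfold beadLabel at h ⊢
  split_ifs at h ⊢ with h1 h2 h2
  · simp only at h ⊢
    rw [← h]
    obtain ⟨-, c, hc⟩ := hmem x h1
    set i := sInf {i | i < n ∧ ∃ c, Exceeds A B x i c}
    cases c
    · have h3 : ¬ Exceeds A B x i true := fun h => not_exceeds_both hx h hc
      have h4 : ¬ Exceeds A B y i true := fun h => not_exceeds_both hy h (hc.mono hxy)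
      simp [h3, h4]
    · simp [hc, hc.mono hxy]
  · have := (hmem x h1).1
    simp only at h
    omega
  · have := (hmem y h2).1
    simp only at h
    omega
  · simp only at h ⊢
    have hbx := hbig x hx h1
    have hby := hbig y hy h2
    obtain ⟨z, hz, hm⟩ := exists_maxTurns hy
    have hzx : Extends z x := fun a ha => hz a (hxy ha)
    rw [firstSign_eq hy hz hm, firstSign_eq hx hzx (by omega)]

/-- The extension of `x` that changes its sign in front of every zero of `x`. -/
noncomputable def zigzag (x : Finset (ℕ × Bool)) : ℕ → Bool
  | 0 => open Classical in decide ((0, true) ∈ x)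
  | t + 1 => open Classical in
    if (t + 1, true) ∈ x then true else if (t + 1, false) ∈ x then false else !zigzag x t

theorem extends_zigzag {x : Finset (ℕ × Bool)} (hx : IsSignVector N x) : Extends (zigzag x) x := by
  rintro ⟨t, c⟩ ha
  have hne := hx.2.2 _ ha
  simp only [opp] at hne
  cases t with
  | zero => cases c <;> simp_all [zigzag]
  | succ t => cases c <;> simp_all [zigzag]

-- Each zero other than the bead `0` forces a turn of `zigzag` just before it; the bead `0` accounts
-- for the `+ 1`.
open Finset in
theorem card_zeros_le (x : Finset (ℕ × Bool)) :
    #{t ∈ range N | (t, true) ∉ x ∧ (t, false) ∉ x} ≤ turns (zigzag x) 0 (N - 1) + 1 := by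
  have : ({t ∈ range N | (t, true) ∉ x ∧ (t, false) ∉ x} : Finset ℕ) ⊆
      insert 0 (({t ∈ Ico 0 (N - 1) | zigzag x t ≠ zigzag x (t + 1)} : Finset ℕ).image
        (fun t => t + 1)) := by
    intro t ht
    simp only [mem_filter, mem_range] at ht
    cases t with
    | zero => simp
    | succ t =>
      apply mem_insert_of_mem
      rw [mem_image]
      refine ⟨t, ?_, rfl⟩
      simp only [mem_filter, mem_Ico, Nat.zero_le, true_and]
      refine ⟨by omega, ?_⟩
      simp [zigzag, ht.2.1, ht.2.2]
  refine (card_le_card this).trans ((card_insert_le _ _).trans ?_)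
  exact Nat.add_le_add_right card_image_le 1

open Finset in
/-- For `n` intervals of beads there is a sign sequence with at most `n` sign changes that is
almost balanced on each of them. -/
theorem exists_balanced_beads (hN : 0 < N) (hB : ∀ i < n, B i ≤ N) :
    ∃ y : ℕ → Bool, turns y 0 (N - 1) ≤ n ∧ ∀ i < n, A i ≤ B i →
      2 * ups y (A i) (B i) ≤ B i - A i + 2 * (n + 1) ∧
      B i - A i ≤ 2 * ups y (A i) (B i) + 2 * (n + 1) := by
  classical
  -- For `n ≥ N` the allowed error exceeds the length of every interval, so a constant sequence will
  -- do. Otherwise labels below `n` are below `N - 1`, as the contradiction with Tucker's lemma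
  -- requires.
  rcases Nat.lt_or_ge n N with hnN | hnN
  swap
  · refine ⟨fun _ => true, ?_, ?_⟩
    · have := turns_le (fun _ => true) 0 (N - 1); omega
    · intro i hi _
      have := ups_le (fun _ => true) (A i) (B i)
      have := hB i hi
      omega
  obtain ⟨x, hx, hne, hle⟩ : ∃ x, IsSignVector N x ∧ (¬ ∃ i < n, ∃ c, Exceeds A B x i c) ∧
      maxTurns N x ≤ n := by
    by_contra hcon
    push Not at hcon
    have hbig : ∀ x, IsSignVector N x → (¬ ∃ i < n, ∃ c, Exceeds A B x i c) →
        n + 1 ≤ maxTurns N x := by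
      intro x hx h
      exact hcon x hx (by simpa using h)
    obtain ⟨x, hx, h⟩ := exists_le_label (L := beadLabel N n A B) (fun x hx => beadLabel_opp hx)
      (fun x y hx hy hxy h => beadLabel_comp hbig hx hy hxy h) hN
    unfold beadLabel at h
    split_ifs at h with h1
    · obtain ⟨i, hi⟩ := h1
      have := Nat.sInf_mem (s := {i | i < n ∧ ∃ c, Exceeds A B x i c}) ⟨i, hi⟩
      have := this.1
      simp only at h
      omega
    · have := hbig x hx h1
      have := maxTurns_le hx
      simp only at h
      omega
  push Not at hne
  have hz := (card_zeros_le (N := N) x)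
  have hex := extends_zigzag hx
  have hturn := turns_le_maxTurns (N := N) hex
  refine ⟨zigzag x, hturn.trans hle, fun i hi hAB => ?_⟩
  -- Each sign of the extension occurs at most as often as in `x`, that is, in at most half of the
  -- interval, plus once for each of the at most `n + 1` zeros.
  have hcount : ∀ c, #{t ∈ Ico (A i) (B i) | zigzag x t = c} ≤
      #{t ∈ Ico (A i) (B i) | (t, c) ∈ x} + #{t ∈ range N | (t, true) ∉ x ∧ (t, false) ∉ x} := by
    intro c
    refine (card_le_card ?_).trans (card_union_le _ _)
    intro t ht
    rw [mem_filter, mem_Ico] at ht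
    simp only [mem_union, mem_filter, mem_Ico, mem_range]
    by_cases h1 : (t, true) ∈ x
    · left
      have := hex _ h1
      simp only at this
      rw [← ht.2, this]
      exact ⟨ht.1, h1⟩
    · by_cases h2 : (t, false) ∈ x
      · left
        have := hex _ h2
        simp only at this
        rw [← ht.2, this]
        exact ⟨ht.1, h2⟩
      · right
        have := hB i hi
        exact ⟨by omega, h1, h2⟩
  have hup := ups_not (zigzag x) (A i) (B i)
  have h1 := hcount true
  have h2 := hcount false
  have e1 := hne i hi true
  have e2 := hne i hi false
  unfold Exceeds at e1 e2
  have e3 : ups (fun t => !zigzag x t) (A i) (B i) = #{t ∈ Ico (A i) (B i) | zigzag x t = false} := by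
    simp [ups]
  change ups (zigzag x) (A i) (B i) ≤ _ at h1
  rw [← e3] at h2
  omega

end Beads

/-! ### Rounding from beads to cells. -/

/-- Sign sequences on `m Q` beads can be rounded to sequences on `m` cells of `Q` beads. -/
theorem exists_rounding (y : ℕ → Bool) {Q : ℕ} (hQ : 0 < Q) (m : ℕ) :
    ∃ s : ℕ → Bool,
      turns s 0 m + (if s m = y ((m + 1) * Q - 1) then 0 else 1) ≤ turns y 0 ((m + 1) * Q - 1) ∧
      ∀ k ≤ m + 1, 2 * (Q * ups s 0 k) ≤ 2 * ups y 0 (k * Q) + Q ∧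
        2 * ups y 0 (k * Q) ≤ 2 * (Q * ups s 0 k) + Q := by
  -- the choice of a value for a block, given the accumulated error
  have choice : ∀ (a S : ℕ), 2 * (Q * S) ≤ 2 * ups y 0 a + Q → 2 * ups y 0 a ≤ 2 * (Q * S) + Q →
      ∃ e : Bool, (∃ c, a ≤ c ∧ c ≤ a + Q - 1 ∧ y c = e) ∧
        2 * (Q * (S + e.toNat)) ≤ 2 * ups y 0 (a + Q) + Q ∧
        2 * ups y 0 (a + Q) ≤ 2 * (Q * (S + e.toNat)) + Q := by
    intro a S h1 h2
    have hadd := ups_add y (Nat.zero_le a) (Nat.le_add_right a Q)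
    have hle := ups_le y a (a + Q)
    by_cases hT : ∃ c, a ≤ c ∧ c ≤ a + Q - 1 ∧ y c = true
    · by_cases hF : ∃ c, a ≤ c ∧ c ≤ a + Q - 1 ∧ y c = false
      -- If both values occur in the block, either may be chosen, and one of them keeps the
      -- accumulated error within `Q / 2`. A constant block leaves no choice, but its only value
      -- leaves the error unchanged.
      · by_cases hc : 2 * (Q * S) + Q ≤ 2 * ups y 0 (a + Q)
        · refine ⟨true, hT, ?_, ?_⟩ <;> simp only [Bool.toNat_true, mul_add, mul_one] <;> omega
        · refine ⟨false, hF, ?_, ?_⟩ <;> simp only [Bool.toNat_false, add_zero] <;> omega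
      · refine ⟨true, hT, ?_⟩
        have : ups y a (a + Q) = Q := by
          have e : ups y a (a + Q) = ups (fun _ => true) a (a + Q) := by
            apply ups_congr
            intro t ht ht'
            by_contra hcon
            exact hF ⟨t, ht, by omega, by simpa using hcon⟩
          rw [e]
          simp [ups]
        simp only [Bool.toNat_true, mul_add, mul_one]
        omega
    · refine ⟨false, ⟨a, le_rfl, by omega, ?_⟩, ?_⟩
      · by_contra hcon
        exact hT ⟨a, le_rfl, by omega, by simpa using hcon⟩
      · have : ups y a (a + Q) = 0 := by
          have e : ups y a (a + Q) = ups (fun _ => false) a (a + Q) := by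
            apply ups_congr
            intro t ht ht'
            by_contra hcon
            exact hT ⟨t, ht, by omega, by simpa using hcon⟩
          rw [e]
          simp [ups]
        simp only [Bool.toNat_false, add_zero]
        omega
  -- Each value of `s` is a value of `y` inside the corresponding block, so `s` changes no more
  -- often than `y`. The additional summand in the claim records a change of `y` between the sampled
  -- bead and the end of its block, which the induction needs.
  induction m with
  | zero =>
    obtain ⟨e, ⟨c, -, hc, hce⟩, h1, h2⟩ := choice 0 0 (by simp) (by simp [ups_self])
    refine ⟨fun _ => e, ?_, ?_⟩
    · have := turns_ge_of_between (s := y) (Nat.zero_le c) hc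
      simp only [turns_self, zero_add, one_mul]
      rw [hce] at this
      simp only [zero_add] at this
      omega
    · intro k hk
      interval_cases k
      · simp [ups_self]
      · have e1 : ups (fun _ => e) 0 1 = e.toNat := ups_one _ 0
        simp only [zero_add] at h1 h2
        simp only [e1, one_mul]
        exact ⟨h1, h2⟩
  | succ m ih =>
    obtain ⟨s, hs, hb⟩ := ih
    obtain ⟨e, ⟨c, hac, hc, hce⟩, h1, h2⟩ := choice ((m + 1) * Q) (ups s 0 (m + 1))
      (hb (m + 1) le_rfl).1 (hb (m + 1) le_rfl).2
    have hpos : 0 < (m + 1) * Q := by positivity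
    have hs' : ∀ k ≤ m + 1, ups (Function.update s (m + 1) e) 0 k = ups s 0 k := by
      intro k hk
      apply ups_congr
      intro t _ ht
      rw [Function.update_of_ne (by omega)]
    have hmul : (m + 1 + 1) * Q = (m + 1) * Q + Q := by ring
    refine ⟨Function.update s (m + 1) e, ?_, ?_⟩
    · rw [turns_succ _ (Nat.zero_le m), Function.update_self,
        Function.update_of_ne (by omega : m ≠ m + 1)]
      have e1 : turns (Function.update s (m + 1) e) 0 m = turns s 0 m := by
        apply turns_congr
        intro t _ ht
        rw [Function.update_of_ne (by omega)]
      rw [e1, hmul, ← turns_add y (Nat.zero_le ((m + 1) * Q - 1))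
        (show (m + 1) * Q - 1 ≤ (m + 1) * Q + Q - 1 by omega),
        ← turns_add y (show (m + 1) * Q - 1 ≤ (m + 1) * Q by omega)
        (show (m + 1) * Q ≤ (m + 1) * Q + Q - 1 by omega)]
      have t1 := turns_ge_of_between (s := y) hac hc
      have t2 : turns y ((m + 1) * Q - 1) ((m + 1) * Q) =
          if y ((m + 1) * Q - 1) = y ((m + 1) * Q) then 0 else 1 := by
        have := turns_one y ((m + 1) * Q - 1)
        rwa [show (m + 1) * Q - 1 + 1 = (m + 1) * Q by omega] at this
      rw [hce] at t1
      have tri : ∀ p q r w : Bool, (if p = e then 0 else 1) ≤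
          (if p = q then 0 else 1) + (if q = r then 0 else 1) + (if r = e then 0 else (1 : ℕ)) := by
        intro p q r w
        cases p <;> cases q <;> cases r <;> cases e <;> simp
      have := tri (s m) (y ((m + 1) * Q - 1)) (y ((m + 1) * Q)) true
      omega
    · intro k hk
      rcases Nat.lt_or_ge k (m + 2) with hlt | hge
      · rw [hs' k (by omega)]
        exact hb k (by omega)
      · obtain rfl : k = m + 1 + 1 := by omega
        rw [ups_succ _ (Nat.zero_le (m + 1)), hs' (m + 1) le_rfl, Function.update_self, hmul]
        exact ⟨h1, h2⟩

/-- Every family of `n` intervals of cells admits a sign sequence that starts with `false`, has at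
most `n` sign changes and is balanced on each interval up to two. -/
theorem exists_balanced (m n : ℕ) (α β : ℕ → ℕ) (hαβ : ∀ i < n, α i ≤ β i) (hβ : ∀ i < n, β i ≤ m) :
    ∃ s : ℕ → Bool, s 0 = false ∧ turns s 0 m ≤ n ∧ ∀ i < n,
      2 * ups s (α i) (β i) ≤ β i - α i + 2 ∧ β i - α i ≤ 2 * ups s (α i) (β i) + 2 := by
  suffices H : ∃ s : ℕ → Bool, turns s 0 m ≤ n ∧ ∀ i < n,
      2 * ups s (α i) (β i) ≤ β i - α i + 2 ∧ β i - α i ≤ 2 * ups s (α i) (β i) + 2 by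
    obtain ⟨s, h1, h2⟩ := H
    by_cases h0 : s 0 = false
    · exact ⟨s, h0, h1, h2⟩
    · refine ⟨fun t => !s t, by simpa using h0, by rwa [turns_not], fun i hi => ?_⟩
      have := ups_not s (α i) (β i)
      have := h2 i hi
      omega
  cases m with
  | zero =>
    refine ⟨fun _ => true, by simp [turns_self], fun i hi => ?_⟩
    have := hβ i hi
    have := ups_le (fun _ => true) (α i) (β i)
    omega
  | succ m =>
    -- In units of half a bead, the imbalance is at most `2 (n + 1)` from the beads and `Q` from the
    -- rounding at either end. As `Q > 2 (n + 1)`, the sum is less than `3 Q`, so the imbalance in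
    -- cells is an integer less than 3.
    set Q := 2 * (n + 1) + 1 with hQ
    obtain ⟨y, hy, hbal⟩ := exists_balanced_beads (N := (m + 1) * Q) (n := n)
      (A := fun i => α i * Q) (B := fun i => β i * Q) (by positivity)
      (fun i hi => Nat.mul_le_mul_right Q (hβ i hi))
    obtain ⟨s, hs, hb⟩ := exists_rounding y (show 0 < Q by omega) m
    -- `turns` up to the number of cells also looks at the first index beyond the last cell;
    -- continuing with a constant avoids a spurious change there.
    refine ⟨fun t => if t ≤ m then s t else s m, ?_, fun i hi => ?_⟩
    · rw [turns_succ _ (Nat.zero_le m)]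
      have : turns (fun t => if t ≤ m then s t else s m) 0 m = turns s 0 m := by
        apply turns_congr
        intro t _ ht
        simp [ht]
      rw [this]
      simp
      omega
    · have h1 := hαβ i hi
      have h2 := hβ i hi
      have e : ∀ a b, b ≤ m + 1 → ups (fun t => if t ≤ m then s t else s m) a b = ups s a b := by
        intro a b hbm
        apply ups_congr
        intro t _ ht
        rw [if_pos (by omega)]
      rw [e _ _ h2]
      have hAB := hbal i hi (Nat.mul_le_mul_right Q h1)
      have hu1 := ups_add s (Nat.zero_le (α i)) h1
      have hu2 := ups_add y (Nat.zero_le (α i * Q)) (Nat.mul_le_mul_right Q h1)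
      have hbα := hb (α i) (by omega)
      have hbβ := hb (β i) h2
      obtain ⟨l, hl⟩ := Nat.exists_eq_add_of_le h1
      rw [← hu1] at hbβ
      rw [← hu2] at hbβ
      rw [hl] at hAB hbβ ⊢
      simp only [add_mul, Nat.add_sub_cancel_left, mul_add] at hAB hbβ hbα ⊢
      set u := ups s (α i) (α i + l)
      constructor
      · by_contra hcon
        have : Q * (l + 3) ≤ Q * (2 * u) := Nat.mul_le_mul_left Q (by omega)
        have e1 : Q * (l + 3) = l * Q + 3 * Q := by ring
        have e2 : Q * (2 * u) = 2 * (Q * u) := by ring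
        omega
      · by_contra hcon
        have : Q * (2 * u + 3) ≤ Q * l := Nat.mul_le_mul_left Q (by omega)
        have e1 : Q * (2 * u + 3) = 2 * (Q * u) + 3 * Q := by ring
        have e2 : Q * l = l * Q := by ring
        omega

end ConsensusHalving

namespace ConsensusHalving

/-! ## Codes for the states of the dynamic program -/

/-- The weights of layer `k`: position `p` is live if `k < reach p`. The first component at `p` is
the number of codes of sign sequences of length `p`, the second one the weight of the last live
position before `p`. -/
def weightPair (reach : ℕ → ℕ) (k : ℕ) : ℕ → ℕ × ℕ
  | 0 => (1, 0)
  | p + 1 =>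
    if k < reach p then
      ((weightPair reach k p).1 + (weightPair reach k p).1, (weightPair reach k p).1)
    else ((weightPair reach k p).1 + (weightPair reach k p).2, (weightPair reach k p).2)

/-- The number of codes of sign sequences of length `p`. -/
def codeCount (reach : ℕ → ℕ) (k p : ℕ) : ℕ := (weightPair reach k p).1

/-- The weight of the cell `p` in the codes of layer `k`. -/
def cellWeight (reach : ℕ → ℕ) (k p : ℕ) : ℕ := (weightPair reach k (p + 1)).2

/-- The code of the first `p` values of `s`. -/
def code (reach : ℕ → ℕ) (k : ℕ) (s : ℕ → Bool) : ℕ → ℕ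
  | 0 => 0
  | p + 1 => code reach k s p + (s p).toNat * cellWeight reach k p

section Codes

variable {reach : ℕ → ℕ} {k : ℕ}

theorem codeCount_zero : codeCount reach k 0 = 1 := rfl

theorem codeCount_succ (p : ℕ) :
    codeCount reach k (p + 1) = codeCount reach k p + cellWeight reach k p := by
  unfold codeCount cellWeight
  simp only [weightPair]
  split_ifs <;> rfl

theorem cellWeight_of_live {p : ℕ} (h : k < reach p) :
    cellWeight reach k p = codeCount reach k p := by
  simp [cellWeight, codeCount, weightPair, h]

theorem cellWeight_zero_of_not_live (h : ¬ k < reach 0) : cellWeight reach k 0 = 0 := by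
  simp [cellWeight, weightPair, h]

theorem cellWeight_succ_of_not_live {p : ℕ} (h : ¬ k < reach (p + 1)) :
    cellWeight reach k (p + 1) = cellWeight reach k p := by
  unfold cellWeight
  rw [weightPair, if_neg h]

/-- This keeps the set of codes free of holes: the codes with last value `true` are shifted by at
most the number of codes already present. -/
theorem cellWeight_le (p : ℕ) : cellWeight reach k p ≤ codeCount reach k p := by
  induction p with
  | zero =>
    by_cases h : k < reach 0
    · rw [cellWeight_of_live h]
    · rw [cellWeight_zero_of_not_live h]; omega
  | succ p ih =>
    by_cases h : k < reach (p + 1)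
    · rw [cellWeight_of_live h]
    · rw [cellWeight_succ_of_not_live h, codeCount_succ]; omega

theorem code_lt (s : ℕ → Bool) (p : ℕ) : code reach k s p < codeCount reach k p := by
  induction p with
  | zero => simp [code, codeCount_zero]
  | succ p ih =>
    rw [code, codeCount_succ]
    cases s p <;> simp <;> omega

theorem code_congr {s s' : ℕ → Bool} {p : ℕ} (h : ∀ t < p, s t = s' t) :
    code reach k s p = code reach k s' p := by
  induction p with
  | zero => rfl
  | succ p ih =>
    rw [code, code, ih (fun t ht => h t (by omega)), h p (by omega)]

/-- Every number below the code count is the code of some sequence, so that the program may run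
through all of them and each table entry has a meaning. -/
theorem exists_code_eq {p c : ℕ} (hc : c < codeCount reach k p) :
    ∃ s, code reach k s p = c := by
  induction p generalizing c with
  | zero =>
    rw [codeCount_zero] at hc
    exact ⟨fun _ => false, by simp [code]; omega⟩
  | succ p ih =>
    rw [codeCount_succ] at hc
    have hle := cellWeight_le (reach := reach) (k := k) p
    by_cases h : c < codeCount reach k p
    · obtain ⟨s, hs⟩ := ih h
      refine ⟨Function.update s p false, ?_⟩
      rw [code, Function.update_self, ← hs]
      simp only [Bool.toNat_false, zero_mul, add_zero]
      exact code_congr fun t ht => Function.update_of_ne (by omega) _ _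
    · obtain ⟨s, hs⟩ := ih (c := c - cellWeight reach k p) (by omega)
      refine ⟨Function.update s p true, ?_⟩
      rw [code, Function.update_self]
      have : code reach k (Function.update s p true) p = code reach k s p :=
        code_congr fun t ht => Function.update_of_ne (by omega) _ _
      rw [this, hs]
      simp only [Bool.toNat_true, one_mul]
      omega

theorem cellWeight_eq_of_gap {p q : ℕ} (hp : k < reach p)
    (hgap : ∀ t, p < t → t < q → ¬ k < reach t) :
    ∀ t, p ≤ t → t < q → cellWeight reach k t = codeCount reach k p := by
  intro t ht
  induction t, ht using Nat.le_induction with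
  | base => intro _; exact cellWeight_of_live hp
  | succ t ht ih =>
    intro htq
    rw [cellWeight_succ_of_not_live (hgap _ (by omega) htq), ih (by omega)]

/-- The codes form a mixed radix system. The digit of a live position `p` is the number of `true`
values from `p` up to the next live position, and its place value is the number of codes for the
values before `p`; together with `code_lt` this permits decoding by division. Cells before the first
live position have weight zero and are forgotten. -/
theorem code_eq_of_gap (s : ℕ → Bool) {p q : ℕ} (hpq : p < q) (hp : k < reach p)
    (hgap : ∀ t, p < t → t < q → ¬ k < reach t) :
    code reach k s q = code reach k s p + ups s p q * codeCount reach k p := by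
  have hw := cellWeight_eq_of_gap hp hgap
  have : ∀ r, p ≤ r → r ≤ q →
      code reach k s r = code reach k s p + ups s p r * codeCount reach k p := by
    intro r hr
    induction r, hr using Nat.le_induction with
    | base => intro _; simp [ups_self]
    | succ r hr ih =>
      intro hrq
      rw [code, ih (by omega), hw r hr (by omega), ups_succ s hr]
      ring
  exact this q hpq.le le_rfl

theorem code_eq_zero_of_gap (s : ℕ → Bool) {q : ℕ} (hgap : ∀ t < q, ¬ k < reach t) :
    code reach k s q = 0 := by
  have hw : ∀ t < q, cellWeight reach k t = 0 := by
    intro t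
    induction t with
    | zero => intro h; exact cellWeight_zero_of_not_live (hgap 0 h)
    | succ t ih =>
      intro h
      rw [cellWeight_succ_of_not_live (hgap _ h), ih (by omega)]
  have : ∀ r ≤ q, code reach k s r = 0 := by
    intro r
    induction r with
    | zero => intro _; rfl
    | succ r ih =>
      intro h
      rw [code, ih (by omega), hw r (by omega)]
      simp
  exact this q le_rfl

-- The number of codes is a product of factors `gap + 1`. Charging `N` to each live position and `1
-- + 1/N` to each cell bounds it without bounding the gaps one by one, which would introduce a
-- constant to the power of the number of live positions.
open Finset in
theorem codeCount_le {N : ℝ} (hN : 1 ≤ N) (p : ℕ) :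
    (codeCount reach k p : ℝ) ≤ N ^ #{t ∈ range p | k < reach t} * (1 + 1 / N) ^ p := by
  have hN0 : 0 < N := by linarith
  have h1 : (1 : ℝ) ≤ 1 + 1 / N := by
    have : 0 < 1 / N := by positivity
    linarith
  -- The weight gains a factor `N` over the count: it is added at a dead cell, where the bound grows
  -- only by the fraction `1/N`, and it is reset to the count at a live cell, where the bound grows
  -- by `N + 1`.
  suffices H : (codeCount reach k p : ℝ) ≤ N ^ #{t ∈ range p | k < reach t} * (1 + 1 / N) ^ p ∧
      ((weightPair reach k p).2 : ℝ) * N ≤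
        N ^ #{t ∈ range p | k < reach t} * (1 + 1 / N) ^ p from H.1
  induction p with
  | zero => simp [codeCount, weightPair]
  | succ p ih =>
    obtain ⟨ih1, ih2⟩ := ih
    have hcard : #{t ∈ range (p + 1) | k < reach t} =
        #{t ∈ range p | k < reach t} + if k < reach p then 1 else 0 := by
      rw [range_add_one, filter_insert]
      split_ifs with h
      · rw [card_insert_of_notMem (by simp)]
      · rfl
    have hpos : 0 ≤ N ^ #{t ∈ range p | k < reach t} * (1 + 1 / N) ^ p := by positivity
    set X := N ^ #{t ∈ range p | k < reach t} * (1 + 1 / N) ^ p with hX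
    by_cases h : k < reach p
    · rw [hcard, if_pos h]
      have e : N ^ (#{t ∈ range p | k < reach t} + 1) * (1 + 1 / N) ^ (p + 1) = X * (N + 1) := by
        rw [hX, pow_succ, pow_succ]
        field_simp
      rw [e, codeCount_succ, cellWeight_of_live h]
      simp only [weightPair, h, if_true]
      change ((codeCount reach k p + codeCount reach k p : ℕ) : ℝ) ≤ _ ∧
        (codeCount reach k p : ℝ) * N ≤ _
      push_cast
      constructor
      · nlinarith
      · nlinarith
    · rw [hcard, if_neg h, add_zero]
      have e : N ^ #{t ∈ range p | k < reach t} * (1 + 1 / N) ^ (p + 1) = X + X / N := by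
        rw [hX, pow_succ]
        field_simp
      have hXN : 0 ≤ X / N := by positivity
      have e2 : (codeCount reach k (p + 1)) = codeCount reach k p + (weightPair reach k p).2 := by
        simp only [codeCount, weightPair, h, if_false]
      rw [e, e2]
      simp only [weightPair, h, if_false]
      push_cast
      constructor
      · have : ((weightPair reach k p).2 : ℝ) ≤ X / N := by
          rw [le_div_iff₀ hN0]; exact ih2
        linarith
      · linarith

end Codes

/-! ### The Bellman recursion on layers. -/

/-- The intervals `[al i, be i)` that end at `k` are balanced up to two. -/
def BalancedAt (n : ℕ) (al be : ℕ → ℕ) (k : ℕ) (s : ℕ → Bool) : Prop :=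
  ∀ i < n, be i = k → al i < k → 2 * ups s (al i) k + al i ≤ k + 2 ∧ k ≤ 2 * ups s (al i) k + al i + 2

theorem balancedAt_congr {n : ℕ} {al be : ℕ → ℕ} {k : ℕ} {s s' : ℕ → Bool}
    (h : ∀ t < k, s t = s' t) (hs : BalancedAt n al be k s) : BalancedAt n al be k s' := by
  intro i hi hb ha
  rw [← ups_congr (s := s) fun t _ ht => h t ht]
  exact hs i hi hb ha

/-- The number of table entries (for each direction) behind the ones of layer `k`. -/
def offset (reach : ℕ → ℕ) (m k : ℕ) : ℕ := ∑ j ∈ Finset.Ico (k + 1) (m + 1), codeCount reach j j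

theorem offset_self (reach : ℕ → ℕ) (m : ℕ) : offset reach m m = 0 := by simp [offset]

theorem offset_eq (reach : ℕ → ℕ) {m k : ℕ} (h : k < m) :
    offset reach m k = offset reach m (k + 1) + codeCount reach (k + 1) (k + 1) := by
  unfold offset
  rw [Finset.sum_eq_sum_Ico_succ_bot (by omega), add_comm]

/-- The table index of the state in layer `k` of a process that follows `s`. -/
def entry (reach : ℕ → ℕ) (m k : ℕ) (s : ℕ → Bool) : ℕ :=
  2 * (offset reach m k + code reach k s k) + (s k).toNat

/-- The entries of layer `k` hold the minimal number of sign changes from `k` on, or more than `n`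
if the process cannot be continued. -/
def LayerCorrect (n m : ℕ) (al be reach : ℕ → ℕ) (T X : ℕ → ℕ) (k : ℕ) : Prop :=
  ∀ s : ℕ → Bool,
    ((∀ j, k < j → j ≤ m → BalancedAt n al be j s) → T (entry reach m k s) ≤ turns s k m) ∧
    (k < m → T (entry reach m k s) ≤ n → BalancedAt n al be (k + 1) s ∧
      ∃ s', (∀ t ≤ k, s' t = s t) ∧ X (entry reach m k s) = entry reach m (k + 1) s' ∧
        T (entry reach m k s) = T (entry reach m (k + 1) s') + turns s' k (k + 1))

/-- One entry of a layer is correct if it is computed from the next layer by the Bellman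
recursion. -/
theorem layer_step {n m : ℕ} {al be reach T X : ℕ → ℕ} {k : ℕ} (hk : k < m) {s : ℕ → Bool}
    (hnext : LayerCorrect n m al be reach T X (k + 1)) {x : ℕ}
    (hx : x = 2 * (offset reach m (k + 1) + code reach (k + 1) s (k + 1)))
    (hbad : ¬ BalancedAt n al be (k + 1) s → n < T (entry reach m k s))
    (hgood : BalancedAt n al be (k + 1) s →
      (T (x + (s k).toNat) ≤ T (x + 1 - (s k).toNat) + 1 →
        T (entry reach m k s) = T (x + (s k).toNat) ∧ X (entry reach m k s) = x + (s k).toNat) ∧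
      (¬ T (x + (s k).toNat) ≤ T (x + 1 - (s k).toNat) + 1 →
        T (entry reach m k s) = T (x + 1 - (s k).toNat) + 1 ∧
          X (entry reach m k s) = x + 1 - (s k).toNat)) :
    ((∀ j, k < j → j ≤ m → BalancedAt n al be j s) → T (entry reach m k s) ≤ turns s k m) ∧
    (T (entry reach m k s) ≤ n → BalancedAt n al be (k + 1) s ∧
      ∃ s', (∀ t ≤ k, s' t = s t) ∧ X (entry reach m k s) = entry reach m (k + 1) s' ∧
        T (entry reach m k s) = T (entry reach m (k + 1) s') + turns s' k (k + 1)) := by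
  -- The code of layer `k + 1` does not involve the value at `k + 1`; the two possible successors of
  -- a state therefore lie at `x` and `x + 1`.
  have hentry : ∀ e : Bool, entry reach m (k + 1) (Function.update s (k + 1) e) = x + e.toNat := by
    intro e
    rw [entry, Function.update_self, hx]
    congr 3
    exact code_congr fun t ht => Function.update_of_ne (by omega) _ _
  have hsub : x + 1 - (s k).toNat = x + (!(s k)).toNat := by
    cases s k <;> simp
  rw [hsub] at hgood
  constructor
  -- The lower bound: a balanced continuation uses one of the two successors, and its turns are at
  -- least the table value there, plus one if the sign changes.
  · intro hbal
    have h := hgood (hbal (k + 1) (by omega) hk)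
    have h1 : T (entry reach m (k + 1) s) ≤ turns s (k + 1) m :=
      (hnext s).1 fun j hj => hbal j (by omega)
    have h2 : entry reach m (k + 1) s = x + (s (k + 1)).toNat := by
      rw [← hentry (s (k + 1)), Function.update_eq_self]
    rw [h2] at h1
    have h3 := turns_add s (show k ≤ k + 1 by omega) (show k + 1 ≤ m from hk)
    rw [turns_one] at h3
    by_cases hs : s k = s (k + 1)
    · rw [if_pos hs] at h3
      rw [← hs] at h1
      by_cases hc : T (x + (s k).toNat) ≤ T (x + (!(s k)).toNat) + 1
      · have := (h.1 hc).1
        omega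
      · have := (h.2 hc).1
        omega
    · rw [if_neg hs] at h3
      have hs' : s (k + 1) = !(s k) := by
        revert hs
        cases s k <;> cases s (k + 1) <;> simp
      rw [hs'] at h1
      by_cases hc : T (x + (s k).toNat) ≤ T (x + (!(s k)).toNat) + 1
      · have := (h.1 hc).1
        omega
      · have := (h.2 hc).1
        omega
  · intro hle
    have hb : BalancedAt n al be (k + 1) s := by
      by_contra hcon
      exact absurd (hbad hcon) (by omega)
    refine ⟨hb, ?_⟩
    have h := hgood hb
    have hupd : ∀ e, ∀ t ≤ k, Function.update s (k + 1) e t = s t := fun e t ht =>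
      Function.update_of_ne (by omega) _ _
    by_cases hc : T (x + (s k).toNat) ≤ T (x + (!(s k)).toNat) + 1
    · refine ⟨Function.update s (k + 1) (s k), hupd _, ?_⟩
      rw [hentry, turns_one, hupd _ k le_rfl, Function.update_self, if_pos rfl]
      exact ⟨(h.1 hc).2, (h.1 hc).1⟩
    · refine ⟨Function.update s (k + 1) (!(s k)), hupd _, ?_⟩
      rw [hentry, turns_one, hupd _ k le_rfl, Function.update_self, if_neg (by cases s k <;> simp)]
      exact ⟨(h.2 hc).2, (h.2 hc).1⟩

end ConsensusHalving

namespace ConsensusHalving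
open MeasureTheory

/-! ## Cuts on a grid -/

/-- The sign changes of `s` as cuts on the grid of width `1 / m`. -/
noncomputable def gridCuts (s : ℕ → Bool) (m : ℕ) : Finset ℝ :=
  ((Finset.Ico 0 m).filter (fun t => s t ≠ s (t + 1))).image (fun t : ℕ => ((t : ℝ) + 1) / m)

theorem card_gridCuts_le (s : ℕ → Bool) (m : ℕ) : (gridCuts s m).card ≤ turns s 0 m :=
  Finset.card_image_le

theorem even_turns_iff (s : ℕ → Bool) (t : ℕ) : Even (turns s 0 t) ↔ s t = s 0 := by
  induction t with
  | zero => simp [turns_self]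
  | succ t ih =>
    rw [turns_succ s (Nat.zero_le t)]
    split_ifs with h
    · rw [add_zero, ih, h]
    · rw [Nat.even_add_one, ih]
      revert h
      cases s t <;> cases s (t + 1) <;> cases s 0 <;> simp

theorem card_gridCuts_filter (s : ℕ → Bool) {m t : ℕ} (ht : t < m) {x : ℝ} (h1 : (t : ℝ) / m ≤ x)
    (h2 : x < ((t : ℝ) + 1) / m) :
    ((gridCuts s m).filter (fun c => c ≤ x)).card = turns s 0 t := by
  have hm : (0 : ℝ) < m := by exact_mod_cast (Nat.zero_le t).trans_lt ht
  have hinj : Function.Injective (fun t : ℕ => ((t : ℝ) + 1) / m) := by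
    intro a b hab
    simp only at hab
    field_simp at hab
    have : (a : ℝ) = b := by linarith
    exact_mod_cast this
  rw [gridCuts, Finset.filter_image, Finset.card_image_of_injective _ hinj, turns,
    Finset.filter_filter]
  congr 1
  ext u
  simp only [Finset.mem_filter, Finset.mem_Ico, Nat.zero_le, true_and]
  rw [div_le_iff₀ hm] at h1
  rw [lt_div_iff₀ hm] at h2
  rw [div_le_iff₀ hm]
  constructor
  · rintro ⟨hu, hne, hle⟩
    have : (u : ℝ) + 1 < t + 1 := by linarith
    have : u < t := by
      have : (u : ℝ) < t := by linarith
      exact_mod_cast this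
    exact ⟨this, hne⟩
  · rintro ⟨hu, hne⟩
    refine ⟨hu.trans ht, hne, ?_⟩
    have : ((u + 1 : ℕ) : ℝ) ≤ t := by exact_mod_cast hu
    push_cast at this
    linarith

theorem measurable_card_filter (S : Finset ℝ) :
    Measurable (fun x : ℝ => (S.filter (fun s => s ≤ x)).card) := by
  simp only [Finset.card_filter]
  refine Finset.measurable_sum _ fun s _ => ?_
  exact Measurable.ite measurableSet_Ici measurable_const measurable_const

theorem measurableSet_plusPart (S : Finset ℝ) : MeasurableSet (plusPart S) :=
  measurableSet_Icc.inter (measurable_card_filter S (MeasurableSet.of_discrete (s := {k | Even k})))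

theorem measurableSet_minusPart (S : Finset ℝ) : MeasurableSet (minusPart S) :=
  measurableSet_Icc.inter (measurable_card_filter S (MeasurableSet.of_discrete (s := {k | Odd k})))

/-- The sign of the piece of `x`. -/
noncomputable def pieceSign (S : Finset ℝ) (x : ℝ) : ℝ :=
  (plusPart S).indicator 1 x - (minusPart S).indicator 1 x

theorem measurable_pieceSign (S : Finset ℝ) : Measurable (pieceSign S) :=
  (measurable_one.indicator (measurableSet_plusPart S)).sub
    (measurable_one.indicator (measurableSet_minusPart S))

theorem abs_pieceSign_le (S : Finset ℝ) (x : ℝ) : |pieceSign S x| ≤ 1 := by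
  unfold pieceSign
  by_cases h : x ∈ plusPart S
  · have h' : x ∉ minusPart S := fun h' => (Nat.not_even_iff_odd.2 h'.2) h.2
    simp [h, h']
  · by_cases h' : x ∈ minusPart S <;> simp [h, h']

theorem intervalIntegrable_pieceSign (S : Finset ℝ) (a b : ℝ) :
    IntervalIntegrable (pieceSign S) volume a b :=
  (intervalIntegrable_const (c := (1 : ℝ))).mono_fun
    (measurable_pieceSign S).aestronglyMeasurable
    (Filter.Eventually.of_forall fun x => by simpa using abs_pieceSign_le S x)

theorem abs_integral_pieceSign_le (S : Finset ℝ) (a b : ℝ) :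
    |∫ x in a..b, pieceSign S x| ≤ |b - a| := by
  have := intervalIntegral.norm_integral_le_of_norm_le_const (a := a) (b := b) (C := 1)
    (f := pieceSign S) (fun x _ => by simpa using abs_pieceSign_le S x)
  simpa using this

theorem pieceSign_gridCuts (s : ℕ → Bool) {m t : ℕ} (ht : t < m) {x : ℝ} (h1 : (t : ℝ) / m ≤ x)
    (h2 : x < ((t : ℝ) + 1) / m) :
    pieceSign (gridCuts s m) x = if s t = s 0 then 1 else -1 := by
  have hm : (0 : ℝ) < m := by exact_mod_cast (Nat.zero_le t).trans_lt ht
  have hx : x ∈ Set.Icc (0 : ℝ) 1 := by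
    refine ⟨le_trans (by positivity) h1, h2.le.trans ?_⟩
    rw [div_le_one hm]
    exact_mod_cast ht
  have hc := card_gridCuts_filter s ht h1 h2
  unfold pieceSign
  by_cases h : s t = s 0
  · have e := (even_turns_iff s t).2 h
    have hp : x ∈ plusPart (gridCuts s m) := ⟨hx, by rw [hc]; exact e⟩
    have hq : x ∉ minusPart (gridCuts s m) := by
      rintro ⟨-, h'⟩
      rw [hc] at h'
      exact Nat.not_even_iff_odd.2 h' e
    simp [hp, hq, h]
  · have e : ¬ Even (turns s 0 t) := fun h' => h ((even_turns_iff s t).1 h')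
    have hp : x ∉ plusPart (gridCuts s m) := by
      rintro ⟨-, h'⟩
      rw [hc] at h'
      exact e h'
    have hq : x ∈ minusPart (gridCuts s m) := ⟨hx, by rw [hc]; exact Nat.not_even_iff_odd.1 e⟩
    simp [hp, hq, h]

theorem integral_pieceSign_cell (s : ℕ → Bool) {m t : ℕ} (ht : t < m) :
    ∫ x in ((t : ℝ) / m)..(((t : ℝ) + 1) / m), pieceSign (gridCuts s m) x =
      (if s t = s 0 then 1 else -1) / m := by
  have hm : (0 : ℝ) < m := by exact_mod_cast (Nat.zero_le t).trans_lt ht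
  have hle : (t : ℝ) / m ≤ ((t : ℝ) + 1) / m := by gcongr; linarith
  rw [intervalIntegral.integral_of_le hle, ← integral_Ico_eq_integral_Ioc,
    setIntegral_congr_fun (g := fun _ => if s t = s 0 then (1 : ℝ) else -1) measurableSet_Ico
      (fun x hx => pieceSign_gridCuts s ht hx.1 hx.2)]
  simp only [integral_const, smul_eq_mul, MeasurableSet.univ, measureReal_restrict_apply,
    Set.univ_inter, Real.volume_real_Ico_of_le hle]
  field_simp
  ring_nf

/-- The piece containing the cell `t` is labelled `+` exactly when `s t = s 0`. The integral thus
counts agreements minus disagreements with `s 0`, whence the global sign. -/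
theorem integral_pieceSign_grid (s : ℕ → Bool) {m a b : ℕ} (hab : a ≤ b) (hb : b ≤ m) :
    ∫ x in ((a : ℝ) / m)..((b : ℝ) / m), pieceSign (gridCuts s m) x =
      (if s 0 then 1 else -1) * (2 * ups s a b - (b - a)) / m := by
  induction b, hab using Nat.le_induction with
  | base => simp [ups_self]
  | succ b hab ih =>
    rw [← intervalIntegral.integral_add_adjacent_intervals
      (intervalIntegrable_pieceSign _ _ ((b : ℝ) / m)) (intervalIntegrable_pieceSign _ _ _),
      ih (by omega)]
    push_cast
    rw [integral_pieceSign_cell s (by omega), ups_succ s hab, ← add_div]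
    congr 1
    cases s 0 <;> cases s b <;> simp <;> ring

theorem valuation_real (n : ℕ) (C : SingleBlock n) (i : Fin n) {A : Set ℝ} (hA : MeasurableSet A) :
    (C.valuation i).real A =
      (1 / (C.right i - C.left i)) * volume.real (A ∩ Set.Ioo (C.left i) (C.right i)) := by
  have h : 0 < C.right i - C.left i := sub_pos.2 (C.left_lt_right i)
  have e : (fun x => ENNReal.ofReal (C.density i x)) =
      (Set.Ioo (C.left i) (C.right i)).indicator
        (fun _ => ENNReal.ofReal (1 / (C.right i - C.left i))) := by
    funext x
    by_cases hx : x ∈ Set.Ioo (C.left i) (C.right i)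
    · simp only [SingleBlock.density, Set.indicator_of_mem hx]
    · simp only [SingleBlock.density, Set.indicator_of_notMem hx, ENNReal.ofReal_zero]
  rw [Measure.real, SingleBlock.valuation, e, withDensity_apply _ hA,
    lintegral_indicator_const measurableSet_Ioo, Measure.restrict_apply measurableSet_Ioo,
    ENNReal.toReal_mul, ENNReal.toReal_ofReal (by positivity), Set.inter_comm]
  rfl

theorem valuation_sub (n : ℕ) (C : SingleBlock n) (i : Fin n) (S : Finset ℝ) :
    (C.valuation i).real (plusPart S) - (C.valuation i).real (minusPart S) =
      (1 / (C.right i - C.left i)) * ∫ x in (C.left i)..(C.right i), pieceSign S x := by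
  have h := (C.left_lt_right i).le
  rw [valuation_real n C i (measurableSet_plusPart S),
    valuation_real n C i (measurableSet_minusPart S), ← mul_sub]
  congr 1
  rw [intervalIntegral.integral_of_le h, ← integral_Ioc_eq_integral_Ioo.symm]
  unfold pieceSign
  have hint : ∀ A : Set ℝ, MeasurableSet A → Integrable (fun x => A.indicator (1 : ℝ → ℝ) x)
      (volume.restrict (Set.Ioo (C.left i) (C.right i))) := by
    intro A hA
    have : IsFiniteMeasure (volume.restrict (Set.Ioo (C.left i) (C.right i))) :=
      ⟨by simp⟩
    exact (integrable_const (1 : ℝ)).indicator hA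
  rw [integral_sub (hint _ (measurableSet_plusPart S)) (hint _ (measurableSet_minusPart S)),
    integral_indicator_one (measurableSet_plusPart S),
    integral_indicator_one (measurableSet_minusPart S),
    measureReal_restrict_apply (measurableSet_plusPart S),
    measureReal_restrict_apply (measurableSet_minusPart S)]

/-- A sign sequence with few sign changes that is balanced on the cells of every block gives a
solution if the grid is fine enough. -/
theorem isSolution_gridCuts {n m : ℕ} (C : SingleBlock n) {ε : ℝ} (al be : ℕ → ℕ)
    (s : ℕ → Bool) (hm : 0 < m) (hfine : ∀ i : Fin n, 4 ≤ m * ε * (C.right i - C.left i))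
    (hal : ∀ i : Fin n, (al i : ℝ) ≤ m * C.left i ∧ m * C.left i < al i + 1)
    (hbe : ∀ i : Fin n, (be i : ℝ) ≤ m * C.right i ∧ m * C.right i < be i + 1)
    (hs : turns s 0 m ≤ n) (hbal : ∀ i < n, BalancedAt n al be (be i) s) :
    IsSolution C.valuation ε (gridCuts s m) := by
  have hm' : (0 : ℝ) < m := by exact_mod_cast hm
  refine ⟨?_, (card_gridCuts_le s m).trans hs, fun i => ?_⟩
  · intro c hc
    simp only [gridCuts, Finset.mem_image, Finset.mem_filter, Finset.mem_Ico] at hc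
    obtain ⟨t, ⟨⟨-, ht⟩, -⟩, rfl⟩ := hc
    refine ⟨by positivity, ?_⟩
    rw [div_le_one hm']
    exact_mod_cast ht
  · have hlt := C.left_lt_right i
    have hpos : 0 < C.right i - C.left i := sub_pos.2 hlt
    obtain ⟨ha1, ha2⟩ := hal i
    obtain ⟨hb1, hb2⟩ := hbe i
    have hab : al i ≤ be i := by
      have : (al i : ℝ) < be i + 1 := by nlinarith
      have : al i < be i + 1 := by exact_mod_cast this
      omega
    have hbm : be i ≤ m := by
      have : (be i : ℝ) ≤ m := by nlinarith [C.right_le_one i]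
      exact_mod_cast this
    have hmid : |∫ x in ((al i : ℝ) / m)..((be i : ℝ) / m), pieceSign (gridCuts s m) x| ≤ 2 / m := by
      rw [integral_pieceSign_grid s hab hbm, abs_div, abs_mul, abs_of_pos hm']
      gcongr
      have e1 : |(if s 0 then (1 : ℝ) else -1)| = 1 := by split_ifs <;> simp
      rw [e1, one_mul]
      rcases hab.eq_or_lt with h | h
      · rw [h]; simp [ups_self]
      · have := hbal i i.2 i i.2 rfl h
        have h1 : (2 * ups s (al i) (be i) + al i : ℝ) ≤ be i + 2 := by exact_mod_cast this.1
        have h2 : (be i : ℝ) ≤ 2 * ups s (al i) (be i) + al i + 2 := by exact_mod_cast this.2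
        rw [abs_le]
        constructor <;> linarith
    have hleft : |∫ x in (C.left i)..((al i : ℝ) / m), pieceSign (gridCuts s m) x| ≤ 1 / m := by
      refine (abs_integral_pieceSign_le _ _ _).trans ?_
      rw [abs_le]
      constructor
      · rw [neg_le_sub_iff_le_add, ← add_div, le_div_iff₀ hm']; linarith
      · rw [sub_le_iff_le_add, div_le_iff₀ hm', add_mul, div_mul_cancel₀ _ hm'.ne']; linarith
    have hright : |∫ x in ((be i : ℝ) / m)..(C.right i), pieceSign (gridCuts s m) x| ≤ 1 / m := by
      refine (abs_integral_pieceSign_le _ _ _).trans ?_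
      rw [abs_le]
      constructor
      · rw [neg_le_sub_iff_le_add, div_le_iff₀ hm', add_mul, div_mul_cancel₀ _ hm'.ne']; linarith
      · rw [sub_le_iff_le_add, ← add_div, le_div_iff₀ hm']; linarith
    have hall : |∫ x in (C.left i)..(C.right i), pieceSign (gridCuts s m) x| ≤ 4 / m := by
      rw [← intervalIntegral.integral_add_adjacent_intervals
        (intervalIntegrable_pieceSign _ _ ((al i : ℝ) / m)) (intervalIntegrable_pieceSign _ _ _),
        ← intervalIntegral.integral_add_adjacent_intervals (a := (al i : ℝ) / m)
        (intervalIntegrable_pieceSign _ _ ((be i : ℝ) / m)) (intervalIntegrable_pieceSign _ _ _)]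
      -- Less than one cell is lost or gained at either end, and the interior contributes an
      -- imbalance of at most two cells.
      have e : (4 : ℝ) / m = 1 / m + (2 / m + 1 / m) := by ring
      rw [e]
      exact (abs_add_le _ _).trans (add_le_add hleft ((abs_add_le _ _).trans (add_le_add hmid hright)))
    rw [valuation_sub, abs_mul, abs_of_pos (by positivity), one_div, inv_mul_le_iff₀ hpos]
    refine hall.trans ?_
    rw [div_le_iff₀ hm']
    have := hfine i
    linarith

end ConsensusHalving

namespace ConsensusHalving

/-! ## Reasoning about programs

The integer memory is divided into sixteen interleaved arrays: the entry `i` of the array `j` has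
the address `16 i + j`. The entries of the array `0` serve as scalar variables. -/

namespace Memory

/-- The scalar variable `x`. -/
def v (σ : Memory) (x : ℕ) : ℕ := σ.ints (16 * x)

/-- The entry `i` of the array `j`. -/
def a (σ : Memory) (j i : ℕ) : ℕ := σ.ints (16 * i + j)

/-- Assignment to a scalar variable. -/
def setV (σ : Memory) (x w : ℕ) : Memory := { σ with ints := Function.update σ.ints (16 * x) w }

/-- Assignment to an array entry. -/
def setA (σ : Memory) (j i w : ℕ) : Memory :=
  { σ with ints := Function.update σ.ints (16 * i + j) w }

variable (σ : Memory) (x y w i i' : ℕ) {j j' : ℕ}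

@[simp] theorem setV_v : (σ.setV x w).v y = if y = x then w else σ.v y := by
  simp only [setV, v, Function.update_apply]
  congr 1
  simp

@[simp] theorem setV_reals : (σ.setV x w).reals = σ.reals := rfl

@[simp] theorem setA_reals : (σ.setA j i w).reals = σ.reals := rfl

@[simp] theorem setV_a (h : 0 < j) (h' : j < 16) : (σ.setV x w).a j = σ.a j := by
  funext i
  simp only [setV, a]
  rw [Function.update_of_ne (by omega)]

@[simp] theorem setA_v (h : 0 < j) (h' : j < 16) : (σ.setA j i w).v x = σ.v x := by
  simp only [setA, v]
  rw [Function.update_of_ne (by omega)]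

@[simp] theorem setA_a_same : (σ.setA j i w).a j = Function.update (σ.a j) i w := by
  funext i'
  simp only [setA, a, Function.update_apply]
  congr 1
  simp

@[simp] theorem setA_a_of_ne (h : j < 16) (h' : j' < 16) (hne : j' ≠ j) :
    (σ.setA j i w).a j' = σ.a j' := by
  funext i'
  simp only [setA, a]
  rw [Function.update_of_ne (by omega)]

end Memory

/-- The scalar variable `x` as an expression. -/
def var (x : ℕ) : IntExpr := .cell (.lit (16 * x))

/-- The double of an expression. -/
def dbl (e : IntExpr) : IntExpr := .add e e

/-- The address of the entry `e` of the array `j`. -/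
def addr (j : ℕ) (e : IntExpr) : IntExpr := .add (dbl (dbl (dbl (dbl e)))) (.lit j)

/-- The entry `e` of the array `j` as an expression. -/
def arr (j : ℕ) (e : IntExpr) : IntExpr := .cell (addr j e)

/-- Assignment to a scalar variable. -/
def setVar (x : ℕ) (e : IntExpr) : Program := .setInt (.lit (16 * x)) e

/-- Assignment to an array entry. -/
def setArr (j : ℕ) (e f : IntExpr) : Program := .setInt (addr j e) f

section Eval

variable (σ : Memory) (x j k : ℕ) (e f : IntExpr)

@[simp] theorem eval_lit : (IntExpr.lit k).eval σ = k := rfl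
@[simp] theorem eval_add : (IntExpr.add e f).eval σ = e.eval σ + f.eval σ := rfl
@[simp] theorem eval_sub : (IntExpr.sub e f).eval σ = e.eval σ - f.eval σ := rfl
@[simp] theorem eval_var : (var x).eval σ = σ.v x := rfl
@[simp] theorem eval_dbl : (dbl e).eval σ = 2 * e.eval σ := by simp [dbl]; ring
@[simp] theorem eval_addr : (addr j e).eval σ = 16 * e.eval σ + j := by simp [addr]; ring
@[simp] theorem eval_arr : (arr j e).eval σ = σ.a j (e.eval σ) := by
  rw [arr, IntExpr.eval, eval_addr]; rfl

@[simp] theorem cost_lit : (IntExpr.lit k).cost = 1 := rfl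
@[simp] theorem cost_add : (IntExpr.add e f).cost = e.cost + f.cost + 1 := rfl
@[simp] theorem cost_sub : (IntExpr.sub e f).cost = e.cost + f.cost + 1 := rfl
@[simp] theorem cost_var : (var x).cost = 2 := rfl
@[simp] theorem cost_dbl : (dbl e).cost = 2 * e.cost + 1 := by simp [dbl]; ring
-- The machine cannot multiply integers; four nested doublings evaluate the index sixteen times,
-- which is still a constant for the fixed expressions of the program.
@[simp] theorem cost_addr : (addr j e).cost = 16 * e.cost + 17 := by simp [addr]; ring
@[simp] theorem cost_arr : (arr j e).cost = 16 * e.cost + 18 := by simp [arr, IntExpr.cost]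

variable (b c : Test) (q r : RealExpr)

@[simp] theorem holds_ltInt : (Test.ltInt e f).Holds σ ↔ e.eval σ < f.eval σ := Iff.rfl
@[simp] theorem holds_ltReal : (Test.ltReal q r).Holds σ ↔ q.eval σ < r.eval σ := Iff.rfl
@[simp] theorem holds_neg : (Test.neg b).Holds σ ↔ ¬ b.Holds σ := Iff.rfl
@[simp] theorem holds_conj : (Test.conj b c).Holds σ ↔ b.Holds σ ∧ c.Holds σ := Iff.rfl
@[simp] theorem testCost_ltInt : (Test.ltInt e f).cost = e.cost + f.cost + 1 := rfl
@[simp] theorem testCost_ltReal : (Test.ltReal q r).cost = q.cost + r.cost + 1 := rfl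
@[simp] theorem testCost_neg : (Test.neg b).cost = b.cost + 1 := rfl
@[simp] theorem testCost_conj : (Test.conj b c).cost = b.cost + c.cost + 1 := rfl

@[simp] theorem realEval_ofInt : (RealExpr.ofInt e).eval σ = (e.eval σ : ℝ) := rfl
@[simp] theorem realEval_cell : (RealExpr.cell e).eval σ = σ.reals (e.eval σ) := rfl
@[simp] theorem realEval_sub : (RealExpr.sub q r).eval σ = q.eval σ - r.eval σ := rfl
@[simp] theorem realEval_mul : (RealExpr.mul q r).eval σ = q.eval σ * r.eval σ := rfl
@[simp] theorem realEval_div : (RealExpr.div q r).eval σ = q.eval σ / r.eval σ := rfl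
@[simp] theorem realCost_ofInt : (RealExpr.ofInt e).cost = e.cost + 1 := rfl
@[simp] theorem realCost_cell : (RealExpr.cell e).cost = e.cost + 1 := rfl
@[simp] theorem realCost_sub : (RealExpr.sub q r).cost = q.cost + r.cost + 1 := rfl
@[simp] theorem realCost_mul : (RealExpr.mul q r).cost = q.cost + r.cost + 1 := rfl
@[simp] theorem realCost_div : (RealExpr.div q r).cost = q.cost + r.cost + 1 := rfl

end Eval

/-- The integer cell `c` is not written by the program. -/
def Avoids (c : ℕ) : Program → Prop
  | .nop => True
  | .setInt a _ => ∀ σ, a.eval σ ≠ c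
  | .setReal _ _ => True
  | .seq p q => Avoids c p ∧ Avoids c q
  | .branch _ p q => Avoids c p ∧ Avoids c q
  | .loop _ p => Avoids c p

/-- The real memory is not written by the program. -/
def AvoidsReals : Program → Prop
  | .nop => True
  | .setInt _ _ => True
  | .setReal _ _ => False
  | .seq p q => AvoidsReals p ∧ AvoidsReals q
  | .branch _ p q => AvoidsReals p ∧ AvoidsReals q
  | .loop _ p => AvoidsReals p

/-- The variable `x` is not written by the program. -/
def AvoidsVar (x : ℕ) (p : Program) : Prop := Avoids (16 * x) p

/-- The array `j` is not written by the program. -/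
def AvoidsArr (j : ℕ) (p : Program) : Prop := ∀ i, Avoids (16 * i + j) p

section Avoids

variable {x y j j' : ℕ} {a e f : IntExpr} {p q : Program} {b : Test} {r : RealExpr}

@[simp] theorem avoidsVar_nop : AvoidsVar x .nop := trivial
@[simp] theorem avoidsVar_setReal : AvoidsVar x (.setReal a r) := trivial
@[simp] theorem avoidsVar_seq : AvoidsVar x (.seq p q) ↔ AvoidsVar x p ∧ AvoidsVar x q := Iff.rfl
@[simp] theorem avoidsVar_branch :
    AvoidsVar x (.branch b p q) ↔ AvoidsVar x p ∧ AvoidsVar x q := Iff.rfl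
@[simp] theorem avoidsVar_loop : AvoidsVar x (.loop b p) ↔ AvoidsVar x p := Iff.rfl
@[simp] theorem avoidsVar_setVar : AvoidsVar x (setVar y e) ↔ x ≠ y := by
  constructor
  · rintro h rfl
    exact h ⟨fun _ => 0, fun _ => 0⟩ rfl
  · intro h σ
    simp only [eval_lit]
    omega
@[simp] theorem avoidsVar_setArr (h : 0 < j) (h' : j < 16) : AvoidsVar x (setArr j e f) := by
  intro σ
  simp only [eval_addr]
  omega

@[simp] theorem avoidsArr_nop : AvoidsArr j .nop := fun _ => trivial
@[simp] theorem avoidsArr_setReal : AvoidsArr j (.setReal a r) := fun _ => trivial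
@[simp] theorem avoidsArr_seq : AvoidsArr j (.seq p q) ↔ AvoidsArr j p ∧ AvoidsArr j q :=
  forall_and
@[simp] theorem avoidsArr_branch :
    AvoidsArr j (.branch b p q) ↔ AvoidsArr j p ∧ AvoidsArr j q := forall_and
@[simp] theorem avoidsArr_loop : AvoidsArr j (.loop b p) ↔ AvoidsArr j p := Iff.rfl
@[simp] theorem avoidsArr_setVar (h : 0 < j) (h' : j < 16) : AvoidsArr j (setVar y e) := by
  intro i σ
  simp only [eval_lit]
  omega
@[simp] theorem avoidsArr_setArr (h : j < 16) (h' : j' < 16) (hne : j ≠ j') :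
    AvoidsArr j (setArr j' e f) := by
  intro i σ
  simp only [eval_addr]
  omega

@[simp] theorem avoidsReals_nop : AvoidsReals .nop := trivial
@[simp] theorem avoidsReals_setVar : AvoidsReals (setVar x e) := trivial
@[simp] theorem avoidsReals_setArr : AvoidsReals (setArr j e f) := trivial
@[simp] theorem avoidsReals_seq : AvoidsReals (.seq p q) ↔ AvoidsReals p ∧ AvoidsReals q := Iff.rfl
@[simp] theorem avoidsReals_branch :
    AvoidsReals (.branch b p q) ↔ AvoidsReals p ∧ AvoidsReals q := Iff.rfl
@[simp] theorem avoidsReals_loop : AvoidsReals (.loop b p) ↔ AvoidsReals p := Iff.rfl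

end Avoids

theorem Exec.ints_eq {p : Program} {σ σ' : Memory} {t c : ℕ} (h : Exec p σ σ' t)
    (hc : Avoids c p) : σ'.ints c = σ.ints c := by
  induction h with
  | nop => rfl
  | setInt a v σ => exact Function.update_of_ne (hc σ).symm _ _
  | setReal => rfl
  | seq _ _ ih ih' => rw [ih' hc.2, ih hc.1]
  | branch_pos _ _ ih => exact ih hc.1
  | branch_neg _ _ ih => exact ih hc.2
  | loop_stop => rfl
  | loop_step _ _ _ ih ih' => rw [ih' hc, ih hc]

theorem Exec.reals_eq {p : Program} {σ σ' : Memory} {t : ℕ} (h : Exec p σ σ' t)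
    (hc : AvoidsReals p) : σ'.reals = σ.reals := by
  induction h with
  | nop => rfl
  | setInt a v σ => rfl
  | setReal => exact hc.elim
  | seq _ _ ih ih' => rw [ih' hc.2, ih hc.1]
  | branch_pos _ _ ih => exact ih hc.1
  | branch_neg _ _ ih => exact ih hc.2
  | loop_stop => rfl
  | loop_step _ _ _ ih ih' => rw [ih' hc, ih hc]

/-- The memories agree on everything that `p` does not write. -/
structure Framed (p : Program) (σ σ' : Memory) : Prop where
  v : ∀ x, AvoidsVar x p → σ'.v x = σ.v x
  a : ∀ j, AvoidsArr j p → σ'.a j = σ.a j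
  reals : AvoidsReals p → σ'.reals = σ.reals

theorem Exec.framed {p : Program} {σ σ' : Memory} {t : ℕ} (h : Exec p σ σ' t) : Framed p σ σ' where
  v _ hx := h.ints_eq hx
  a _ hj := funext fun i => h.ints_eq (hj i)
  reals hr := h.reals_eq hr

theorem Framed.refl (p : Program) (σ : Memory) : Framed p σ σ :=
  ⟨fun _ _ => rfl, fun _ _ => rfl, fun _ => rfl⟩

theorem Framed.trans {p : Program} {σ σ₁ σ₂ : Memory} (h : Framed p σ σ₁) (h' : Framed p σ₁ σ₂) :
    Framed p σ σ₂ where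
  v x hx := (h'.v x hx).trans (h.v x hx)
  a j hj := (h'.a j hj).trans (h.a j hj)
  reals hr := (h'.reals hr).trans (h.reals hr)

/-- Started with memory `σ`, the program `p` halts with a final memory and a number of steps that
satisfy `Q`. -/
def Runs (p : Program) (σ : Memory) (Q : Memory → ℕ → Prop) : Prop :=
  ∃ σ' t, Exec p σ σ' t ∧ Q σ' t

namespace Runs

variable {p q : Program} {σ : Memory} {Q R : Memory → ℕ → Prop} {b : Test}

theorem mono (h : Runs p σ R) (h' : ∀ σ' t, Framed p σ σ' → R σ' t → Q σ' t) : Runs p σ Q := by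
  obtain ⟨σ', t, he, hr⟩ := h
  exact ⟨σ', t, he, h' σ' t he.framed hr⟩

/-- A family of specifications holds simultaneously, as the execution is deterministic. -/
theorem forall_of {ι : Sort*} [Nonempty ι] {S : ι → Memory → ℕ → Prop} (h : ∀ i, Runs p σ (S i)) :
    Runs p σ (fun σ' t => ∀ i, S i σ' t) := by
  obtain ⟨i₀⟩ := ‹Nonempty ι›
  obtain ⟨σ', t, he, -⟩ := h i₀
  refine ⟨σ', t, he, fun i => ?_⟩
  obtain ⟨σ'', t', he', hs⟩ := h i
  obtain ⟨rfl, rfl⟩ := he.unique he'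
  exact hs

theorem nop (h : Q σ 1) : Runs .nop σ Q := ⟨_, _, Exec.nop σ, h⟩

theorem setVar {x : ℕ} {e : IntExpr} (h : Q (σ.setV x (e.eval σ)) (e.cost + 2)) :
    Runs (setVar x e) σ Q := by
  refine ⟨_, _, Exec.setInt _ _ σ, ?_⟩
  rw [show (IntExpr.lit (16 * x)).cost + e.cost + 1 = e.cost + 2 by simp; ring]
  exact h

theorem setArr {j : ℕ} {e f : IntExpr}
    (h : Q (σ.setA j (e.eval σ) (f.eval σ)) (16 * e.cost + f.cost + 18)) :
    Runs (setArr j e f) σ Q := by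
  refine ⟨_, _, Exec.setInt _ _ σ, ?_⟩
  rw [show (addr j e).cost + f.cost + 1 = 16 * e.cost + f.cost + 18 by simp; ring, eval_addr]
  exact h

theorem setReal {a : IntExpr} {r : RealExpr}
    (h : Q { σ with reals := Function.update σ.reals (a.eval σ) (r.eval σ) } (a.cost + r.cost + 1)) :
    Runs (.setReal a r) σ Q := ⟨_, _, Exec.setReal _ _ σ, h⟩

theorem seq (h : Runs p σ (fun σ₁ t₁ => Runs q σ₁ (fun σ₂ t₂ => Q σ₂ (t₁ + t₂)))) :
    Runs (.seq p q) σ Q := by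
  obtain ⟨σ₁, t₁, he₁, σ₂, t₂, he₂, hq⟩ := h
  exact ⟨σ₂, _, he₁.seq he₂, hq⟩

theorem branch (h : b.Holds σ → Runs p σ (fun σ' t => Q σ' (b.cost + t + 1)))
    (h' : ¬ b.Holds σ → Runs q σ (fun σ' t => Q σ' (b.cost + t + 1))) :
    Runs (.branch b p q) σ Q := by
  by_cases hb : b.Holds σ
  · obtain ⟨σ', t, he, hq⟩ := h hb
    exact ⟨_, _, Exec.branch_pos hb he, hq⟩
  · obtain ⟨σ', t, he, hq⟩ := h' hb
    exact ⟨_, _, Exec.branch_neg hb he, hq⟩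

/-- A loop with an invariant and a variant. -/
theorem while_ (Inv : Memory → ℕ → Prop) (var : Memory → ℕ) (h0 : Inv σ 0)
    (hstep : ∀ σ' t, Framed p σ σ' → Inv σ' t → b.Holds σ' →
      Runs p σ' (fun σ'' t' => Inv σ'' (t + (b.cost + t' + 1)) ∧ var σ'' < var σ'))
    (hend : ∀ σ' t, Framed p σ σ' → Inv σ' t → ¬ b.Holds σ' → Q σ' (t + (b.cost + 1))) :
    Runs (.loop b p) σ Q := by
  suffices H : ∀ k σ' t, var σ' = k → Framed p σ σ' → Inv σ' t →
      Runs (.loop b p) σ' (fun σ'' t' => Q σ'' (t + t')) by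
    have := H _ σ 0 rfl (Framed.refl p σ) h0
    simpa using this
  intro k
  induction k using Nat.strong_induction_on with
  | _ k ih =>
    intro σ' t hk hf hi
    by_cases hb : b.Holds σ'
    · obtain ⟨σ₁, t₁, he₁, hi₁, hlt⟩ := hstep σ' t hf hi hb
      obtain ⟨σ₂, t₂, he₂, hq⟩ := ih _ (hk ▸ hlt) σ₁ _ rfl (hf.trans he₁.framed) hi₁
      refine ⟨σ₂, _, Exec.loop_step hb he₁ he₂, ?_⟩
      have e : t + (b.cost + t₁ + t₂ + 1) = t + (b.cost + t₁ + 1) + t₂ := by ring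
      simpa only [e] using hq
    · exact ⟨σ', _, Exec.loop_stop hb, hend σ' t hf hi hb⟩

/-- A loop with `K` iterations. -/
theorem for_ (K : ℕ) (Inv : ℕ → Memory → ℕ → Prop) (h0 : Inv 0 σ 0)
    (hstep : ∀ i < K, ∀ σ' t, Framed p σ σ' → Inv i σ' t →
      b.Holds σ' ∧ Runs p σ' (fun σ'' t' => Inv (i + 1) σ'' (t + (b.cost + t' + 1))))
    (hend : ∀ σ' t, Framed p σ σ' → Inv K σ' t → ¬ b.Holds σ' ∧ Q σ' (t + (b.cost + 1))) :
    Runs (.loop b p) σ Q := by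
  suffices H : ∀ k ≤ K, ∀ σ' t, Framed p σ σ' → Inv (K - k) σ' t →
      Runs (.loop b p) σ' (fun σ'' t' => Q σ'' (t + t')) by
    have := H K le_rfl σ 0 (Framed.refl p σ) (by simpa using h0)
    simpa using this
  intro k
  induction k with
  | zero =>
    intro _ σ' t hf hi
    obtain ⟨hb, hq⟩ := hend σ' t hf hi
    exact ⟨σ', _, Exec.loop_stop hb, hq⟩
  | succ k ih =>
    intro hk σ' t hf hi
    obtain ⟨hb, σ₁, t₁, he₁, hi₁⟩ := hstep (K - (k + 1)) (by omega) σ' t hf hi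
    rw [show K - (k + 1) + 1 = K - k by omega] at hi₁
    obtain ⟨σ₂, t₂, he₂, hq⟩ := ih (by omega) σ₁ _ (hf.trans he₁.framed) hi₁
    refine ⟨σ₂, _, Exec.loop_step hb he₁ he₂, ?_⟩
    have e : t + (b.cost + t₁ + t₂ + 1) = t + (b.cost + t₁ + 1) + t₂ := by ring
    simpa only [e] using hq

end Runs

end ConsensusHalving

namespace ConsensusHalving

/-! ## The program -/

/-- Fills the array `j` with the code counts of the layer in variable `21`. -/
def weightsProg (j : ℕ) : Program :=
  -- Variables: `0` is `n`, `1` is `m`, `2` an agent, `3` scratch, `4` the layer `k`, `5` a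
  -- position, `6` a code, `7` the value at `k`, `8` to `11` serve decoding and recoding, `12` and
  -- `13` hold the weight pair, `14` the number of codes of layer `k`, `15` and `16` the offsets of
  -- layers `k + 1` and `k`, `17` signals a violated interval, `18` and `19` are table indices, `20`
  -- counts cuts, `21` is the layer whose weights are computed. Arrays: `1`, `2` the ends of the
  -- intervals, `3` the reach, `4`, `5` the code counts of layers `k` and `k + 1`, `6` the counts of
  -- `true` values, `7` the table of values, `8` the chosen successors.
  .seq (setVar 12 (.lit 1)) <| .seq (setVar 13 (.lit 0)) <| .seq (setVar 5 (.lit 0)) <|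
  .seq (.loop (.ltInt (var 5) (var 21)) <|
    .seq (.branch (.ltInt (var 21) (arr 3 (var 5))) (setVar 13 (var 12)) .nop) <|
    .seq (setArr j (var 5) (var 12)) <|
    .seq (setVar 12 (.add (var 12) (var 13))) (setVar 5 (.add (var 5) (.lit 1)))) <|
  setArr j (var 5) (var 12)

theorem weightsProg_runs {j : ℕ} (hj : 3 < j) (hj' : j < 16) (σ : Memory) :
    Runs (weightsProg j) σ (fun σ' t => (∀ p ≤ σ.v 21, σ'.a j p = codeCount (σ.a 3) (σ.v 21) p) ∧
      σ'.v 12 = codeCount (σ.a 3) (σ.v 21) (σ.v 21) ∧ t ≤ 200 * (σ.v 21 + 1)) := by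
  have hj0 : 0 < j := by omega
  refine Runs.seq (Runs.setVar ?_)
  refine Runs.seq (Runs.setVar ?_)
  refine Runs.seq (Runs.setVar ?_)
  simp only [eval_lit, cost_lit]
  refine Runs.seq (Runs.for_ (σ.v 21) (fun i σ' t => σ'.v 5 = i ∧
    (σ'.v 12, σ'.v 13) = weightPair (σ.a 3) (σ.v 21) i ∧
    (∀ p < i, σ'.a j p = codeCount (σ.a 3) (σ.v 21) p) ∧ t ≤ 150 * i) ?_ ?_ ?_)
  · simp [weightPair]
  · rintro i hi τ t hf ⟨h5, hw, hp, ht⟩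
    have h21 : τ.v 21 = σ.v 21 := by rw [hf.v 21 (by simp [hj0, hj'])]; simp
    have h3 : τ.a 3 = σ.a 3 := by
      rw [hf.a 3 (by simp [hj', show 3 ≠ j by omega])]; simp
    rw [Prod.ext_iff] at hw
    simp only at hw
    refine ⟨by simp [h5, h21, hi], Runs.seq (Runs.branch ?_ ?_)⟩
    · intro hb
      simp only [holds_ltInt, eval_var, eval_arr, h5, h3, h21] at hb
      refine Runs.setVar ?_
      refine Runs.seq (Runs.setArr ?_)
      refine Runs.seq (Runs.setVar ?_)
      refine Runs.setVar ?_
      simp [hj0, hj', h5, weightPair, hb, hw.1, codeCount] 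
      refine ⟨?_, by omega⟩
      intro p hp'
      rw [Function.update_apply]
      split_ifs with hpi
      · rw [hpi]
      · exact hp p (by omega)
    · intro hb
      simp only [holds_ltInt, eval_var, eval_arr, h5, h3, h21] at hb
      refine Runs.nop ?_
      refine Runs.seq (Runs.setArr ?_)
      refine Runs.seq (Runs.setVar ?_)
      refine Runs.setVar ?_
      simp [hj0, hj', h5, weightPair, hb, hw.1, hw.2, codeCount]
      refine ⟨?_, by omega⟩
      intro p hp'
      rw [Function.update_apply]
      split_ifs with hpi
      · rw [hpi]
      · exact hp p (by omega)
  · rintro τ t hf ⟨h5, hw, hp, ht⟩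
    have h21 : τ.v 21 = σ.v 21 := by rw [hf.v 21 (by simp [hj0, hj'])]; simp
    rw [Prod.ext_iff] at hw
    simp only at hw
    refine ⟨by simp [h5, h21], Runs.setArr ?_⟩
    simp [hj0, hj', h5, hw.1, codeCount]
    refine ⟨?_, by omega⟩
    intro p hp'
    rw [Function.update_apply]
    split_ifs with hpi
    · rw [hpi]
    · exact hp p (by omega)

end ConsensusHalving

/-! ### Decoding a state and encoding its successor. -/

namespace ConsensusHalving

/-- Splits off the digit of the position `5` from the code in variable `8`. -/
def digitProg : Program :=
  .loop (.neg (.ltInt (var 8) (arr 4 (var 5)))) <|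
    .seq (setVar 8 (.sub (var 8) (arr 4 (var 5)))) (setVar 9 (.add (var 9) (.lit 1)))

/-- Adds the digit of the position `5` to the code in variable `11`. -/
def recodeProg : Program :=
  .loop (.ltInt (var 10) (.add (var 9) (var 7))) <|
    .seq (setVar 10 (.add (var 10) (.lit 1))) (setVar 11 (.add (var 11) (arr 5 (var 5))))

/-- Computes the code in layer `k + 1` from the code `6` in layer `k` and the new value `7`. -/
def transitionProg : Program :=
  .seq (setVar 8 (var 6)) <| .seq (setVar 9 (.lit 0)) <| .seq (setVar 10 (.lit 0)) <|
  .seq (setVar 11 (.lit 0)) <| .seq (setVar 5 (.add (var 4) (.lit 1))) <|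
  .loop (.ltInt (.lit 0) (var 5)) <|
    .seq (setVar 5 (.sub (var 5) (.lit 1))) <|
    .seq (.branch (.ltInt (var 4) (arr 3 (var 5))) digitProg .nop) <|
    .seq (setArr 6 (var 5) (.add (var 9) (var 7))) <|
    .branch (.ltInt (.add (var 4) (.lit 1)) (arr 3 (var 5))) recodeProg .nop

/-- Division with remainder by repeated subtraction. Its cost is proportional to the digit, which is
a number of `true` values, so that the total over all digits stays linear in `k`. -/
theorem digitProg_runs (σ : Memory) {d r : ℕ} (h8 : σ.v 8 = r + d * σ.a 4 (σ.v 5))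
    (hr : r < σ.a 4 (σ.v 5)) :
    Runs digitProg σ (fun σ' t => σ'.v 8 = r ∧ σ'.v 9 = σ.v 9 + d ∧ t ≤ 300 * d + 300) := by
  refine Runs.for_ d (fun i τ t => τ.v 8 + i * σ.a 4 (σ.v 5) = r + d * σ.a 4 (σ.v 5) ∧
    τ.v 9 = σ.v 9 + i ∧ t ≤ 300 * i) ?_ ?_ ?_
  · simp [h8]
  · rintro i hi τ t hf ⟨h1, h2, ht⟩
    have e5 : τ.v 5 = σ.v 5 := hf.v 5 (by simp)
    have e4 : τ.a 4 = σ.a 4 := hf.a 4 (by simp)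
    set w := σ.a 4 (σ.v 5)
    have hle : (i + 1) * w ≤ d * w := Nat.mul_le_mul_right w hi
    have e : (i + 1) * w = i * w + w := by ring
    refine ⟨by simp [e5, e4]; omega, ?_⟩
    refine Runs.seq (Runs.setVar (Runs.setVar ?_))
    simp [e5, e4, h2]
    omega
  · rintro τ t hf ⟨h1, h2, ht⟩
    have e5 : τ.v 5 = σ.v 5 := hf.v 5 (by simp)
    have e4 : τ.a 4 = σ.a 4 := hf.a 4 (by simp)
    have e8 : τ.v 8 = r := by omega
    refine ⟨by simp [e5, e4, e8, hr], e8, h2, ?_⟩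
    simp
    omega

theorem recodeProg_runs (σ : Memory) {d : ℕ} (h : σ.v 10 + d = σ.v 9 + σ.v 7) :
    Runs recodeProg σ (fun σ' t => σ'.v 10 = σ.v 9 + σ.v 7 ∧
      σ'.v 11 = σ.v 11 + d * σ.a 5 (σ.v 5) ∧ t ≤ 300 * d + 300) := by
  refine Runs.for_ d (fun i τ t => τ.v 10 = σ.v 10 + i ∧
    τ.v 11 = σ.v 11 + i * σ.a 5 (σ.v 5) ∧ t ≤ 300 * i) ?_ ?_ ?_
  · simp
  · rintro i hi τ t hf ⟨h1, h2, ht⟩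
    have e5 : τ.v 5 = σ.v 5 := hf.v 5 (by simp)
    have e9 : τ.v 9 = σ.v 9 := hf.v 9 (by simp)
    have e7 : τ.v 7 = σ.v 7 := hf.v 7 (by simp)
    have e4 : τ.a 5 = σ.a 5 := hf.a 5 (by simp)
    refine ⟨by simp [e9, e7, h1]; omega, ?_⟩
    refine Runs.seq (Runs.setVar (Runs.setVar ?_))
    simp [e5, e4, h1, h2]
    constructor
    · ring
    constructor
    · ring
    · omega
  · rintro τ t hf ⟨h1, h2, ht⟩
    have e9 : τ.v 9 = σ.v 9 := hf.v 9 (by simp)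
    have e7 : τ.v 7 = σ.v 7 := hf.v 7 (by simp)
    refine ⟨by simp [e9, e7, h1]; omega, by omega, h2, ?_⟩
    simp
    omega

/-- Running through the positions downwards, the digits of the old code give the counts `ups s p k`
at the live positions one after the other. Adding the new value yields the counts for the interval
checks, and their increments between positions live in layer `k + 1` are the digits of the new code.
-/
theorem transitionProg_runs (σ : Memory) (s : ℕ → Bool) {k : ℕ} (h4 : σ.v 4 = k)
    (h6 : σ.v 6 = code (σ.a 3) k s k) (h7 : σ.v 7 = (s k).toNat)
    (hP : ∀ p ≤ k, σ.a 4 p = codeCount (σ.a 3) k p)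
    (hP' : ∀ p ≤ k + 1, σ.a 5 p = codeCount (σ.a 3) (k + 1) p) :
    Runs transitionProg σ (fun σ' t => σ'.v 11 = code (σ.a 3) (k + 1) s (k + 1) ∧
      (∀ p ≤ k, k < σ.a 3 p → σ'.a 6 p = ups s p (k + 1)) ∧ t ≤ 3000 * (k + 1)) := by
  set reach := σ.a 3 with hreach
  refine Runs.seq (Runs.setVar (Runs.seq (Runs.setVar (Runs.seq (Runs.setVar
    (Runs.seq (Runs.setVar (Runs.seq (Runs.setVar ?_)))))))))
  simp only [eval_lit, eval_add, eval_var, cost_lit, cost_add, cost_var]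
  -- Here `l` and `l'` are the positions up to which the old code has been split and from which the
  -- new code has been assembled; no position in between is live in the respective layer. The term
  -- with variables `9` and `10` in the time bound is the amortisation: the inner loops only ever
  -- increase these two counts, which end up at most `k` and `k + 1`.
  refine Runs.for_ (k + 1) (fun i τ t => ∃ q, q + i = k + 1 ∧ τ.v 5 = q ∧
    (∃ l ≤ k, (q ≤ l ∨ i = 0 ∧ l = k) ∧ (∀ t, q ≤ t → t < l → ¬ k < reach t) ∧
      τ.v 8 = code reach k s l ∧ τ.v 9 = ups s l k) ∧
    (∃ l ≤ k + 1, q ≤ l ∧ (∀ t, q ≤ t → t < l → ¬ k + 1 < reach t) ∧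
      τ.v 10 = ups s l (k + 1) ∧ τ.v 11 + code reach (k + 1) s l = code reach (k + 1) s (k + 1)) ∧
    (∀ p, q ≤ p → p ≤ k → k < reach p → τ.a 6 p = ups s p (k + 1)) ∧
    t ≤ 1000 * i + 300 * (τ.v 9 + τ.v 10)) ?_ ?_ ?_
  · refine ⟨k + 1, rfl, by simp [h4], ⟨k, le_rfl, Or.inr ⟨rfl, rfl⟩, ?_, ?_, ?_⟩,
      ⟨k + 1, le_rfl, le_rfl, ?_, ?_, ?_⟩, ?_, ?_⟩
    · intro t h1 h2; omega
    · simp [h6]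
    · simp [ups_self]
    · intro t h1 h2; omega
    · simp [ups_self]
    · simp
    · intro p h1 h2; omega
    · omega
  · rintro i hi τ t hf ⟨q, hqi, h5, ⟨l, hlk, hql, hgap, h8, h9⟩, ⟨l', hl'k, hql', hgap', h10, h11⟩,
      hU, ht⟩
    obtain ⟨p, rfl⟩ : ∃ p, q = p + 1 := ⟨q - 1, by omega⟩
    have e4 : τ.v 4 = k := by rw [hf.v 4 (by simp [digitProg, recodeProg])]; simp [h4]
    have e7 : τ.v 7 = (s k).toNat := by rw [hf.v 7 (by simp [digitProg, recodeProg])]; simp [h7]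
    have a3 : τ.a 3 = reach := by rw [hf.a 3 (by simp [digitProg, recodeProg])]; simp [hreach]
    have a4 : τ.a 4 = σ.a 4 := by rw [hf.a 4 (by simp [digitProg, recodeProg])]; simp
    have a5 : τ.a 5 = σ.a 5 := by rw [hf.a 5 (by simp [digitProg, recodeProg])]; simp
    have hpk : p ≤ k := by omega
    refine ⟨by simp [h5], Runs.seq (Runs.setVar ?_)⟩
    simp only [eval_sub, eval_var, eval_lit, h5, Nat.add_sub_cancel]
    -- the state after the digit of `p` has been split off
    refine Runs.seq (Runs.mono (R := fun τ' t' => τ'.v 5 = p ∧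
      (∃ l₁ ≤ k, p ≤ l₁ ∧ (∀ t, p ≤ t → t < l₁ → ¬ k < reach t) ∧
        τ'.v 8 = code reach k s l₁ ∧ τ'.v 9 = ups s l₁ k ∧ (k < reach p → l₁ = p)) ∧
      τ.v 9 ≤ τ'.v 9 ∧ t' ≤ 400 + 300 * (τ'.v 9 - τ.v 9)) ?_ ?_)
    · refine Runs.branch ?_ ?_
      · intro hb
        simp [e4, a3] at hb
        -- The position `k` itself may be live, but the old code only covers the values before `k`,
        -- so its digit is zero.
        rcases hpk.eq_or_lt with hpe | hlt
        · have hl : l = k := by omega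
          refine Runs.mono (digitProg_runs _ (d := 0) (r := code reach k s k) ?_ ?_) ?_
          · simp [h8, hl]
          · simp [a4, hpe, hP k le_rfl]
            exact code_lt _ _
          · rintro τ' t' hf' ⟨h1, h2, h3⟩
            have e5 := hf'.v 5 (by simp [digitProg])
            simp at e5 h2
            refine ⟨e5, ⟨k, le_rfl, hpk, ?_, h1, ?_, fun _ => hpe.symm⟩, by omega, ?_⟩
            · intro t h1 h2; omega
            · rw [h2, h9, hl]
            · simp; omega
        · have hpl : p < l := by omega
          refine Runs.mono (digitProg_runs _ (d := ups s p l) (r := code reach k s p) ?_ ?_) ?_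
          · simp [h8, a4, hP p hpk]
            rw [code_eq_of_gap s hpl hb (fun t h1 h2 => hgap t (by omega) h2)]
          · simp [a4, hP p hpk]
            exact code_lt _ _
          · rintro τ' t' hf' ⟨h1, h2, h3⟩
            have e5 := hf'.v 5 (by simp [digitProg])
            simp at e5 h2
            have hadd := ups_add s hpl.le hlk
            refine ⟨e5, ⟨p, hpk, le_rfl, ?_, h1, ?_, fun _ => rfl⟩, by omega, ?_⟩
            · intro t h1 h2; omega
            · rw [h2, h9]; omega
            · simp; omega
      · intro hb
        simp [e4, a3] at hb
        refine Runs.nop ?_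
        refine ⟨by simp, ⟨l, hlk, by omega, ?_, by simp [h8], by simp [h9], fun h => by omega⟩,
          by simp, by simp⟩
        intro t h1 h2
        rcases h1.eq_or_lt with rfl | h1
        · omega
        · exact hgap t h1 h2
    rintro τ₁ t₁ hf₁ ⟨e5, ⟨l₁, hl₁k, hpl₁, hgap₁, h8₁, h9₁, hlive⟩, hmono, ht₁⟩
    have e4₁ : τ₁.v 4 = k := by rw [hf₁.v 4 (by simp [digitProg])]; simp [e4]
    have e7₁ : τ₁.v 7 = (s k).toNat := by rw [hf₁.v 7 (by simp [digitProg])]; simp [e7]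
    have e10₁ : τ₁.v 10 = ups s l' (k + 1) := by
      rw [hf₁.v 10 (by simp [digitProg])]; simp [h10]
    have e11₁ : τ₁.v 11 = τ.v 11 := by rw [hf₁.v 11 (by simp [digitProg])]; simp
    have a3₁ : τ₁.a 3 = reach := by rw [hf₁.a 3 (by simp [digitProg])]; simp [a3]
    have a5₁ : τ₁.a 5 = σ.a 5 := by rw [hf₁.a 5 (by simp [digitProg])]; simp [a5]
    have a6₁ : τ₁.a 6 = τ.a 6 := by rw [hf₁.a 6 (by simp [digitProg])]; simp
    refine Runs.seq (Runs.setArr ?_)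
    simp only [eval_add, eval_var, e5, e7₁]
    have hval : k < reach p → τ₁.v 9 + (s k).toNat = ups s p (k + 1) := by
      intro h
      rw [h9₁, hlive h, ups_succ s hpk]
    have hU' : ∀ p', p ≤ p' → p' ≤ k → k < reach p' →
        Function.update (τ.a 6) p (τ₁.v 9 + (s k).toNat) p' = ups s p' (k + 1) := by
      intro p' h1 h2 h3
      rw [Function.update_apply]
      split_ifs with h
      · subst h; exact hval h3
      · exact hU p' (by omega) h2 h3
    refine Runs.branch ?_ ?_
    · intro hb
      simp [e4₁, a3₁, e5] at hb
      have hb' : k < reach p := by omega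
      have hadd := ups_add s (show p ≤ l' by omega) hl'k
      refine Runs.mono (recodeProg_runs _ (d := ups s p l') ?_) ?_
      · simp [e10₁, e7₁, hval hb']; omega
      · rintro τ₂ t₂ hf₂ ⟨h1, h2, h3⟩
        have e5₂ := hf₂.v 5 (by simp [recodeProg])
        have e8₂ := hf₂.v 8 (by simp [recodeProg])
        have e9₂ := hf₂.v 9 (by simp [recodeProg])
        have a6₂ := hf₂.a 6 (by simp [recodeProg])
        simp [e5] at e5₂ e8₂ e9₂ a6₂ h2
        simp [e7₁, hval hb'] at h1
        have hcode := code_eq_of_gap s (show p < l' by omega) hb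
          (fun t h1 h2 => hgap' t (by omega) h2)
        refine ⟨p, by omega, e5₂, ⟨l₁, hl₁k, Or.inl hpl₁, hgap₁, by rw [e8₂, h8₁],
          by rw [e9₂, h9₁]⟩, ⟨p, by omega, le_rfl, ?_, h1, ?_⟩, ?_, ?_⟩
        · intro t h1 h2; omega
        · rw [h2, e11₁, a5₁, hP' p (by omega), ← h11, hcode]
          ring
        · rw [a6₂, a6₁]; exact hU'
        · simp [e5, e4₁]; omega
    · intro hb
      simp [e4₁, a3₁, e5] at hb
      refine Runs.nop ?_
      refine ⟨p, by omega, by simp [e5], ⟨l₁, hl₁k, Or.inl hpl₁, hgap₁, by simp [h8₁],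
          by simp [h9₁]⟩, ⟨l', hl'k, by omega, ?_, by simp [e10₁], by simp [e11₁, h11]⟩, ?_, ?_⟩
      · intro t h1 h2
        rcases h1.eq_or_lt with rfl | h1
        · omega
        · exact hgap' t h1 h2
      · simp [a6₁]; exact hU'
      · simp [e10₁, h10] at ht ⊢
        omega
  · rintro τ t hf ⟨q, hqi, h5, ⟨l, hlk, hql, hgap, h8, h9⟩, ⟨l', hl'k, hql', hgap', h10, h11⟩,
      hU, ht⟩
    obtain rfl : q = 0 := by omega
    rw [code_eq_zero_of_gap s (fun t ht => hgap' t (Nat.zero_le t) ht), add_zero] at h11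
    refine ⟨by simp [h5], h11, fun p hp hr => hU p (Nat.zero_le p) hp hr, ?_⟩
    have := ups_le s l k
    have := ups_le s l' (k + 1)
    simp
    omega

end ConsensusHalving

/-! ### Checking the intervals and filling one table entry. -/

namespace ConsensusHalving

/-- Sets the variable `17` to `0` if the intervals that end at `k + 1` are balanced, and to `1`
otherwise. -/
def checkProg : Program :=
  .seq (setVar 17 (.lit 0)) <| .seq (setVar 2 (.lit 0)) <|
  .loop (.ltInt (var 2) (var 0)) <|
    .seq (.branch
      (.conj (.neg (.ltInt (arr 2 (var 2)) (.add (var 4) (.lit 1)))) <|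
        .conj (.neg (.ltInt (.add (var 4) (.lit 1)) (arr 2 (var 2)))) <|
        .conj (.ltInt (arr 1 (var 2)) (.add (var 4) (.lit 1))) <|
        .neg <| .conj
          -- The constant `3` is the tolerance 2 added to the end `k + 1` of the interval.
          (.neg (.ltInt (.add (var 4) (.lit 3))
            (.add (dbl (arr 6 (arr 1 (var 2)))) (arr 1 (var 2)))))
          (.neg (.ltInt (.add (.add (dbl (arr 6 (arr 1 (var 2)))) (arr 1 (var 2))) (.lit 2))
            (.add (var 4) (.lit 1)))))
      (setVar 17 (.lit 1)) .nop) <|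
    setVar 2 (.add (var 2) (.lit 1))

theorem checkProg_runs (σ : Memory) (s : ℕ → Bool) {n k : ℕ} (h0 : σ.v 0 = n) (h4 : σ.v 4 = k)
    (hU : ∀ i < n, σ.a 2 i = k + 1 → σ.a 1 i < k + 1 →
      σ.a 6 (σ.a 1 i) = ups s (σ.a 1 i) (k + 1)) :
    Runs checkProg σ (fun σ' t =>
      (σ'.v 17 = 0 ↔ BalancedAt n (σ.a 1) (σ.a 2) (k + 1) s) ∧ t ≤ 10000 * (n + 1)) := by
  refine Runs.seq (Runs.setVar (Runs.seq (Runs.setVar ?_)))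
  simp only [eval_lit, cost_lit]
  refine Runs.for_ n (fun i τ t => τ.v 2 = i ∧
    (τ.v 17 = 0 ↔ BalancedAt i (σ.a 1) (σ.a 2) (k + 1) s) ∧ t ≤ 9000 * i) ?_ ?_ ?_
  · simp [BalancedAt]
  · rintro i hi τ t hf ⟨h2, h17, ht⟩
    have e0 : τ.v 0 = n := by rw [hf.v 0 (by simp)]; simp [h0]
    have e4 : τ.v 4 = k := by rw [hf.v 4 (by simp)]; simp [h4]
    have a1 : τ.a 1 = σ.a 1 := by rw [hf.a 1 (by simp)]; simp
    have a2 : τ.a 2 = σ.a 2 := by rw [hf.a 2 (by simp)]; simp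
    have a6 : τ.a 6 = σ.a 6 := by rw [hf.a 6 (by simp)]; simp
    have hsucc : BalancedAt (i + 1) (σ.a 1) (σ.a 2) (k + 1) s ↔
        BalancedAt i (σ.a 1) (σ.a 2) (k + 1) s ∧ (σ.a 2 i = k + 1 → σ.a 1 i < k + 1 →
          2 * ups s (σ.a 1 i) (k + 1) + σ.a 1 i ≤ k + 1 + 2 ∧
          k + 1 ≤ 2 * ups s (σ.a 1 i) (k + 1) + σ.a 1 i + 2) := by
      constructor
      · intro h
        exact ⟨fun j hj => h j (by omega), h i (by omega)⟩
      · rintro ⟨h, h'⟩ j hj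
        rcases Nat.lt_succ_iff_lt_or_eq.1 hj with h1 | rfl
        · exact h j h1
        · exact h'
    refine ⟨by simp [h2, e0, hi], Runs.seq (Runs.branch ?_ ?_)⟩
    · intro hb
      simp only [holds_conj, holds_neg, holds_ltInt, eval_arr, eval_var, eval_add, eval_lit,
        eval_dbl, h2, e4, a1, a2, a6] at hb
      obtain ⟨b1, b2, b3, b4⟩ := hb
      rw [hU i hi (by omega) b3] at b4
      refine Runs.setVar (Runs.setVar ?_)
      refine ⟨by simp [h2], ?_, by simp; omega⟩
      simp [hsucc]
      intro _
      exact ⟨by omega, by omega, fun _ => by omega⟩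
    · intro hb
      simp only [holds_conj, holds_neg, holds_ltInt, eval_arr, eval_var, eval_add, eval_lit,
        eval_dbl, h2, e4, a1, a2, a6] at hb
      refine Runs.nop (Runs.setVar ?_)
      refine ⟨by simp [h2], ?_, by simp; omega⟩
      simp [hsucc, h17]
      intro _ h1 h3
      rw [hU i hi h1 (by omega)] at hb
      omega
  · rintro τ t hf ⟨h2, h17, ht⟩
    have e0 : τ.v 0 = n := by rw [hf.v 0 (by simp)]; simp [h0]
    refine ⟨by simp [h2, e0], h17, ?_⟩
    simp
    omega

/-- Fills the table entry of the state with code `6` and new value `7`. -/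
def relaxProg : Program :=
  .seq (setVar 3 (dbl (.add (var 15) (var 11)))) <|
  .seq (setVar 18 (.add (dbl (.add (var 16) (var 6))) (var 7))) <|
  -- The value `n + 1` marks a dead end; no successor is stored, since the trace never visits
  -- entries above `n`.
  .branch (.ltInt (.lit 0) (var 17)) (setArr 7 (var 18) (.add (var 0) (.lit 1))) <|
  -- With `x` in variable `3` and the value `e` at `k` in variable `7`, the successor keeping the
  -- sign is `x + e`, and the one changing it is `x + 1 - e`.
  .branch (.ltInt (.add (arr 7 (.sub (.add (var 3) (.lit 1)) (var 7))) (.lit 1))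
      (arr 7 (.add (var 3) (var 7))))
    (.seq (setArr 7 (var 18) (.add (arr 7 (.sub (.add (var 3) (.lit 1)) (var 7))) (.lit 1)))
      (setArr 8 (var 18) (.sub (.add (var 3) (.lit 1)) (var 7))))
    (.seq (setArr 7 (var 18) (arr 7 (.add (var 3) (var 7))))
      (setArr 8 (var 18) (.add (var 3) (var 7))))

theorem relaxProg_runs (σ : Memory) {x z : ℕ} (hx : 2 * (σ.v 15 + σ.v 11) = x)
    (hz : 2 * (σ.v 16 + σ.v 6) + σ.v 7 = z) :
    Runs relaxProg σ (fun σ' t => (∀ y ≠ z, σ'.a 7 y = σ.a 7 y ∧ σ'.a 8 y = σ.a 8 y) ∧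
      (σ.v 17 ≠ 0 → σ'.a 7 z = σ.v 0 + 1) ∧
      (σ.v 17 = 0 →
        (σ.a 7 (x + σ.v 7) ≤ σ.a 7 (x + 1 - σ.v 7) + 1 →
          σ'.a 7 z = σ.a 7 (x + σ.v 7) ∧ σ'.a 8 z = x + σ.v 7) ∧
        (¬ σ.a 7 (x + σ.v 7) ≤ σ.a 7 (x + 1 - σ.v 7) + 1 →
          σ'.a 7 z = σ.a 7 (x + 1 - σ.v 7) + 1 ∧ σ'.a 8 z = x + 1 - σ.v 7)) ∧ t ≤ 2000) := by
  refine Runs.seq (Runs.setVar (Runs.seq (Runs.setVar (Runs.branch ?_ ?_))))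
  · intro hb
    simp at hb
    refine Runs.setArr ?_
    simp [hx, hz]
    refine ⟨fun y hy => ?_, fun h => absurd h (by omega)⟩
    rw [Function.update_of_ne hy]
  · intro hb
    simp at hb
    refine Runs.branch ?_ ?_
    · intro hc
      simp [hx] at hc
      refine Runs.seq (Runs.setArr (Runs.setArr ?_))
      simp [hx, hz, hb]
      refine ⟨fun y hy => ?_, fun h => absurd h (by omega)⟩
      rw [Function.update_of_ne hy, Function.update_of_ne hy]
      exact ⟨rfl, rfl⟩
    · intro hc
      simp [hx] at hc
      refine Runs.seq (Runs.setArr (Runs.setArr ?_))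
      simp [hx, hz, hb]
      refine ⟨fun y hy => ?_, fun h => absurd h (by omega)⟩
      rw [Function.update_of_ne hy, Function.update_of_ne hy]
      exact ⟨rfl, rfl⟩

/-- The entry of the layer `k` that belongs to `s` is correct. -/
def EntryCorrect (n m : ℕ) (al be reach : ℕ → ℕ) (T X : ℕ → ℕ) (k : ℕ) (s : ℕ → Bool) : Prop :=
  ((∀ j, k < j → j ≤ m → BalancedAt n al be j s) → T (entry reach m k s) ≤ turns s k m) ∧
    (k < m → T (entry reach m k s) ≤ n → BalancedAt n al be (k + 1) s ∧
      ∃ s', (∀ t ≤ k, s' t = s t) ∧ X (entry reach m k s) = entry reach m (k + 1) s' ∧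
        T (entry reach m k s) = T (entry reach m (k + 1) s') + turns s' k (k + 1))

theorem entry_lt (reach : ℕ → ℕ) {m k : ℕ} (s : ℕ → Bool) :
    entry reach m k s < 2 * (offset reach m k + codeCount reach k k) := by
  have := code_lt (reach := reach) (k := k) s k
  unfold entry
  cases s k <;> simp <;> omega

/-- The layers occupy consecutive blocks of the table, later layers first. Filling layer `k` thus
never disturbs what it depends on. -/
theorem entry_succ_lt (reach : ℕ → ℕ) {m k : ℕ} (hk : k < m) (s : ℕ → Bool) :
    entry reach m (k + 1) s < 2 * offset reach m k := by
  rw [offset_eq reach hk]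
  exact entry_lt reach s

theorem le_entry (reach : ℕ → ℕ) {m k : ℕ} (s : ℕ → Bool) :
    2 * offset reach m k ≤ entry reach m k s := by
  unfold entry; omega

/-- Correctness of an entry refers only to the entry itself and to successors, which have smaller
indices. -/
theorem EntryCorrect.congr {n m : ℕ} {al be reach T X T' X' : ℕ → ℕ} {k : ℕ} {s : ℕ → Bool}
    (h : EntryCorrect n m al be reach T X k s)
    (hT : ∀ y ≤ entry reach m k s, T' y = T y) (hX : ∀ y ≤ entry reach m k s, X' y = X y) :
    EntryCorrect n m al be reach T' X' k s := by
  refine ⟨fun hb => ?_, fun hk hle => ?_⟩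
  · rw [hT _ le_rfl]; exact h.1 hb
  · rw [hT _ le_rfl] at hle
    obtain ⟨hb, s', h1, h2, h3⟩ := h.2 hk hle
    refine ⟨hb, s', h1, by rw [hX _ le_rfl, h2], ?_⟩
    have := entry_succ_lt reach hk s'
    have := le_entry reach (m := m) (k := k) s
    rw [hT _ le_rfl, h3, hT _ (by omega)]

/-- Processes the state with code `6` and new value `7`. -/
def entryProg : Program := .seq transitionProg (.seq checkProg relaxProg)

/-- The memory holds the data of the layers `k` and `k + 1`. -/
structure LayerData (n m : ℕ) (al be reach : ℕ → ℕ) (k : ℕ) (σ : Memory) : Prop where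
  v0 : σ.v 0 = n
  v4 : σ.v 4 = k
  v15 : σ.v 15 = offset reach m (k + 1)
  v16 : σ.v 16 = offset reach m k
  a1 : σ.a 1 = al
  a2 : σ.a 2 = be
  a3 : σ.a 3 = reach
  a4 : ∀ p ≤ k, σ.a 4 p = codeCount reach k p
  a5 : ∀ p ≤ k + 1, σ.a 5 p = codeCount reach (k + 1) p

theorem LayerData.of_framed {n m : ℕ} {al be reach : ℕ → ℕ} {k : ℕ} {σ σ' : Memory}
    (h : LayerData n m al be reach k σ) (hf : Framed entryProg σ σ') :
    LayerData n m al be reach k σ' := by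
  have ha : ∀ j, 0 < j → j < 6 → σ'.a j = σ.a j := by
    intro j hj hj'
    apply hf.a
    simp [entryProg, transitionProg, digitProg, recodeProg, checkProg, relaxProg, hj,
      show j < 16 by omega, show j ≠ 6 by omega, show j ≠ 7 by omega, show j ≠ 8 by omega]
  have hv : ∀ x, x = 0 ∨ x = 4 ∨ x = 15 ∨ x = 16 → σ'.v x = σ.v x := by
    intro x hx
    apply hf.v
    rcases hx with rfl | rfl | rfl | rfl <;>
      simp [entryProg, transitionProg, digitProg, recodeProg, checkProg, relaxProg]
  exact ⟨by rw [hv 0 (by simp), h.v0], by rw [hv 4 (by simp), h.v4], by rw [hv 15 (by simp), h.v15],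
    by rw [hv 16 (by simp), h.v16], by rw [ha 1 (by simp) (by simp), h.a1],
    by rw [ha 2 (by simp) (by simp), h.a2], by rw [ha 3 (by simp) (by simp), h.a3],
    by rw [ha 4 (by simp) (by simp)]; exact h.a4, by rw [ha 5 (by simp) (by simp)]; exact h.a5⟩

/-- The program knows only the code, whereas correctness concerns every sequence with that code.
`hreach` guarantees that an interval ending at `k + 1` starts at a position live in layer `k`, so
that the required count can be read off from the code. -/
theorem entryProg_runs {n m : ℕ} {al be reach : ℕ → ℕ} {k : ℕ} (hk : k < m)
    (hreach : ∀ i < n, be i ≤ reach (al i)) {σ : Memory} (hd : LayerData n m al be reach k σ)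
    (hnext : LayerCorrect n m al be reach (σ.a 7) (σ.a 8) (k + 1)) {c : ℕ} {e : Bool}
    (h6 : σ.v 6 = c) (hc : c < codeCount reach k k) (h7 : σ.v 7 = e.toNat) :
    Runs entryProg σ (fun σ' t =>
      (∀ y ≠ 2 * (offset reach m k + c) + e.toNat, σ'.a 7 y = σ.a 7 y ∧ σ'.a 8 y = σ.a 8 y) ∧
      (∀ s, code reach k s k = c → s k = e → EntryCorrect n m al be reach (σ'.a 7) (σ'.a 8) k s) ∧
      t ≤ 10000 * (m + n + 2)) := by
  have hne : Nonempty {s : ℕ → Bool // code reach k s k = c ∧ s k = e} := by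
    obtain ⟨s, hs⟩ := exists_code_eq hc
    refine ⟨Function.update s k e, ?_, Function.update_self _ _ _⟩
    rw [← hs]
    exact code_congr fun t ht => Function.update_of_ne (by omega) _ _
  refine Runs.mono (R := fun σ' t => ∀ s : {s : ℕ → Bool // code reach k s k = c ∧ s k = e},
    (∀ y ≠ 2 * (offset reach m k + c) + e.toNat, σ'.a 7 y = σ.a 7 y ∧ σ'.a 8 y = σ.a 8 y) ∧
    EntryCorrect n m al be reach (σ'.a 7) (σ'.a 8) k s.1 ∧ t ≤ 10000 * (m + n + 2)) ?_ ?_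
  swap
  · intro σ' t _ h
    exact ⟨(h hne.some).1, fun s h1 h2 => (h ⟨s, h1, h2⟩).2.1, (h hne.some).2.2⟩
  -- Execution does not depend on the sequence used to describe it; by determinism the specification
  -- may be proved for each `s` separately.
  refine Runs.forall_of ?_
  rintro ⟨s, hs, hse⟩
  have hentry : entry reach m k s = 2 * (offset reach m k + c) + e.toNat := by
    rw [entry, hs, hse]
  refine Runs.seq (Runs.mono (transitionProg_runs σ s hd.v4 (by rw [h6, hd.a3, hs])
    (by rw [h7, hse]) (by rw [hd.a3]; exact hd.a4) (by rw [hd.a3]; exact hd.a5)) ?_)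
  rintro τ t hf ⟨h11, hU, ht⟩
  rw [hd.a3] at h11 hU
  have a1 : τ.a 1 = al := by
    rw [hf.a 1 (by simp [transitionProg, digitProg, recodeProg]), hd.a1]
  have a2 : τ.a 2 = be := by
    rw [hf.a 2 (by simp [transitionProg, digitProg, recodeProg]), hd.a2]
  have a7 : τ.a 7 = σ.a 7 := hf.a 7 (by simp [transitionProg, digitProg, recodeProg])
  have a8 : τ.a 8 = σ.a 8 := hf.a 8 (by simp [transitionProg, digitProg, recodeProg])
  have hv : ∀ x, x = 0 ∨ x = 4 ∨ x = 6 ∨ x = 7 ∨ x = 15 ∨ x = 16 → τ.v x = σ.v x := by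
    intro x hx
    apply hf.v
    rcases hx with rfl | rfl | rfl | rfl | rfl | rfl <;>
      simp [transitionProg, digitProg, recodeProg]
  refine Runs.seq (Runs.mono (checkProg_runs τ s (n := n) (k := k) (by rw [hv 0 (by simp), hd.v0])
    (by rw [hv 4 (by simp), hd.v4]) ?_) ?_)
  · intro i hi h1 h2
    rw [a2] at h1
    rw [a1] at h2 ⊢
    -- Since `be i = k + 1 ≤ reach (al i)`, the start of the interval is live in layer `k` and its
    -- count has been computed.
    exact hU _ (by omega) (by have := hreach i hi; omega)
  rintro τ' t' hf' ⟨h17, ht'⟩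
  have a7' : τ'.a 7 = σ.a 7 := by rw [hf'.a 7 (by simp [checkProg]), a7]
  have a8' : τ'.a 8 = σ.a 8 := by rw [hf'.a 8 (by simp [checkProg]), a8]
  have hv' : ∀ x, x = 0 ∨ x = 6 ∨ x = 7 ∨ x = 11 ∨ x = 15 ∨ x = 16 → τ'.v x = τ.v x := by
    intro x hx
    apply hf'.v
    rcases hx with rfl | rfl | rfl | rfl | rfl | rfl <;> simp [checkProg]
  have w0 : τ'.v 0 = n := by rw [hv' 0 (by simp), hv 0 (by simp), hd.v0]
  have w6 : τ'.v 6 = c := by rw [hv' 6 (by simp), hv 6 (by simp), h6]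
  have w7 : τ'.v 7 = (s k).toNat := by rw [hv' 7 (by simp), hv 7 (by simp), h7, hse]
  have w11 : τ'.v 11 = code reach (k + 1) s (k + 1) := by rw [hv' 11 (by simp), h11]
  have w15 : τ'.v 15 = offset reach m (k + 1) := by
    rw [hv' 15 (by simp), hv 15 (by simp), hd.v15]
  have w16 : τ'.v 16 = offset reach m k := by rw [hv' 16 (by simp), hv 16 (by simp), hd.v16]
  refine Runs.mono (relaxProg_runs τ' (x := 2 * (offset reach m (k + 1) +
    code reach (k + 1) s (k + 1))) (z := entry reach m k s) (by rw [w15, w11])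
    (by rw [w16, w6, w7, entry, hs])) ?_
  rintro τ'' t'' hf'' ⟨h1, h2, h3, ht''⟩
  rw [a1, a2] at h17
  rw [w7] at h3
  rw [w0] at h2
  have hlow : ∀ y ≠ entry reach m k s, τ''.a 7 y = σ.a 7 y ∧ τ''.a 8 y = σ.a 8 y := by
    intro y hy
    rw [← a7', ← a8']
    exact h1 y hy
  refine ⟨by rw [← hentry]; exact hlow, ?_, by omega⟩
  set x := 2 * (offset reach m (k + 1) + code reach (k + 1) s (k + 1)) with hx
  have hle := le_entry reach (m := m) (k := k) s
  have hxlt : x + 1 < entry reach m k s := by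
    have := code_lt (reach := reach) (k := k + 1) s (k + 1)
    rw [offset_eq reach hk] at hle
    omega
  have hnext' : LayerCorrect n m al be reach (τ''.a 7) (τ''.a 8) (k + 1) := by
    intro s'
    refine EntryCorrect.congr (hnext s') ?_ ?_ <;> intro y hy <;>
      have := entry_succ_lt reach hk s'
    · exact (hlow y (by omega)).1
    · exact (hlow y (by omega)).2
  have hstep := layer_step hk hnext' hx
    (fun hb => by
      rw [h2 (fun h => hb (h17.1 h))]; omega)
    (fun hb => by
      have := h3 (h17.2 hb)
      have e1 := (h1 (x + (s k).toNat) (by cases s k <;> simp <;> omega)).1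
      have e2 := (h1 (x + 1 - (s k).toNat) (by cases s k <;> simp <;> omega)).1
      rw [e1, e2]
      exact this)
  exact ⟨hstep.1, fun _ => hstep.2⟩

end ConsensusHalving

/-! ### Filling a layer and the whole table. -/

namespace ConsensusHalving

theorem offset_add_le (reach : ℕ → ℕ) {m k j : ℕ} (hkj : k < j) (hj : j ≤ m) :
    offset reach m j + codeCount reach j j ≤ offset reach m k := by
  induction j, hkj using Nat.le_induction with
  | base => exact (offset_eq reach (by omega)).ge
  | succ j hkj ih =>
    have := ih (by omega)
    rw [offset_eq reach (show j < m by omega)] at this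
    omega

/-- Later layers lie entirely below the block of layer `k`, so work on layer `k` preserves their
correctness. -/
theorem LayerCorrect.congr {n m : ℕ} {al be reach T X T' X' : ℕ → ℕ} {k j : ℕ} (hkj : k < j)
    (hj : j ≤ m) (h : LayerCorrect n m al be reach T X j)
    (hlow : ∀ y < 2 * offset reach m k, T' y = T y ∧ X' y = X y) :
    LayerCorrect n m al be reach T' X' j := by
  intro s
  have h1 := entry_lt reach (m := m) (k := j) s
  have h2 := offset_add_le reach hkj hj
  exact EntryCorrect.congr (h s) (fun y hy => (hlow y (by omega)).1)
    (fun y hy => (hlow y (by omega)).2)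

theorem LayerData.setV {n m : ℕ} {al be reach : ℕ → ℕ} {k : ℕ} {σ : Memory}
    (h : LayerData n m al be reach k σ) {x : ℕ} (hx : x = 6 ∨ x = 7) (w : ℕ) :
    LayerData n m al be reach k (σ.setV x w) := by
  obtain ⟨h0, h4, h15, h16, h1, h2, h3, h4', h5⟩ := h
  rcases hx with rfl | rfl <;> constructor <;> simp <;> assumption

/-- Processes the layer in variable `4`, whose number of codes is in variable `14`. -/
def layerProg : Program :=
  .seq (setVar 6 (.lit 0)) <| .loop (.ltInt (var 6) (var 14)) <|
    .seq (setVar 7 (.lit 0)) <| .seq entryProg <| .seq (setVar 7 (.lit 1)) <| .seq entryProg <|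
    setVar 6 (.add (var 6) (.lit 1))

/-- The entries are filled in increasing order of their index, and each write leaves all smaller
entries intact. As the codes run through all numbers below the code count, every sequence has its
entry filled. -/
theorem layerProg_runs {n m : ℕ} {al be reach : ℕ → ℕ} {k : ℕ} (hk : k < m)
    (hreach : ∀ i < n, be i ≤ reach (al i)) {σ : Memory} (hd : LayerData n m al be reach k σ)
    (hnext : LayerCorrect n m al be reach (σ.a 7) (σ.a 8) (k + 1))
    (h14 : σ.v 14 = codeCount reach k k) :
    Runs layerProg σ (fun σ' t =>
      (∀ y < 2 * offset reach m k, σ'.a 7 y = σ.a 7 y ∧ σ'.a 8 y = σ.a 8 y) ∧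
      LayerCorrect n m al be reach (σ'.a 7) (σ'.a 8) k ∧
      t ≤ codeCount reach k k * (30000 * (m + n + 2)) + 100) := by
  refine Runs.seq (Runs.setVar ?_)
  refine Runs.for_ (codeCount reach k k) (fun i τ t => τ.v 6 = i ∧ LayerData n m al be reach k τ ∧
    (∀ y < 2 * offset reach m k, τ.a 7 y = σ.a 7 y ∧ τ.a 8 y = σ.a 8 y) ∧
    (∀ s, code reach k s k < i → EntryCorrect n m al be reach (τ.a 7) (τ.a 8) k s) ∧
    t ≤ i * (30000 * (m + n + 2))) ?_ ?_ ?_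
  · refine ⟨by simp, hd.setV (Or.inl rfl) _, ?_, ?_, by simp⟩
    · simp
    · intro s hs; omega
  · rintro i hi τ t hf ⟨h6, hdτ, hlow, hdone, ht⟩
    have e14 : τ.v 14 = codeCount reach k k := by
      rw [hf.v 14 (by simp [entryProg, transitionProg, digitProg, recodeProg, checkProg, relaxProg])]
      simp [h14]
    refine ⟨by simp [h6, e14, hi], Runs.seq (Runs.setVar (Runs.seq ?_))⟩
    have hlow' : ∀ {τ' : Memory} {z : ℕ}, 2 * offset reach m k ≤ z →
        (∀ y < 2 * offset reach m k, τ'.a 7 y = σ.a 7 y ∧ τ'.a 8 y = σ.a 8 y) →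
        ∀ τ'' : Memory, (∀ y ≠ z, τ''.a 7 y = τ'.a 7 y ∧ τ''.a 8 y = τ'.a 8 y) →
        ∀ y < 2 * offset reach m k, τ''.a 7 y = σ.a 7 y ∧ τ''.a 8 y = σ.a 8 y := by
      intro τ' z hz h1 τ'' h2 y hy
      rw [(h2 y (by omega)).1, (h2 y (by omega)).2]
      exact h1 y hy
    have hd1 := hdτ.setV (x := 7) (Or.inr rfl) ((IntExpr.lit 0).eval τ)
    refine Runs.mono (entryProg_runs hk hreach hd1 (c := i) (e := false)
      (by simpa using LayerCorrect.congr (Nat.lt_succ_self k) hk hnext hlow) (by simp [h6]) hi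
      (by simp)) ?_
    rintro τ₁ t₁ hf₁ ⟨g1, g2, gt⟩
    have hd2 := (hd1.of_framed hf₁).setV (x := 7) (Or.inr rfl) ((IntExpr.lit 1).eval τ₁)
    have h6₁ : τ₁.v 6 = i := by
      rw [hf₁.v 6 (by simp [entryProg, transitionProg, digitProg, recodeProg, checkProg, relaxProg])]
      simp [h6]
    simp only [Bool.toNat_false, add_zero, eval_lit, ne_eq, OfNat.ofNat_ne_zero, not_false_eq_true,
      Memory.setV_a, Nat.ofNat_pos, Nat.reduceLT] at g1
    have hlow₁ := hlow' (by omega) hlow τ₁ g1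
    refine Runs.seq (Runs.setVar (Runs.seq ?_))
    refine Runs.mono (entryProg_runs hk hreach hd2 (c := i) (e := true)
      (by simpa using LayerCorrect.congr (Nat.lt_succ_self k) hk hnext hlow₁) (by simp [h6₁]) hi
      (by simp)) ?_
    rintro τ₂ t₂ hf₂ ⟨k1, k2, kt⟩
    have h6₂ : τ₂.v 6 = i := by
      rw [hf₂.v 6 (by simp [entryProg, transitionProg, digitProg, recodeProg, checkProg, relaxProg])]
      simp [h6₁]
    simp only [Bool.toNat_true, eval_lit, ne_eq, OfNat.ofNat_ne_zero, not_false_eq_true,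
      Memory.setV_a, Nat.ofNat_pos, Nat.reduceLT] at k1
    have hlow₂ := hlow' (by omega) hlow₁ τ₂ k1
    refine Runs.setVar ⟨by simp [h6₂], (hd2.of_framed hf₂).setV (Or.inl rfl) _, by simpa using hlow₂,
      ?_, ?_⟩
    · intro s hs
      simp only [Nat.ofNat_pos, Nat.reduceLT, Memory.setV_a]
      by_cases hc : code reach k s k = i
      · by_cases he : s k = true
        · exact k2 s hc he
        · have he : s k = false := by simpa using he
          have hentry : entry reach m k s = 2 * (offset reach m k + i) := by
            rw [entry, hc, he]; rfl
          exact EntryCorrect.congr (g2 s hc he) (fun y hy => (k1 y (by omega)).1)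
            (fun y hy => (k1 y (by omega)).2)
      · have hentry : entry reach m k s < 2 * (offset reach m k + i) := by
          unfold entry
          cases s k <;> simp <;> omega
        refine EntryCorrect.congr (hdone s (by omega)) (fun y hy => ?_) (fun y hy => ?_)
        · rw [(k1 y (by omega)).1, (g1 y (by omega)).1]
        · rw [(k1 y (by omega)).2, (g1 y (by omega)).2]
    · simp only [testCost_ltInt, cost_var, cost_lit, cost_add]
      rw [add_mul]
      omega
  · rintro τ t hf ⟨h6, hdτ, hlow, hdone, ht⟩
    have e14 : τ.v 14 = codeCount reach k k := by
      rw [hf.v 14 (by simp [entryProg, transitionProg, digitProg, recodeProg, checkProg, relaxProg])]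
      simp [h14]
    refine ⟨by simp [h6, e14], hlow, fun s => hdone s (code_lt s k), ?_⟩
    simp
    omega

/-- The dynamic program. -/
def tableProg : Program :=
  .seq (setVar 4 (var 1)) <| .seq (setVar 15 (.lit 0)) <|
  .loop (.ltInt (.lit 0) (var 4)) <|
    .seq (setVar 4 (.sub (var 4) (.lit 1))) <|
    .seq (setVar 21 (.add (var 4) (.lit 1))) <|
    .seq (weightsProg 5) <|
    -- After `weightsProg 5`, variable `12` holds the number of codes of layer `k + 1`, which is the
    -- difference between the two offsets. It must be used before the weights of layer `k` overwrite
    -- it.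
    .seq (setVar 16 (.add (var 15) (var 12))) <|
    .seq (setVar 21 (var 4)) <|
    .seq (weightsProg 4) <|
    .seq (setVar 14 (var 12)) <|
    .seq layerProg <|
    setVar 15 (var 16)

/-- No interval reaches beyond `m`, so the last layer has the single code `0` and its entries are
`0` and `1`. The zero initial memory already contains the right values. -/
theorem layerCorrect_last {n m : ℕ} {al be reach T X : ℕ → ℕ} (hm : ∀ p, reach p ≤ m)
    (h0 : T 0 = 0) (h1 : T 1 = 0) : LayerCorrect n m al be reach T X m := by
  intro s
  have hc : code reach m s m = 0 := code_eq_zero_of_gap s fun t _ => by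
    have := hm t
    omega
  have he : entry reach m m s = (s m).toNat := by
    rw [entry, hc, offset_self]
    simp
  refine ⟨fun _ => ?_, fun h => absurd h (lt_irrefl m)⟩
  rw [he]
  cases s m <;> simp [h0, h1]

theorem avoids_layerProg_var {x : ℕ} (hx : x < 6 ∨ 11 < x) (h2 : x ≠ 2) (h3 : x ≠ 3) (h5 : x ≠ 5)
    (h17 : x ≠ 17) (h18 : x ≠ 18) : AvoidsVar x layerProg := by
  simp [layerProg, entryProg, transitionProg, digitProg, recodeProg, checkProg, relaxProg]
  omega

theorem avoids_layerProg_arr {j : ℕ} (h0 : 0 < j) (h6 : j < 6) : AvoidsArr j layerProg := by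
  simp [layerProg, entryProg, transitionProg, digitProg, recodeProg, checkProg, relaxProg, h0,
    show j < 16 by omega, show j ≠ 6 by omega, show j ≠ 7 by omega, show j ≠ 8 by omega]

theorem tableProg_runs {n m S : ℕ} {al be reach : ℕ → ℕ} (hreach : ∀ i < n, be i ≤ reach (al i))
    (hm : ∀ p, reach p ≤ m) (hS : ∀ k < m, codeCount reach k k ≤ S) {σ : Memory} (h0 : σ.v 0 = n)
    (h1 : σ.v 1 = m) (ha1 : σ.a 1 = al) (ha2 : σ.a 2 = be) (ha3 : σ.a 3 = reach)
    (h7 : σ.a 7 0 = 0) (h7' : σ.a 7 1 = 0) :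
    Runs tableProg σ (fun σ' t => σ'.v 15 = offset reach m 0 ∧
      (∀ j ≤ m, LayerCorrect n m al be reach (σ'.a 7) (σ'.a 8) j) ∧
      t ≤ m * (S * (30000 * (m + n + 2)) + 1000 * (m + 1)) + 100) := by
  refine Runs.seq (Runs.setVar (Runs.seq (Runs.setVar ?_)))
  refine Runs.for_ m (fun i τ t => ∃ k, k + i = m ∧ τ.v 4 = k ∧ τ.v 15 = offset reach m k ∧
    (∀ j, k ≤ j → j ≤ m → LayerCorrect n m al be reach (τ.a 7) (τ.a 8) j) ∧
    t ≤ i * (S * (30000 * (m + n + 2)) + 1000 * (m + 1))) ?_ ?_ ?_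
  · refine ⟨m, rfl, by simp [h1], by simp [offset_self], ?_, by simp⟩
    intro j hj hj'
    obtain rfl : j = m := by omega
    exact layerCorrect_last hm (by simpa using h7) (by simpa using h7')
  · rintro i hi τ t hf ⟨q, hqi, h4, h15, hdone, ht⟩
    obtain ⟨k, rfl⟩ : ∃ k, q = k + 1 := ⟨q - 1, by omega⟩
    have hk : k < m := by omega
    have e0 : τ.v 0 = n := by
      rw [hf.v 0 (by simp [weightsProg, avoids_layerProg_var])]; simp [h0]
    have a1 : τ.a 1 = al := by
      rw [hf.a 1 (by simp [weightsProg, avoids_layerProg_arr])]; simp [ha1]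
    have a2 : τ.a 2 = be := by
      rw [hf.a 2 (by simp [weightsProg, avoids_layerProg_arr])]; simp [ha2]
    have a3 : τ.a 3 = reach := by
      rw [hf.a 3 (by simp [weightsProg, avoids_layerProg_arr])]; simp [ha3]
    refine ⟨by simp [h4], Runs.seq (Runs.setVar (Runs.seq (Runs.setVar (Runs.seq ?_))))⟩
    refine Runs.mono (weightsProg_runs (by norm_num) (by norm_num) _) ?_
    rintro τ₁ t₁ hf₁ ⟨g1, g2, g3⟩
    simp [h4, a3] at g1 g2 g3
    have hv₁ : ∀ x, x = 0 ∨ x = 4 ∨ x = 15 → τ₁.v x = if x = 4 then k else τ.v x := by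
      intro x hx
      rw [hf₁.v x (by rcases hx with rfl | rfl | rfl <;> simp [weightsProg])]
      rcases hx with rfl | rfl | rfl <;> simp [h4]
    have ha₁ : ∀ j, 0 < j → j < 16 → j ≠ 5 → τ₁.a j = τ.a j := by
      intro j h h' h''
      rw [hf₁.a j (by simp [weightsProg, h, h', h''])]
      simp [h, h']
    refine Runs.seq (Runs.setVar (Runs.seq (Runs.setVar (Runs.seq ?_))))
    refine Runs.mono (weightsProg_runs (by norm_num) (by norm_num) _) ?_
    rintro τ₂ t₂ hf₂ ⟨k1, k2, k3⟩
    simp [hv₁ 4, ha₁ 3, a3] at k1 k2 k3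
    have hv₂ : ∀ x, x = 0 ∨ x = 4 ∨ x = 15 ∨ x = 16 →
        τ₂.v x = if x = 16 then τ₁.v 15 + τ₁.v 12 else τ₁.v x := by
      intro x hx
      rw [hf₂.v x (by rcases hx with rfl | rfl | rfl | rfl <;> simp [weightsProg])]
      rcases hx with rfl | rfl | rfl | rfl <;> simp
    have ha₂ : ∀ j, 0 < j → j < 16 → j ≠ 4 → τ₂.a j = τ₁.a j := by
      intro j h h' h''
      rw [hf₂.a j (by simp [weightsProg, h, h', h''])]
      simp [h, h']
    refine Runs.seq (Runs.setVar (Runs.seq ?_))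
    have h15' : τ₁.v 15 = offset reach m (k + 1) := by simp [hv₁ 15, h15]
    have hd : LayerData n m al be reach k (τ₂.setV 14 ((var 12).eval τ₂)) := by
      constructor
      · simp [hv₂ 0, hv₁ 0, e0]
      · simp [hv₂ 4, hv₁ 4]
      · simp [hv₂ 15, h15']
      · simp [hv₂ 16, h15', g2, offset_eq reach hk]
      · simp [ha₂ 1, ha₁ 1, a1]
      · simp [ha₂ 2, ha₁ 2, a2]
      · simp [ha₂ 3, ha₁ 3, a3]
      · simpa using k1
      · simpa [ha₂ 5] using g1
    refine Runs.mono (layerProg_runs hk hreach hd ?_ ?_) ?_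
    · have := hdone (k + 1) le_rfl hk
      simpa [ha₂ 7, ha₁ 7, ha₂ 8, ha₁ 8] using this
    · simp [k2]
    rintro τ₃ t₃ hf₃ ⟨l1, l2, l3⟩
    simp [ha₂ 7, ha₁ 7, ha₂ 8, ha₁ 8] at l1
    refine Runs.setVar ⟨k, by omega, ?_, ?_, ?_, ?_⟩
    · have := hf₃.v 4 (by simp [avoids_layerProg_var])
      simp at this
      simp [this, hv₂ 4, hv₁ 4]
    · have := hf₃.v 16 (by simp [avoids_layerProg_var])
      simp at this
      simp [this, hv₂ 16, h15', g2, offset_eq reach hk]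
    · intro j hj hjm
      simp only [Nat.ofNat_pos, Nat.reduceLT, Memory.setV_a]
      rcases hj.eq_or_lt with rfl | hlt
      · exact l2
      · exact LayerCorrect.congr hlt hjm (hdone j hlt hjm) l1
    · have : codeCount reach k k * (30000 * (m + n + 2)) ≤ S * (30000 * (m + n + 2)) :=
        Nat.mul_le_mul_right _ (hS k hk)
      simp only [testCost_ltInt, cost_var, cost_lit, cost_add, cost_sub]
      rw [add_mul]
      omega
  · rintro τ t hf ⟨k, hki, h4, h15, hdone, ht⟩
    obtain rfl : k = 0 := by omega
    refine ⟨by simp [h4], h15, fun j hj => hdone j (Nat.zero_le j) hj, ?_⟩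
    simp
    omega

end ConsensusHalving

/-! ### Reading off the cuts. -/

namespace ConsensusHalving

/-- Follows the optimal decisions and writes the cuts. -/
def traceProg : Program :=
  .seq (setVar 19 (dbl (var 15))) <| .seq (setVar 4 (.lit 0)) <| .seq (setVar 20 (.lit 0)) <|
  .seq (.loop (.ltInt (var 4) (var 1)) <|
    .seq (setVar 3 (arr 8 (var 19))) <|
    .seq (.branch (.ltInt (arr 7 (var 3)) (arr 7 (var 19)))
      (.seq (.setReal (var 20) (.div (.ofInt (.add (var 4) (.lit 1))) (.ofInt (var 1))))
        (setVar 20 (.add (var 20) (.lit 1)))) .nop) <|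
    .seq (setVar 19 (var 3)) (setVar 4 (.add (var 4) (.lit 1)))) <|
  setVar 0 (var 20)

@[simp] theorem v_with_reals (σ : Memory) (r : ℕ → ℝ) (x : ℕ) :
    ({ σ with reals := r } : Memory).v x = σ.v x := rfl

@[simp] theorem a_with_reals (σ : Memory) (r : ℕ → ℝ) (j : ℕ) :
    ({ σ with reals := r } : Memory).a j = σ.a j := rfl

/-- The positions of the sign changes in the first `i` cells, on the grid of width `1 / m`. -/
noncomputable def cutsBefore (s : ℕ → Bool) (m i : ℕ) : Finset ℝ :=
  ((Finset.Ico 0 i).filter (fun t => s t ≠ s (t + 1))).image (fun t : ℕ => ((t : ℝ) + 1) / m)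

theorem cutsBefore_congr {s s' : ℕ → Bool} (m : ℕ) {i : ℕ} (h : ∀ t ≤ i, s t = s' t) :
    cutsBefore s m i = cutsBefore s' m i := by
  unfold cutsBefore
  congr 1
  apply Finset.filter_congr
  intro t ht
  rw [Finset.mem_Ico] at ht
  rw [h t ht.2.le, h (t + 1) ht.2]

theorem cutsBefore_succ (s : ℕ → Bool) (m i : ℕ) : cutsBefore s m (i + 1) =
    if s i = s (i + 1) then cutsBefore s m i
    else insert (((i : ℝ) + 1) / m) (cutsBefore s m i) := by
  have e : Finset.Ico 0 (i + 1) = insert i (Finset.Ico 0 i) := by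
    ext t; simp only [Finset.mem_Ico, Finset.mem_insert]; omega
  rw [cutsBefore, e, Finset.filter_insert]
  by_cases h : s i = s (i + 1)
  · rw [if_neg (not_not.2 h), if_pos h]; rfl
  · rw [if_pos h, if_neg h, Finset.image_insert]; rfl

/-- The value of the current entry plus the turns made so far never exceeds `n`. Hence the entry is
never a dead end, and correctness of its layer supplies a sequence that continues the present one. A
drop of the table value along the stored successor signals a turn. -/
theorem traceProg_runs {n m : ℕ} {al be reach : ℕ → ℕ} {σ : Memory} (h1 : σ.v 1 = m)
    (h15 : σ.v 15 = offset reach m 0)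
    (hcorrect : ∀ j ≤ m, LayerCorrect n m al be reach (σ.a 7) (σ.a 8) j)
    (hle : σ.a 7 (2 * offset reach m 0) ≤ n) :
    Runs traceProg σ (fun σ' t => (∃ s, turns s 0 m ≤ n ∧
      (∀ j, 0 < j → j ≤ m → BalancedAt n al be j s) ∧ outputCuts σ' = gridCuts s m) ∧
      t ≤ 1000 * (m + 1)) := by
  refine Runs.seq (Runs.setVar (Runs.seq (Runs.setVar (Runs.seq (Runs.setVar ?_)))))
  refine Runs.seq (Runs.for_ m (fun i τ t => τ.v 4 = i ∧ t ≤ 900 * i ∧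
    ∃ s, τ.v 19 = entry reach m i s ∧ σ.a 7 (entry reach m i s) + turns s 0 i ≤ n ∧
      (∀ j, 0 < j → j ≤ i → BalancedAt n al be j s) ∧ τ.v 20 = turns s 0 i ∧
      (Finset.range (turns s 0 i)).image τ.reals = cutsBefore s m i) ?_ ?_ ?_)
  · have he : entry reach m 0 (fun _ => false) = 2 * offset reach m 0 := by simp [entry, code]
    refine ⟨by simp, by simp, fun _ => false, by simp [h15, he], by simpa [he, turns_self] using hle,
      fun j hj hj' => by omega, by simp [turns_self], by simp [turns_self, cutsBefore]⟩
  · rintro i hi τ t hf ⟨h4, ht, s, h19, hn, hbal, h20, himg⟩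
    have e1 : τ.v 1 = m := by rw [hf.v 1 (by simp)]; simp [h1]
    have a7 : τ.a 7 = σ.a 7 := by rw [hf.a 7 (by simp)]; simp
    have a8 : τ.a 8 = σ.a 8 := by rw [hf.a 8 (by simp)]; simp
    obtain ⟨hb, s', hs', hX, hT⟩ := (hcorrect i hi.le s).2 hi (by omega)
    have ht1 : turns s' 0 i = turns s 0 i := turns_congr fun t _ ht => hs' t ht
    have ht2 : turns s' 0 (i + 1) = turns s 0 i + turns s' i (i + 1) := by
      rw [← turns_add s' (Nat.zero_le i) (Nat.le_succ i), ht1]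
    have hc1 : cutsBefore s' m i = cutsBefore s m i := cutsBefore_congr m fun t ht => hs' t ht
    have hn' : σ.a 7 (entry reach m (i + 1) s') + turns s' 0 (i + 1) ≤ n := by
      rw [ht2]; omega
    have hbal' : ∀ j, 0 < j → j ≤ i + 1 → BalancedAt n al be j s' := by
      intro j hj hj'
      rcases Nat.lt_or_ge i j with hlt | hge
      · obtain rfl : j = i + 1 := by omega
        exact balancedAt_congr (fun t ht => (hs' t (by omega)).symm) hb
      · exact balancedAt_congr (fun t ht => (hs' t (by omega)).symm) (hbal j hj hge)
    rw [turns_one] at hT ht2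
    refine ⟨by simp [h4, e1, hi], Runs.seq (Runs.setVar (Runs.seq (Runs.branch ?_ ?_)))⟩
    · intro hc
      simp [a7, a8, h19, hX] at hc
      have hne : ¬ s' i = s' (i + 1) := fun h => by rw [if_pos h] at hT; omega
      rw [if_neg hne] at hT ht2
      -- The cuts overwrite the input in the real memory, which is no longer read at this stage.
      refine Runs.seq (Runs.setReal (Runs.setVar (Runs.seq (Runs.setVar (Runs.setVar ?_)))))
      refine ⟨by simp [h4], by simp; omega, s', by simp [a8, h19, hX], hn', hbal',
        by simp [h20, ht2], ?_⟩
      rw [ht2, cutsBefore_succ, if_neg hne, hc1, ← himg, Finset.range_add_one, Finset.image_insert]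
      simp only [Memory.setV_reals, eval_var, Memory.setV_v, realEval_div, realEval_ofInt, eval_add,
        eval_lit, h20, h4, e1, Nat.reduceEqDiff, reduceIte, OfNat.one_ne_ofNat]
      rw [Function.update_self]
      congr 1
      · push_cast; rfl
      · apply Finset.image_congr
        intro y hy
        simp only [Finset.coe_range, Set.mem_Iio] at hy
        exact Function.update_of_ne hy.ne _ _
    · intro hc
      simp [a7, a8, h19, hX] at hc
      have heq : s' i = s' (i + 1) := by
        by_contra h
        rw [if_neg h] at hT
        omega
      rw [if_pos heq] at hT ht2
      refine Runs.nop (Runs.seq (Runs.setVar (Runs.setVar ?_)))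
      refine ⟨by simp [h4], by simp; omega, s', by simp [a8, h19, hX], hn', hbal',
        by simp [h20, ht2], ?_⟩
      rw [ht2, cutsBefore_succ, if_pos heq, hc1, ← himg]
      simp
  · rintro τ t hf ⟨h4, ht, s, h19, hn, hbal, h20, himg⟩
    have e1 : τ.v 1 = m := by rw [hf.v 1 (by simp)]; simp [h1]
    refine ⟨by simp [h4, e1], Runs.setVar ⟨⟨s, by omega, hbal, ?_⟩, by simp; omega⟩⟩
    have : (τ.setV 0 ((var 20).eval τ)).ints 0 = turns s 0 m := by
      change (τ.setV 0 ((var 20).eval τ)).v 0 = _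
      simp [h20]
    rw [outputCuts, this, Memory.setV_reals, himg]
    rfl

/-! ### Choosing the grid and rounding the blocks. -/

/-- The real cell with the left (`c = 1`) or right (`c = 2`) endpoint of the block of agent `2`. -/
def endpoint (c : ℕ) : RealExpr := .cell (.add (.add (var 2) (var 2)) (.lit c))

/-- Finds the number of cells of the grid. -/
def gridProg : Program :=
  .seq (setVar 1 (.lit 1)) <| .seq (setVar 2 (.lit 0)) <|
  .loop (.ltInt (var 2) (var 0)) <|
    .seq (.loop (.ltReal (.mul (.mul (.ofInt (var 1)) (.cell (.lit 0)))
      (.sub (endpoint 2) (endpoint 1))) (.ofInt (.lit 4)))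
      (setVar 1 (.add (var 1) (.lit 1)))) <|
    setVar 2 (.add (var 2) (.lit 1))

/-- The number of cells is only increased, and it is never reset between agents. This keeps it at
most any `B` that suffices for all of them and makes the time linear in `n + B`; `B` itself is not
known to the program. -/
theorem gridProg_runs {n B : ℕ} {σ : Memory} (h0 : σ.v 0 = n) (hB : 1 ≤ B)
    (hpos : ∀ i < n, 0 ≤ σ.reals 0 * (σ.reals (2 * i + 2) - σ.reals (2 * i + 1)))
    (hBi : ∀ i < n, 4 ≤ (B : ℝ) * σ.reals 0 * (σ.reals (2 * i + 2) - σ.reals (2 * i + 1))) :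
    Runs gridProg σ (fun σ' t => 1 ≤ σ'.v 1 ∧ σ'.v 1 ≤ B ∧
      (∀ i < n, 4 ≤ (σ'.v 1 : ℝ) * σ.reals 0 * (σ.reals (2 * i + 2) - σ.reals (2 * i + 1))) ∧
      t ≤ 200 * (n + B + 1)) := by
  refine Runs.seq (Runs.setVar (Runs.seq (Runs.setVar ?_)))
  refine Runs.for_ n (fun i τ t => τ.v 2 = i ∧ 1 ≤ τ.v 1 ∧ τ.v 1 ≤ B ∧
    (∀ j < i, 4 ≤ (τ.v 1 : ℝ) * σ.reals 0 * (σ.reals (2 * j + 2) - σ.reals (2 * j + 1))) ∧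
    t ≤ 100 * i + 100 * τ.v 1) ?_ ?_ ?_
  · simp [hB]
  · rintro i hi τ t hf ⟨h2, h1, h1', hj, ht⟩
    have e0 : τ.v 0 = n := by rw [hf.v 0 (by simp)]; simp [h0]
    have er : τ.reals = σ.reals := by rw [hf.reals (by simp)]; simp
    refine ⟨by simp [h2, e0, hi], Runs.seq ?_⟩
    refine Runs.while_ (fun τ' t' => τ.v 1 ≤ τ'.v 1 ∧ τ'.v 1 ≤ B ∧
      t' ≤ 100 * (τ'.v 1 - τ.v 1)) (fun τ' => B - τ'.v 1) ⟨le_rfl, h1', by simp⟩ ?_ ?_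
    · rintro τ' t' hf' ⟨g1, g2, gt⟩ hb
      have e2 : τ'.v 2 = i := by rw [hf'.v 2 (by simp), h2]
      have er' : τ'.reals = σ.reals := by rw [hf'.reals (by simp), er]
      simp only [endpoint, holds_ltReal, realEval_mul, realEval_sub, realEval_cell, realEval_ofInt,
        eval_add, eval_var, eval_lit, e2, er', ← two_mul] at hb
      have hlt : τ'.v 1 < B := by
        by_contra hcon
        push Not at hcon
        have h := hBi i hi
        have hc : (B : ℝ) ≤ τ'.v 1 := by exact_mod_cast hcon
        have := mul_le_mul_of_nonneg_right hc (hpos i hi)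
        push_cast at hb
        rw [mul_assoc] at h hb
        linarith
      refine Runs.setVar ?_
      simp [endpoint]
      omega
    · rintro τ' t' hf' ⟨g1, g2, gt⟩ hb
      have e2 : τ'.v 2 = i := by rw [hf'.v 2 (by simp), h2]
      have er' : τ'.reals = σ.reals := by rw [hf'.reals (by simp), er]
      simp only [endpoint, holds_ltReal, realEval_mul, realEval_sub, realEval_cell, realEval_ofInt,
        eval_add, eval_var, eval_lit, e2, er', ← two_mul, not_lt] at hb
      refine Runs.setVar ⟨by simp [e2], by simp; omega, by simp [g2], ?_, ?_⟩
      · intro j hj'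
        simp only [Memory.setV_v, OfNat.one_ne_ofNat, if_false]
        rcases Nat.lt_succ_iff_lt_or_eq.1 hj' with hlt | rfl
        · have h := hj j hlt
          have hc : (τ.v 1 : ℝ) ≤ τ'.v 1 := by exact_mod_cast g1
          have := mul_le_mul_of_nonneg_right hc (hpos j (by omega))
          rw [mul_assoc] at h ⊢
          linarith
        · push_cast at hb; exact hb
      · simp [endpoint]
        omega
  · rintro τ t hf ⟨h2, h1, h1', hj, ht⟩
    have e0 : τ.v 0 = n := by rw [hf.v 0 (by simp)]; simp [h0]
    refine ⟨by simp [h2, e0], h1, h1', hj, ?_⟩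
    simp
    omega

/-- Increases the variable `3` to the integer part of `m` times an endpoint. -/
def floorProg (c : ℕ) : Program :=
  .loop (.neg (.ltReal (.mul (.ofInt (var 1)) (endpoint c)) (.ofInt (.add (var 3) (.lit 1)))))
    (setVar 3 (.add (var 3) (.lit 1)))

/-- With no conversion from reals to integers, the integer part is found by counting up, in at most
`m` rounds because the endpoint is at most 1. -/
theorem floorProg_runs (c : ℕ) {σ : Memory} (h1 : σ.reals (2 * σ.v 2 + c) ≤ 1)
    (h3 : (σ.v 3 : ℝ) ≤ σ.v 1 * σ.reals (2 * σ.v 2 + c)) :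
    Runs (floorProg c) σ (fun σ' t => σ.v 3 ≤ σ'.v 3 ∧ σ'.v 3 ≤ σ.v 1 ∧
      (σ'.v 3 : ℝ) ≤ σ.v 1 * σ.reals (2 * σ.v 2 + c) ∧
      σ.v 1 * σ.reals (2 * σ.v 2 + c) < (σ'.v 3 : ℝ) + 1 ∧ t ≤ 100 * (σ.v 1 + 1)) := by
  have hm : ∀ x : ℕ, (x : ℝ) ≤ σ.v 1 * σ.reals (2 * σ.v 2 + c) → x ≤ σ.v 1 := by
    intro x hx
    have : (x : ℝ) ≤ σ.v 1 :=
      hx.trans (mul_le_of_le_one_right (Nat.cast_nonneg _) h1)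
    exact_mod_cast this
  refine Runs.while_ (fun τ t => σ.v 3 ≤ τ.v 3 ∧
    (τ.v 3 : ℝ) ≤ σ.v 1 * σ.reals (2 * σ.v 2 + c) ∧ t ≤ 100 * (τ.v 3 - σ.v 3))
    (fun τ => σ.v 1 - τ.v 3) ⟨le_rfl, h3, by simp⟩ ?_ ?_
  · rintro τ t hf ⟨g1, g2, gt⟩ hb
    have e1 : τ.v 1 = σ.v 1 := hf.v 1 (by simp)
    have e2 : τ.v 2 = σ.v 2 := hf.v 2 (by simp)
    have er : τ.reals = σ.reals := hf.reals (by simp)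
    simp only [endpoint, holds_neg, holds_ltReal, realEval_mul, realEval_cell, realEval_ofInt,
      eval_add, eval_var, eval_lit, e1, e2, er, ← two_mul, not_lt] at hb
    have := hm _ hb
    refine Runs.setVar ⟨⟨by simp; omega, by simpa using hb, ?_⟩, ?_⟩
    · simp [endpoint]; omega
    · simp; omega
  · rintro τ t hf ⟨g1, g2, gt⟩ hb
    have e1 : τ.v 1 = σ.v 1 := hf.v 1 (by simp)
    have e2 : τ.v 2 = σ.v 2 := hf.v 2 (by simp)
    have er : τ.reals = σ.reals := hf.reals (by simp)
    simp only [endpoint, holds_neg, holds_ltReal, realEval_mul, realEval_cell, realEval_ofInt,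
      eval_add, eval_var, eval_lit, e1, e2, er, ← two_mul, not_not] at hb
    have := hm _ g2
    refine ⟨g1, this, g2, by exact_mod_cast hb, ?_⟩
    simp [endpoint]
    omega

/-- Computes the cells of the endpoints and the last cell reached from each position. -/
def blocksProg : Program :=
  .seq (setVar 2 (.lit 0)) <| .loop (.ltInt (var 2) (var 0)) <|
    .seq (setVar 3 (.lit 0)) <| .seq (floorProg 1) <| .seq (setArr 1 (var 2) (var 3)) <|
    -- Variable `3` is not reset: the search for the right end continues from the integer part of
    -- the left end, which gives `al i ≤ be i` directly.
    .seq (floorProg 2) <| .seq (setArr 2 (var 2) (var 3)) <|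
    .seq (.branch (.ltInt (arr 3 (arr 1 (var 2))) (var 3)) (setArr 3 (arr 1 (var 2)) (var 3)) .nop) <|
    setVar 2 (.add (var 2) (.lit 1))

theorem blocksProg_runs {n m : ℕ} {σ : Memory} (h0 : σ.v 0 = n) (h1 : σ.v 1 = m)
    (h3 : ∀ p, σ.a 3 p = 0)
    (hR : ∀ i < n, 0 ≤ σ.reals (2 * i + 1) ∧ σ.reals (2 * i + 1) ≤ σ.reals (2 * i + 2) ∧
      σ.reals (2 * i + 2) ≤ 1) :
    Runs blocksProg σ (fun σ' t =>
      (∀ i < n, ((σ'.a 1 i : ℝ) ≤ m * σ.reals (2 * i + 1) ∧ m * σ.reals (2 * i + 1) < σ'.a 1 i + 1) ∧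
        ((σ'.a 2 i : ℝ) ≤ m * σ.reals (2 * i + 2) ∧ m * σ.reals (2 * i + 2) < σ'.a 2 i + 1) ∧
        σ'.a 1 i ≤ σ'.a 2 i ∧ σ'.a 2 i ≤ m ∧ σ'.a 2 i ≤ σ'.a 3 (σ'.a 1 i)) ∧
      (∀ p, σ'.a 3 p = 0 ∨ ∃ i < n, σ'.a 1 i = p ∧ σ'.a 2 i = σ'.a 3 p) ∧
      t ≤ 2000 * (n + 1) * (m + 1)) := by
  refine Runs.seq (Runs.setVar ?_)
  refine Runs.for_ n (fun i τ t => τ.v 2 = i ∧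
    (∀ j < i, ((τ.a 1 j : ℝ) ≤ m * σ.reals (2 * j + 1) ∧ m * σ.reals (2 * j + 1) < τ.a 1 j + 1) ∧
        ((τ.a 2 j : ℝ) ≤ m * σ.reals (2 * j + 2) ∧ m * σ.reals (2 * j + 2) < τ.a 2 j + 1) ∧
        τ.a 1 j ≤ τ.a 2 j ∧ τ.a 2 j ≤ m ∧ τ.a 2 j ≤ τ.a 3 (τ.a 1 j)) ∧
      (∀ p, τ.a 3 p = 0 ∨ ∃ j < i, τ.a 1 j = p ∧ τ.a 2 j = τ.a 3 p) ∧
      t ≤ i * (1900 * (m + 1))) ?_ ?_ ?_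
  · simp [h3]
  · rintro i hi τ t hf ⟨h2, hj, hp, ht⟩
    obtain ⟨r1, r2, r3⟩ := hR i hi
    have e0 : τ.v 0 = n := by rw [hf.v 0 (by simp [floorProg])]; simp [h0]
    have e1 : τ.v 1 = m := by rw [hf.v 1 (by simp [floorProg])]; simp [h1]
    have er : τ.reals = σ.reals := by rw [hf.reals (by simp [floorProg])]; simp
    refine ⟨by simp [h2, e0, hi], Runs.seq (Runs.setVar (Runs.seq ?_))⟩
    refine Runs.mono (floorProg_runs 1 ?_ ?_) ?_
    · simp [h2, er]; linarith
    · simp [h2, er, e1]; positivity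
    rintro τ₁ t₁ hf₁ ⟨-, f2, f3, f4, ft⟩
    simp [h2, er, e1] at f2 f3 f4 ft
    have hv₁ : ∀ x, x = 0 ∨ x = 1 ∨ x = 2 → τ₁.v x = τ.v x := by
      intro x hx
      rw [hf₁.v x (by rcases hx with rfl | rfl | rfl <;> simp [floorProg])]
      rcases hx with rfl | rfl | rfl <;> simp
    have ha₁ : ∀ j, 0 < j → j < 16 → τ₁.a j = τ.a j := by
      intro j h h'
      rw [hf₁.a j (by simp [floorProg, h, h'])]
      simp [h, h']
    have er₁ : τ₁.reals = σ.reals := by rw [hf₁.reals (by simp [floorProg])]; simp [er]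
    refine Runs.seq (Runs.setArr (Runs.seq ?_))
    refine Runs.mono (floorProg_runs 2 ?_ ?_) ?_
    · simp [hv₁ 2, h2, er₁]; exact r3
    · simp [hv₁ 2, hv₁ 1, e1, h2, er₁]
      exact f3.trans (by gcongr)
    rintro τ₂ t₂ hf₂ ⟨g1, g2, g3, g4, gt⟩
    simp [hv₁ 2, hv₁ 1, e1, h2, er₁] at g1 g2 g3 g4 gt
    have e2₂ : τ₂.v 2 = i := by rw [hf₂.v 2 (by simp [floorProg])]; simp [hv₁ 2, h2]
    have a1₂ : τ₂.a 1 = Function.update (τ.a 1) i (τ₁.v 3) := by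
      rw [hf₂.a 1 (by simp [floorProg])]; simp [hv₁ 2, h2, ha₁ 1]
    have a2₂ : τ₂.a 2 = τ.a 2 := by rw [hf₂.a 2 (by simp [floorProg])]; simp [ha₁ 2]
    have a3₂ : τ₂.a 3 = τ.a 3 := by rw [hf₂.a 3 (by simp [floorProg])]; simp [ha₁ 3]
    refine Runs.seq (Runs.setArr (Runs.seq ?_))
    simp only [eval_var, e2₂]
    -- the values after the update of the reached cells
    have finish : ∀ R : ℕ → ℕ, (∀ p, τ.a 3 p ≤ R p) → τ₂.v 3 ≤ R (τ₁.v 3) →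
        (∀ p, R p = τ.a 3 p ∧ (p ≠ τ₁.v 3 ∨ τ₂.v 3 ≤ τ.a 3 p) ∨ p = τ₁.v 3 ∧ R p = τ₂.v 3) →
        (∀ j < i + 1, ((Function.update (τ.a 1) i (τ₁.v 3) j : ℝ) ≤ m * σ.reals (2 * j + 1) ∧
          m * σ.reals (2 * j + 1) < Function.update (τ.a 1) i (τ₁.v 3) j + 1) ∧
          ((Function.update (τ.a 2) i (τ₂.v 3) j : ℝ) ≤ m * σ.reals (2 * j + 2) ∧
          m * σ.reals (2 * j + 2) < Function.update (τ.a 2) i (τ₂.v 3) j + 1) ∧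
          Function.update (τ.a 1) i (τ₁.v 3) j ≤ Function.update (τ.a 2) i (τ₂.v 3) j ∧
          Function.update (τ.a 2) i (τ₂.v 3) j ≤ m ∧
          Function.update (τ.a 2) i (τ₂.v 3) j ≤ R (Function.update (τ.a 1) i (τ₁.v 3) j)) ∧
        (∀ p, R p = 0 ∨ ∃ j < i + 1, Function.update (τ.a 1) i (τ₁.v 3) j = p ∧
          Function.update (τ.a 2) i (τ₂.v 3) j = R p) := by
      intro R hR1 hR2 hR3
      constructor
      · intro j hj'
        rcases Nat.lt_succ_iff_lt_or_eq.1 hj' with hlt | rfl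
        · simp only [Function.update_of_ne hlt.ne]
          obtain ⟨q1, q2, q3, q4, q5⟩ := hj j hlt
          exact ⟨q1, q2, q3, q4, q5.trans (hR1 _)⟩
        · simp only [Function.update_self]
          exact ⟨⟨f3, f4⟩, ⟨g3, g4⟩, g1, g2, hR2⟩
      · intro p
        rcases hR3 p with ⟨h, -⟩ | ⟨h, h'⟩
        · rw [h]
          rcases hp p with h' | ⟨j, hlt, q1, q2⟩
          · exact Or.inl h'
          · refine Or.inr ⟨j, by omega, ?_⟩
            rw [Function.update_of_ne hlt.ne, Function.update_of_ne hlt.ne]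
            exact ⟨q1, q2⟩
        · refine Or.inr ⟨i, by omega, ?_⟩
          rw [Function.update_self, Function.update_self]
          exact ⟨h.symm, h'.symm⟩
    refine Runs.branch ?_ ?_
    · intro hb
      simp [e2₂, a1₂, a3₂] at hb
      refine Runs.setArr (Runs.setVar ⟨by simp [e2₂], ?_⟩)
      have hfin := finish (Function.update (τ.a 3) (τ₁.v 3) (τ₂.v 3)) ?_ (by simp) ?_
      · refine ⟨?_, ?_, ?_⟩
        · simpa [a1₂, a2₂, a3₂, e2₂] using hfin.1
        · simpa [a1₂, a2₂, a3₂, e2₂] using hfin.2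
        · simp [add_mul]; omega
      · intro p
        rw [Function.update_apply]
        split_ifs with h
        · rw [h]; exact hb.le
        · exact le_rfl
      · intro p
        by_cases h : p = τ₁.v 3
        · right; subst h; simp
        · left; simp [h]
    · intro hb
      simp [e2₂, a1₂, a3₂] at hb
      refine Runs.nop (Runs.setVar ⟨by simp [e2₂], ?_⟩)
      have hfin := finish (τ.a 3) (fun p => le_rfl) hb ?_
      · refine ⟨?_, ?_, ?_⟩
        · simpa [a1₂, a2₂, a3₂, e2₂] using hfin.1
        · simpa [a1₂, a2₂, a3₂, e2₂] using hfin.2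
        · simp [add_mul]; omega
      · intro p
        by_cases h : p = τ₁.v 3
        · left; subst h; exact ⟨rfl, Or.inr hb⟩
        · left; exact ⟨rfl, Or.inl h⟩
  · rintro τ t hf ⟨h2, hj, hp, ht⟩
    have e0 : τ.v 0 = n := by rw [hf.v 0 (by simp [floorProg])]; simp [h0]
    refine ⟨by simp [h2, e0], hj, hp, ?_⟩
    have e : 2000 * (n + 1) * (m + 1) = n * (1900 * (m + 1)) + 100 * n * (m + 1) + 2000 * (m + 1) := by
      ring
    simp
    omega

end ConsensusHalving

/-! ### Counting states and steps, and the final assembly. -/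

namespace ConsensusHalving

/-- At most `d` of the positions that are reached over by a block extend beyond a given grid
point. -/
theorem card_reach_le {n m d k : ℕ} {C : SingleBlock n} (hC : C.HasMaxIntersection d)
    {al be reach : ℕ → ℕ} (hk : k < m)
    (hal : ∀ i : Fin n, m * C.left i < al i + 1) (hbe : ∀ i : Fin n, (be i : ℝ) ≤ m * C.right i)
    (hreach : ∀ p, reach p = 0 ∨ ∃ i < n, al i = p ∧ be i = reach p) :
    ((Finset.range k).filter (fun t => k < reach t)).card ≤ d := by
  classical
  have hm : (0 : ℝ) < m := by exact_mod_cast (Nat.zero_le k).trans_lt hk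
  have hagent : ∀ t ∈ (Finset.range k).filter (fun t => k < reach t),
      ∃ i : Fin n, al i = t ∧ be i = reach t := by
    intro t ht
    rw [Finset.mem_filter] at ht
    rcases hreach t with h | ⟨i, hi, h, h'⟩
    · omega
    · exact ⟨⟨i, hi⟩, h, h'⟩
  choose f hf hf' using hagent
  have hx : ((k : ℝ) / m) ∈ Set.Icc (0 : ℝ) 1 :=
    ⟨by positivity, by rw [div_le_one hm]; exact_mod_cast hk.le⟩
  refine le_trans ?_ (hC _ hx)
  rw [Set.ncard_eq_toFinset_card']
  -- Each live position is the rounded left end of some agent, so different positions have different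
  -- agents. From `al i + 1 ≤ k < be i` it follows that `k / m` lies strictly inside the block.
  refine Finset.card_le_card_of_surjOn (fun i : Fin n => al i) fun t ht => ?_
  refine ⟨f t ht, ?_, hf t ht⟩
  have h1 := hal (f t ht)
  have h2 := hbe (f t ht)
  rw [hf] at h1
  rw [hf'] at h2
  rw [Finset.mem_coe, Finset.mem_filter, Finset.mem_range] at ht
  have h3 : (t : ℝ) + 1 ≤ k := by exact_mod_cast ht.1
  have h4 : (k : ℝ) < reach t := by exact_mod_cast ht.2
  rw [Finset.mem_coe, Set.mem_toFinset, Set.mem_setOf_eq, SingleBlock.density,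
    Set.indicator_of_mem]
  · exact one_div_pos.2 (sub_pos.2 (C.left_lt_right _))
  · refine ⟨?_, ?_⟩
    · rw [lt_div_iff₀ hm]; linarith
    · rw [div_lt_iff₀ hm]; linarith

/-- As `1 + 1/N ≤ exp (1/N)` and `k ≤ 3N`, the factor contributed by the cells is at most `e^3 ≤
21`. -/
theorem codeCount_self_le {reach : ℕ → ℕ} {N : ℝ} (hN : 1 ≤ N) {k d : ℕ} (hk : (k : ℝ) ≤ 3 * N)
    (hd : ((Finset.range k).filter (fun t => k < reach t)).card ≤ d) :
    (codeCount reach k k : ℝ) ≤ 21 * N ^ d := by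
  have hN0 : 0 < N := by linarith
  have h1 : (1 + 1 / N) ^ k ≤ 21 := by
    calc (1 + 1 / N) ^ k ≤ Real.exp (1 / N) ^ k := by
          gcongr
          linarith [Real.add_one_le_exp (1 / N)]
      _ = Real.exp (k / N) := by rw [← Real.exp_nat_mul]; congr 1; ring
      _ ≤ Real.exp 3 := by
          apply Real.exp_le_exp.2
          rwa [div_le_iff₀ hN0]
      _ = Real.exp 1 ^ 3 := by rw [← Real.exp_nat_mul]; norm_num
      _ ≤ 2.7182818286 ^ 3 := by gcongr; exact Real.exp_one_lt_d9.le
      _ ≤ 21 := by norm_num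
  calc (codeCount reach k k : ℝ) ≤ N ^ _ * (1 + 1 / N) ^ k := codeCount_le hN k
    _ ≤ N ^ d * 21 := by
        have := pow_le_pow_right₀ hN hd
        gcongr
    _ = 21 * N ^ d := mul_comm _ _

/-- The algorithm: choose a grid, round the blocks to it, compute by dynamic programming how few
sign changes suffice, and follow the optimal decisions. -/
def halvingProg : Program := .seq gridProg (.seq blocksProg (.seq tableProg traceProg))

/-- The dominating term is layers times states times cost per state, of order `N · N^d · (N + n)`.
Since `N` and `n` are at least 1, the last factor is at most a constant times `N n`; the other terms
are absorbed in the same way. -/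
theorem steps_le {n m B S : ℕ} {N : ℝ} {d : ℕ} (hn : 0 < n) (hN : 1 ≤ N) (hB : (B : ℝ) ≤ 3 * N)
    (hm : m ≤ B) (hS : (S : ℝ) ≤ 21 * N ^ d) :
    ((200 * (n + B + 1) + (2000 * (n + 1) * (m + 1) +
      ((m * (S * (30000 * (m + n + 2)) + 1000 * (m + 1)) + 100) + 1000 * (m + 1))) : ℕ) : ℝ) ≤
      20000000 * (N ^ (d + 2) * n * (n + d)) := by
  have hn1 : (1 : ℝ) ≤ n := by exact_mod_cast hn
  have hm' : (m : ℝ) ≤ 3 * N := le_trans (by exact_mod_cast hm) hB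
  have hX : 1 ≤ N ^ d := one_le_pow₀ hN
  set X := N ^ d
  have hNn : N ≤ N * n := le_mul_of_one_le_right (by linarith) hn1
  have hnN : (n : ℝ) ≤ N * n := le_mul_of_one_le_left (by linarith) hN
  have hNN : N * n ≤ N * (N * n) := le_mul_of_one_le_left (by positivity) hN
  have hXN : N * (N * n) ≤ X * (N * (N * n)) := le_mul_of_one_le_left (by positivity) hX
  have hmain : (m : ℝ) * (S * (30000 * (m + n + 2))) ≤ 3 * N * (21 * X * (30000 * (6 * (N * n)))) := by
    gcongr
    linarith
  have hblocks : (2000 * (n + 1) * (m + 1) : ℝ) ≤ 2000 * (2 * n) * (4 * N) := by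
    gcongr <;> linarith
  have hsweep : (m : ℝ) * (1000 * (m + 1)) ≤ 3 * N * (1000 * (4 * (N * n))) := by
    gcongr
    linarith
  -- The factor `n + d` of the bound enters only through being at least 1.
  have hlast : X * (N * (N * n)) ≤ X * (N * (N * n)) * (n + d) := by
    refine le_mul_of_one_le_right (by positivity) ?_
    have : (0 : ℝ) ≤ d := Nat.cast_nonneg d
    linarith
  have hrw : N ^ (d + 2) * n * (n + d) = X * (N * (N * n)) * (n + d) := by
    simp only [X, pow_add]; ring
  rw [hrw]
  push_cast
  rw [mul_add (m : ℝ)]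
  nlinarith

theorem halvingProg_runs {n : ℕ} (C : SingleBlock n) {ε M : ℝ} {d : ℕ} (hn : 0 < n) (hε : 0 < ε)
    (hεM : ε ≤ 2 * M) (hM : C.HasMaxValue M) (hd : C.HasMaxIntersection d) :
    Runs halvingProg (inputMemory C ε) (fun σ t => IsSolution C.valuation ε (outputCuts σ) ∧
      (t : ℝ) ≤ 20000000 * ((2 * M / ε) ^ (d + 2) * n * (n + d))) := by
  have hN : 1 ≤ 2 * M / ε := by rwa [le_div_iff₀ hε, one_mul]
  -- The density at the midpoint of the block, the inverse of its length, is at most `M`.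
  have hlen : ∀ i, 1 ≤ M * (C.right i - C.left i) := by
    intro i
    have hlt := C.left_lt_right i
    have h := hM i ((C.left i + C.right i) / 2)
      ⟨by linarith [C.left_nonneg i], by linarith [C.right_le_one i]⟩
    rw [SingleBlock.density, Set.indicator_of_mem (Set.mem_Ioo.2 ⟨by linarith, by linarith⟩),
      div_le_iff₀ (by linarith)] at h
    exact h
  set N := 2 * M / ε with hNdef
  -- This many cells suffice: `B ε ≥ 4 M`, and `M` times the length of a block is at least 1. The
  -- ceiling costs at most `1 ≤ N`, whence the bound `3 N`.
  set B := ⌈2 * N⌉₊ with hBdef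
  have hB1 : 1 ≤ B := Nat.one_le_iff_ne_zero.2 fun h => by
    have := Nat.le_ceil (2 * N); rw [← hBdef, h] at this; simp at this; linarith
  have hB : (B : ℝ) ≤ 3 * N := by
    have := (Nat.ceil_lt_add_one (a := 2 * N) (by linarith)).le
    linarith
  have hBε : 4 * M ≤ B * ε := by
    have := mul_le_mul_of_nonneg_right (Nat.le_ceil (2 * N)) hε.le
    have e : 2 * N * ε = 4 * M := by rw [hNdef]; field_simp; ring
    linarith
  -- the input
  have hv0 : (inputMemory C ε).v 0 = n := by simp [Memory.v, inputMemory]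
  have ha : ∀ j, 0 < j → ∀ p, (inputMemory C ε).a j p = 0 := by
    intro j hj p
    simp only [Memory.a, inputMemory]
    rw [if_neg (by omega)]
  have hr0 : (inputMemory C ε).reals 0 = ε := by simp [inputMemory]
  have hr1 : ∀ i : Fin n, (inputMemory C ε).reals (2 * i + 1) = C.left i := by
    intro i
    simp [inputMemory, Nat.mul_add_mod]
  have hr2 : ∀ i : Fin n, (inputMemory C ε).reals (2 * i + 2) = C.right i := by
    intro i
    have e : (2 * (i : ℕ) + 1) / 2 = i := by omega
    simp [inputMemory, e]
  generalize inputMemory C ε = σ at *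
  refine Runs.seq (Runs.mono (gridProg_runs (B := B) hv0 hB1 ?_ ?_) ?_)
  · intro i hi
    rw [hr0, hr1 ⟨i, hi⟩, hr2 ⟨i, hi⟩]
    exact mul_nonneg hε.le (sub_nonneg.2 (C.left_lt_right _).le)
  · intro i hi
    rw [hr0, hr1 ⟨i, hi⟩, hr2 ⟨i, hi⟩]
    have := mul_le_mul_of_nonneg_right hBε (sub_nonneg.2 (C.left_lt_right ⟨i, hi⟩).le)
    linarith [hlen ⟨i, hi⟩]
  rintro σ₁ t₁ hf₁ ⟨hm1, hmB, hfine, ht₁⟩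
  have hv0₁ : σ₁.v 0 = n := by rw [hf₁.v 0 (by simp [gridProg]), hv0]
  have hr₁ : σ₁.reals = σ.reals := hf₁.reals (by simp [gridProg])
  have ha₁ : ∀ j, 0 < j → j < 16 → ∀ p, σ₁.a j p = 0 := by
    intro j h h' p
    rw [hf₁.a j (by simp [gridProg, h, h']), ha j h]
  generalize hm : σ₁.v 1 = m at *
  refine Runs.seq (Runs.mono (blocksProg_runs hv0₁ hm (ha₁ 3 (by norm_num) (by norm_num)) ?_) ?_)
  · intro i hi
    rw [hr₁, hr1 ⟨i, hi⟩, hr2 ⟨i, hi⟩]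
    exact ⟨C.left_nonneg _, (C.left_lt_right _).le, C.right_le_one _⟩
  rintro σ₂ t₂ hf₂ ⟨hblocks, hreach, ht₂⟩
  have hv0₂ : σ₂.v 0 = n := by rw [hf₂.v 0 (by simp [blocksProg, floorProg]), hv0₁]
  have hv1₂ : σ₂.v 1 = m := by rw [hf₂.v 1 (by simp [blocksProg, floorProg]), hm]
  have ha₂ : ∀ p, σ₂.a 7 p = 0 := by
    intro p
    rw [hf₂.a 7 (by simp [blocksProg, floorProg]), ha₁ 7 (by norm_num) (by norm_num)]
  rw [hr₁] at hblocks
  have hal : ∀ i : Fin n, (σ₂.a 1 i : ℝ) ≤ m * C.left i ∧ m * C.left i < σ₂.a 1 i + 1 := by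
    intro i; rw [← hr1 i]; exact (hblocks i i.2).1
  have hbe : ∀ i : Fin n, (σ₂.a 2 i : ℝ) ≤ m * C.right i ∧ m * C.right i < σ₂.a 2 i + 1 := by
    intro i; rw [← hr2 i]; exact (hblocks i i.2).2.1
  have hS : ∀ k < m, codeCount (σ₂.a 3) k k ≤ ⌊21 * N ^ d⌋₊ := by
    intro k hk
    apply Nat.le_floor
    refine codeCount_self_le hN ?_
      (card_reach_le hd hk (fun i => (hal i).2) (fun i => (hbe i).1) hreach)
    exact le_trans (by exact_mod_cast hk.le.trans hmB) hB
  have hSle : ((⌊21 * N ^ d⌋₊ : ℕ) : ℝ) ≤ 21 * N ^ d := Nat.floor_le (by positivity)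
  have hreachm : ∀ p, σ₂.a 3 p ≤ m := by
    intro p
    rcases hreach p with h | ⟨i, hi, -, h⟩
    · omega
    · rw [← h]; exact (hblocks i hi).2.2.2.1
  refine Runs.seq (Runs.mono (tableProg_runs (fun i hi => (hblocks i hi).2.2.2.2) hreachm hS
    hv0₂ hv1₂ rfl rfl rfl (ha₂ 0) (ha₂ 1)) ?_)
  rintro σ₃ t₃ hf₃ ⟨hv15, hcorrect, ht₃⟩
  have hv1₃ : σ₃.v 1 = m := by
    rw [hf₃.v 1 (by simp [tableProg, weightsProg, avoids_layerProg_var]), hv1₂]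
  -- The topological existence result is needed only here: it bounds the table value at the start by
  -- `n`. Normalising the first sign to `false` singles out the one entry from which the trace
  -- begins.
  have hstart : σ₃.a 7 (2 * offset (σ₂.a 3) m 0) ≤ n := by
    obtain ⟨s, hs0, hs, hbal⟩ := exists_balanced m n (σ₂.a 1) (σ₂.a 2)
      (fun i hi => (hblocks i hi).2.2.1) (fun i hi => (hblocks i hi).2.2.2.1)
    have h := (hcorrect 0 (Nat.zero_le m) s).1 ?_
    · have e : entry (σ₂.a 3) m 0 s = 2 * offset (σ₂.a 3) m 0 := by simp [entry, code, hs0]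
      rw [e] at h
      exact h.trans hs
    · intro j _ _ i hi hij hlt
      have := hbal i hi
      rw [hij] at this
      omega
  refine Runs.mono (traceProg_runs hv1₃ hv15 hcorrect hstart) ?_
  rintro σ₄ t₄ - ⟨⟨s, hs, hbal, hout⟩, ht₄⟩
  have hcells : ∀ i : Fin n, 4 ≤ m * ε * (C.right i - C.left i) := by
    intro i
    have := hfine i i.2
    rwa [hr0, hr1, hr2] at this
  refine ⟨?_, ?_⟩
  · rw [hout]
    refine isSolution_gridCuts C (σ₂.a 1) (σ₂.a 2) s hm1 hcells hal hbe hs fun i hi => ?_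
    rcases Nat.eq_zero_or_pos (σ₂.a 2 i) with h | h
    · intro j _ hj hlt
      omega
    · exact hbal _ h (hblocks i hi).2.2.2.1
  · refine le_trans ?_ (steps_le hn hN hB hmB hSle)
    exact_mod_cast Nat.add_le_add ht₁ (Nat.add_le_add ht₂ (Nat.add_le_add ht₃ ht₄))

end ConsensusHalving

theorem theorem4p3 :
    ∃ (P : ConsensusHalving.Program) (K : ℝ),
      ∀ (n : ℕ) (C : ConsensusHalving.SingleBlock n) (ε M : ℝ) (d : ℕ),
        0 < n → 0 < ε → ε ≤ 2 * M → C.HasMaxValue M → C.HasMaxIntersection d →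
          ∃ (σ : ConsensusHalving.Memory) (T : ℕ),
            ConsensusHalving.Exec P (ConsensusHalving.inputMemory C ε) σ T ∧
            ConsensusHalving.IsSolution C.valuation ε (ConsensusHalving.outputCuts σ) ∧
            (T : ℝ) ≤ K * ((2 * M / ε) ^ (d + 2) * n * (n + d)) :=
  ⟨ConsensusHalving.halvingProg, 20000000, fun _ C _ _ _ hn hε hεM hM hd =>
    ConsensusHalving.halvingProg_runs C hn hε hεM hM hd⟩
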